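/- **Setting.** A square is a closed axis-aligned square $[\ell_\rho,r_\rho]\times[b_\rho,t_\rho]\subset\mathbb{R}^2$ with $r_\rho-\ell_\rho=t_\rho-b_\rho>0$. Let $\mathcal{R}$ be a finite dynamic set of squares and let $R_i\subseteq\mathcal{R}$ ($i\in\mathbb{N}$) be its *conflict sets*, finitely many of which are nonempty. At any time, let $m=|\mathcal{R}|$, let $z=\sum_i|R_i|$, let $k$ be the number of nonempty conflict sets, and let $l$ be the maximum, over $\rho\in\mathcal{R}$, of the number of conflict sets containing $\rho$. It is assumed that $k\le m$ at all times. The operations are: * $\mathrm{Insert}(\rho)$: insert the square $\rho$ into $\mathcal{R}$; * $\mathrm{Delete}(\rho)$: delete $\rho$ from $\mathcal{R}$ and from every $R_i$ in which it occurs; * $\mathrm{Insert}(\rho,R_i)$, for $\rho\in\mathcal{R}$: insert $\rho$ into $R_i$ (creating $R_i$ if it was empty); * $\mathrm{Delete}(\rho,R_i)$: delete $\rho$ from $R_i$; * $\mathrm{Query}(\sigma,R_i,C)$, for a square $\sigma=[\ell_\sigma,r_\sigma]\times[b_\sigma,t_\sigma]$ whose center is not above the center of any square of $\mathcal{R}$,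 and a horizontal segment $C=[\ell_C,r_C]\times\{y_C\}$ with $\ell_C\le r_C$ and $y_C\le b_\sigma$: return a square $\rho\in\mathcal{R}\setminus R_i$ that intersects $\sigma$ and does not contain $C$, or report that there is none. **Model.** Algorithms are finite programs in a deterministic first-order functional language with recursion, whose values are binary trees with empty or real-valued leaves. Each construction or decomposition of a pair, comparison ($\le$) or arithmetic operation ($+,-,\times$) on reals, rational constant, variable access, variable binding and function call counts as one step. (There is no mutable memory and no rounding; each step takes constant time on a real RAM.) The size of a value is its number of tree nodes. **Lemma.** There are a deterministic data structure (one program, used for all inputs) and an absolute constant $K$ such that the following holds. Every $\mathcal{R}$ with conflict sets as above, $k\le m$, has a representation (for $\mathcal{R}=\emptyset$, the empty value) such that, for every finite sequence of operations starting from it, all queries are answered correctly; the size of the structure is at all times at most $K\,(m+z+1)\log^3(m+2)$; and the total number of steps is at most $K$ times the sum, over the operations of the sequence, of * $\max(1,l)\,\log^3(m+2)$ for each $\mathrm{Insert}(\rho)$ and each $\mathrm{Delete}(\rho)$, * $\log^3(m+2)$ for each $\mathrm{Insert}(\rho,R_i)$, each $\mathrm{Delete}(\rho,R_i)$ and each $\mathrm{Query}(\sigma,R_i,C)$,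 where $m$ and $l$ are the values immediately before the operation, and $m$ and $z$ in the size bound are the current values. That is, the size is $O((m+z)\log^3 m)$ and the amortized times are $O(l\log^3 m)$ for inserting or deleting a square and $O(\log^3 m)$ for the other operations. -/

import Mathlib

namespace SquareDS

/-! ### Squares, segments, conflict sets -/

/-- A (closed, axis-aligned) square `[left, right] × [bottom, top]` in the plane. -/
@[ext]
structure Square where
  left : ℝ
  right : ℝ
  bottom : ℝ
  top : ℝ
  left_lt_right : left < right
  sides_eq : right - left = top - bottom

noncomputable instance : DecidableEq Square := Classical.decEq _

/-- The points of a square. -/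
def Square.toSet (ρ : Square) : Set (ℝ × ℝ) :=
  Set.Icc ρ.left ρ.right ×ˢ Set.Icc ρ.bottom ρ.top

/-- The `y`-coordinate of the center of a square. -/
noncomputable def Square.centerY (ρ : Square) : ℝ := (ρ.bottom + ρ.top) / 2

/-- A horizontal line segment `[left, right] × {height}`. -/
@[ext]
structure HSegment where
  left : ℝ
  right : ℝ
  height : ℝ
  left_le_right : left ≤ right

/-- The points of a horizontal segment. -/
def HSegment.toSet (C : HSegment) : Set (ℝ × ℝ) :=
  Set.Icc C.left C.right ×ˢ {C.height}

/-- A set of squares together with finitely many nonempty conflict sets. Conflict sets are named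
by natural numbers; `(i, ρ) ∈ incidences` means that `ρ` belongs to the conflict set `R_i`. -/
structure Config where
  squares : Finset Square
  incidences : Finset (ℕ × Square)

namespace Config

/-- The empty configuration. -/
def empty : Config := ⟨∅, ∅⟩

/-- The conflict set `R_i`. -/
noncomputable def conflictSet (c : Config) (i : ℕ) : Finset Square :=
  (c.incidences.filter fun p => p.1 = i).image Prod.snd

/-- The names of the nonempty conflict sets. -/
def labels (c : Config) : Finset ℕ := c.incidences.image Prod.fst

/-- The number of squares. -/
def m (c : Config) : ℕ := c.squares.card

/-- The number of (nonempty) conflict sets. -/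
def k (c : Config) : ℕ := c.labels.card

/-- The total size of the conflict sets. -/
noncomputable def z (c : Config) : ℕ := ∑ i ∈ c.labels, (c.conflictSet i).card

/-- The maximum number of conflict sets in which a single square appears. -/
noncomputable def l (c : Config) : ℕ :=
  c.squares.sup fun ρ => (c.labels.filter fun i => ρ ∈ c.conflictSet i).card

end Config

/-! ### The operations -/

/-- The five operations: insert or delete a square, insert or delete a square in the conflict
set `R_i`, and the query with a square `σ`, a conflict set `R_i` and a segment `C`. -/
inductive Op where
  | insert (ρ : Square)
  | delete (ρ : Square)
  | insertConflict (ρ : Square) (i : ℕ)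
  | deleteConflict (ρ : Square) (i : ℕ)
  | query (σ : Square) (i : ℕ) (C : HSegment)

/-- The effect of an operation. Deleting a square also removes it from all conflict sets. -/
noncomputable def Config.apply (c : Config) : Op → Config
  | .insert ρ => ⟨Insert.insert ρ c.squares, c.incidences⟩
  | .delete ρ => ⟨c.squares.erase ρ, c.incidences.filter fun p => p.2 ≠ ρ⟩
  | .insertConflict ρ i => ⟨c.squares, Insert.insert (i, ρ) c.incidences⟩
  | .deleteConflict ρ i => ⟨c.squares, c.incidences.erase (i, ρ)⟩
  | .query _ _ _ => c

/-- When an operation may be issued: only squares that are present enter conflict sets; the center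
of a query square lies below the centers of all squares, and the segment lies below the query
square. -/
def Config.Allows (c : Config) : Op → Prop
  | .insertConflict ρ _ => ρ ∈ c.squares
  | .query σ _ C => (∀ ρ ∈ c.squares, σ.centerY ≤ ρ.centerY) ∧ C.height ≤ σ.bottom
  | _ => True

/-- The standing assumptions: conflict sets are subsets of the set of squares, and there are at most
as many conflict sets as squares. -/
def Config.WellFormed (c : Config) : Prop :=
  (∀ i, c.conflictSet i ⊆ c.squares) ∧ c.k ≤ c.m

/-- `c.Valid ops`: starting from `c`, all operations may be issued in turn, and the standing
assumptions hold after each of them. -/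
def Config.Valid (c : Config) : List Op → Prop
  | [] => True
  | op :: ops => c.Allows op ∧ (c.apply op).WellFormed ∧ (c.apply op).Valid ops

/-- The configuration reached from `c` by a sequence of operations. -/
noncomputable def Config.applyAll (c : Config) (ops : List Op) : Config :=
  ops.foldl Config.apply c

/-- `ρ` is a correct positive answer to the query with `σ`, `R_i` and `C`. -/
def Config.IsHit (c : Config) (σ : Square) (i : ℕ) (C : HSegment) (ρ : Square) : Prop :=
  ρ ∈ c.squares ∧ (ρ.toSet ∩ σ.toSet).Nonempty ∧ ρ ∉ c.conflictSet i ∧ ¬ C.toSet ⊆ ρ.toSet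

/-! ### The machine model

A first-order functional language over binary trees ("cons cells") whose atoms are real numbers.
There is no mutable memory, no address arithmetic and no rounding. Each evaluation step applies one
constructor, projection, comparison or arithmetic operation to values held by reference, or binds a
value to a variable, so it takes constant time on a real RAM. -/

/-- Values: binary trees whose leaves are empty or carry a real number. -/
inductive Val where
  | nil
  | num (x : ℝ)
  | pair (u w : Val)

/-- The number of cells of a value (shared subtrees are counted with multiplicity). -/
def Val.size : Val → ℕ
  | .nil => 1
  | .num _ => 1
  | .pair u w => u.size + w.size + 1

/-- Arithmetic operations on real numbers. -/
inductive Arith where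
  | add
  | sub
  | mul

/-- The meaning of the arithmetic operations. -/
noncomputable def Arith.eval : Arith → ℝ → ℝ → ℝ
  | .add, x, y => x + y
  | .sub, x, y => x - y
  | .mul, x, y => x * y

/-- Expressions. Variables are de Bruijn indices; `call f e` calls the `f`-th function of the
program with the value of `e` as its only argument. -/
inductive Expr where
  | var (n : ℕ)
  | nil
  | const (q : ℚ)
  | pair (a b : Expr)
  | arith (o : Arith) (a b : Expr)
  | letIn (a body : Expr)
  | ifLe (a b yes no : Expr)
  | casePair (a yes no : Expr)
  | call (f : ℕ) (a : Expr)

/-- `Eval F env e v t`: with the (mutually recursive) function bodies `F` and the variables bound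
to `env`, the expression `e` evaluates to `v` in exactly `t` steps. An ill-typed or nonterminating
evaluation has no result. -/
inductive Eval (F : List Expr) : List Val → Expr → Val → ℕ → Prop where
  | var {env n v} (h : env[n]? = some v) : Eval F env (.var n) v 1
  | nil {env} : Eval F env .nil .nil 1
  | const {env} (q : ℚ) : Eval F env (.const q) (.num (q : ℝ)) 1
  | pair {env a b u w s t} (ha : Eval F env a u s) (hb : Eval F env b w t) :
      Eval F env (.pair a b) (.pair u w) (s + t + 1)
  | arith {env a b x y s t} (o : Arith) (ha : Eval F env a (.num x) s)
      (hb : Eval F env b (.num y) t) :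
      Eval F env (.arith o a b) (.num (o.eval x y)) (s + t + 1)
  | letIn {env a body u v s t} (ha : Eval F env a u s) (hb : Eval F (u :: env) body v t) :
      Eval F env (.letIn a body) v (s + t + 1)
  | ifLe_yes {env a b yes no x y v r s t} (ha : Eval F env a (.num x) r)
      (hb : Eval F env b (.num y) s) (hxy : x ≤ y) (h : Eval F env yes v t) :
      Eval F env (.ifLe a b yes no) v (r + s + t + 1)
  | ifLe_no {env a b yes no x y v r s t} (ha : Eval F env a (.num x) r)
      (hb : Eval F env b (.num y) s) (hxy : ¬ x ≤ y) (h : Eval F env no v t) :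
      Eval F env (.ifLe a b yes no) v (r + s + t + 1)
  | casePair_yes {env a yes no u w v s t} (ha : Eval F env a (.pair u w) s)
      (h : Eval F (u :: w :: env) yes v t) :
      Eval F env (.casePair a yes no) v (s + t + 1)
  | casePair_no {env a yes no p v s t} (ha : Eval F env a p s)
      (hp : ∀ u w, p ≠ .pair u w) (h : Eval F env no v t) :
      Eval F env (.casePair a yes no) v (s + t + 1)
  | call {env f a body u v s t} (ha : Eval F env a u s) (hf : F[f]? = some body)
      (h : Eval F [u] body v t) :
      Eval F env (.call f a) v (s + t + 1)

/-- Evaluation is deterministic, in its result and in its number of steps. -/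
theorem Eval.deterministic {F : List Expr} {env : List Val} {e : Expr} {v v' : Val} {t t' : ℕ}
    (h : Eval F env e v t) (h' : Eval F env e v' t') : v = v' ∧ t = t' := by
  induction h generalizing v' t' with
  | var h => cases h' with | var h2 => simp_all
  | nil => cases h'; simp
  | const q => cases h'; simp
  | pair _ _ iha ihb =>
    cases h' with
    | pair ha' hb' => obtain ⟨rfl, rfl⟩ := iha ha'; obtain ⟨rfl, rfl⟩ := ihb hb'; simp
  | arith o _ _ iha ihb =>
    cases h' with
    | arith _ ha' hb' =>
      obtain ⟨h1, rfl⟩ := iha ha'; obtain ⟨h2, rfl⟩ := ihb hb'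
      cases h1; cases h2; simp
  | letIn _ _ iha ihb =>
    cases h' with
    | letIn ha' hb' => obtain ⟨rfl, rfl⟩ := iha ha'; obtain ⟨rfl, rfl⟩ := ihb hb'; simp
  | ifLe_yes _ _ hxy _ iha ihb ih =>
    cases h' with
    | ifLe_yes ha' hb' _ h2 =>
      obtain ⟨_, rfl⟩ := iha ha'; obtain ⟨_, rfl⟩ := ihb hb'; obtain ⟨rfl, rfl⟩ := ih h2; simp
    | ifLe_no ha' hb' hn _ =>
      obtain ⟨h1, rfl⟩ := iha ha'; obtain ⟨h2, rfl⟩ := ihb hb'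
      cases h1; cases h2; exact absurd hxy hn
  | ifLe_no _ _ hxy _ iha ihb ih =>
    cases h' with
    | ifLe_no ha' hb' _ h2 =>
      obtain ⟨_, rfl⟩ := iha ha'; obtain ⟨_, rfl⟩ := ihb hb'; obtain ⟨rfl, rfl⟩ := ih h2; simp
    | ifLe_yes ha' hb' hn _ =>
      obtain ⟨h1, rfl⟩ := iha ha'; obtain ⟨h2, rfl⟩ := ihb hb'
      cases h1; cases h2; exact absurd hn hxy
  | casePair_yes _ _ iha ih =>
    cases h' with
    | casePair_yes ha' h2 =>
      obtain ⟨h1, rfl⟩ := iha ha'; cases h1; obtain ⟨rfl, rfl⟩ := ih h2; simp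
    | casePair_no ha' hp _ => exact absurd (iha ha').1.symm (hp _ _)
  | casePair_no _ hp _ iha ih =>
    cases h' with
    | casePair_yes ha' _ => exact absurd (iha ha').1 (hp _ _)
    | casePair_no ha' _ h2 =>
      obtain ⟨_, rfl⟩ := iha ha'; obtain ⟨rfl, rfl⟩ := ih h2; simp
  | call _ hf _ iha ih =>
    cases h' with
    | call ha' hf' h2 =>
      obtain ⟨rfl, rfl⟩ := iha ha'
      rw [hf] at hf'; cases hf'
      obtain ⟨rfl, rfl⟩ := ih h2; simp

/-! ### Data structures -/

/-- A square is passed as its four coordinates. -/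
def Square.encode (ρ : Square) : Val :=
  .pair (.num ρ.left) (.pair (.num ρ.right) (.pair (.num ρ.bottom) (.num ρ.top)))

/-- A horizontal segment is passed as its three coordinates. -/
def HSegment.encode (C : HSegment) : Val :=
  .pair (.num C.left) (.pair (.num C.right) (.num C.height))

/-- An implementation: a finite program, consisting of auxiliary functions and one expression for
each operation. -/
structure Implementation where
  funs : List Expr
  insert : Expr
  delete : Expr
  insertConflict : Expr
  deleteConflict : Expr
  query : Expr

/-- `D.Step c v op v' t`: if the stored value is `v` and represents the configuration `c`, then the
operation `op` takes `t` steps, is answered correctly, and the stored value afterwards is `v'`.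
A query returns the new stored value together with its answer, `nil` meaning that no square
qualifies. -/
def Implementation.Step (D : Implementation) (c : Config) (v : Val) (op : Op) (v' : Val) (t : ℕ) :
    Prop :=
  match op with
  | .insert ρ => Eval D.funs [v, ρ.encode] D.insert v' t
  | .delete ρ => Eval D.funs [v, ρ.encode] D.delete v' t
  | .insertConflict ρ i => Eval D.funs [v, ρ.encode, .num (i : ℝ)] D.insertConflict v' t
  | .deleteConflict ρ i => Eval D.funs [v, ρ.encode, .num (i : ℝ)] D.deleteConflict v' t
  | .query σ i C => ∃ ans : Val,
      Eval D.funs [v, σ.encode, .num (i : ℝ), C.encode] D.query (.pair v' ans) t ∧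
      ((∃ ρ, c.IsHit σ i C ρ ∧ ans = ρ.encode) ∨ ((∀ ρ, ¬ c.IsHit σ i C ρ) ∧ ans = .nil))

/-- `D.Run c v ops v' t`: with stored value `v` for the configuration `c`, the sequence `ops` is
carried out, all queries being answered correctly, in `t` steps in total; the stored value
afterwards is `v'`. -/
inductive Implementation.Run (D : Implementation) : Config → Val → List Op → Val → ℕ → Prop where
  | nil {c v} : D.Run c v [] v 0
  | cons {c v op ops v' v'' s t} (h : D.Step c v op v' s)
      (hs : D.Run (c.apply op) v' ops v'' t) : D.Run c v (op :: ops) v'' (s + t)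

/-- `log³ m`, with `m + 2` in place of `m` so that it is positive for all `m`. -/
noncomputable def logCubed (m : ℕ) : ℝ := Real.log ((m : ℝ) + 2) ^ 3

/-- The amortized time bound of an operation that is issued in the configuration `c`. -/
noncomputable def Config.opBound (c : Config) : Op → ℝ
  | .insert _ => max 1 (c.l : ℝ) * logCubed c.m
  | .delete _ => max 1 (c.l : ℝ) * logCubed c.m
  | .insertConflict _ _ => logCubed c.m
  | .deleteConflict _ _ => logCubed c.m
  | .query _ _ _ => logCubed c.m

/-- The sum of the amortized time bounds along a sequence of operations that starts in `c`. -/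
noncomputable def Config.totalBound (c : Config) : List Op → ℝ
  | [] => 0
  | op :: ops => c.opBound op + (c.apply op).totalBound ops

/-- The bound `(m + z) log³ m` on the size (`+ 1` for the empty structure). -/
noncomputable def Config.sizeBound (c : Config) : ℝ :=
  ((c.m : ℝ) + (c.z : ℝ) + 1) * logCubed c.m

end SquareDS

/-! A square becomes the point (x, y, w) = (left, -right, bottom); its top is determined by these. A
point with label -1 records that the square is present, a point with label i that it belongs to R_i.
The center of σ is not above that of ρ, so the top of ρ is at least the bottom of σ and at least the
height of C, and the upper side of ρ never matters. Hence ρ meets σ iff x, y, w are at most three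
numbers given by σ, and ρ fails to contain C iff one of x, y, w exceeds a number given by C
(`Config.isHit_iff`). A query is therefore three searches in boxes that are bounded on both sides in
one coordinate and only from above in the other two. Three cyclically rotated copies of the point
set make the two-sided coordinate the first one each time.

Being outside R_i is expressed by counting. Every point with label i has a companion with label -1
at the same position, so the points with label -1 in a box minus those with label i count the
squares of the box outside R_i (`sum_surplus`). These counts come from a range tree of three levels:
the outer one is ordered by (x, y, w), the middle one by (label, y), the inner one by (w, x, y,
label), and inner nodes carry cardinalities. A prefix count costs one logarithm per level
(`cnt_spec`), and selection by rank in the outer tree finds the first free square beyond the lower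
bound (`sel_spec`, `find_spec`).

Trees are kept balanced by partial rebuilding. A node built from N points counts the updates c it
has seen and is rebuilt as soon as 4c > N, so a child never exceeds 3/4 of the bound of its parent.
Since the inner order can be read off the innermost payload without sorting, rebuilding n points at
level d costs n log^(d-1) n. The potential c * `unitPotential d N` pays for it (`balance_spec`), and
an update at level d costs log^d amortized (`upd_tree`). Freshly built trees have potential 0, so
every initial configuration has a representation without debt.

In the inner order the label comes last, so all points of one square are consecutive. Deleting a
square removes them one after another, at most l + 1 of them (`deleteAll_spec`). Finally k ≤ m gives
z ≤ m², so logarithms of the number of points are O(log m). Runs of the program are verified with a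
weakest-precondition calculus (`wp_sound`). -/

namespace SquareDS

/-! ### Symbolic evaluation -/

/-- The `f`-th function of `F`, applied to `u`, returns `v` in `t` steps. -/
def Fn (F : List Expr) (f : ℕ) (u v : Val) (t : ℕ) : Prop :=
  ∃ body, F[f]? = some body ∧ Eval F [u] body v t

/-- Case distinction on a value: pair or not. -/
def Val.onPair (v : Val) (yes : Val → Val → Prop) (no : Prop) : Prop :=
  match v with
  | .pair u w => yes u w
  | _ => no

/-- The value is a number satisfying `P`. -/
def Val.onNum (v : Val) (P : ℝ → Prop) : Prop :=
  match v with
  | .num x => P x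
  | _ => False

@[simp] theorem Val.onPair_pair (u w : Val) (yes no) : (Val.pair u w).onPair yes no = yes u w := rfl
@[simp] theorem Val.onPair_nil (yes no) : Val.nil.onPair yes no = no := rfl
@[simp] theorem Val.onNum_num (x : ℝ) (P) : (Val.num x).onNum P = P x := rfl

/-- The `n`-th entry of the environment satisfies `P`. -/
def lookup : List Val → ℕ → (Val → Prop) → Prop
  | [], _, _ => False
  | v :: _, 0, P => P v
  | _ :: env, n + 1, P => lookup env n P

/-- Weakest precondition: the expression evaluates to some value in some number of steps that
satisfy `Q`. -/
def wp (F : List Expr) : Expr → List Val → (Val → ℕ → Prop) → Prop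
  | .var n, env, Q => lookup env n fun v => Q v 1
  | .nil, _, Q => Q .nil 1
  | .const q, _, Q => Q (.num q) 1
  | .pair a b, env, Q =>
      wp F a env fun u s => wp F b env fun w t => Q (.pair u w) (s + t + 1)
  | .arith o a b, env, Q =>
      wp F a env fun u s => wp F b env fun w t =>
        u.onNum fun x => w.onNum fun y => Q (.num (o.eval x y)) (s + t + 1)
  | .letIn a body, env, Q =>
      wp F a env fun u s => wp F body (u :: env) fun v t => Q v (s + t + 1)
  | .ifLe a b yes no, env, Q =>
      wp F a env fun u r => wp F b env fun w s => u.onNum fun x => w.onNum fun y =>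
        (x ≤ y → wp F yes env fun v t => Q v (r + s + t + 1)) ∧
        (¬ x ≤ y → wp F no env fun v t => Q v (r + s + t + 1))
  | .casePair a yes no, env, Q =>
      wp F a env fun p s => p.onPair (fun u w => wp F yes (u :: w :: env) fun v t => Q v (s + t + 1))
        (wp F no env fun v t => Q v (s + t + 1))
  | .call f a, env, Q =>
      wp F a env fun u s => ∃ v t, Fn F f u v t ∧ Q v (s + t + 1)

theorem lookup_sound {env : List Val} {n : ℕ} {P : Val → Prop} (h : lookup env n P) :
    ∃ v, env[n]? = some v ∧ P v := by
  induction env generalizing n with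
  | nil => exact h.elim
  | cons a env ih =>
    cases n with
    | zero => exact ⟨a, rfl, h⟩
    | succ n => exact ih h

/-- Calls enter `wp` only through `Fn`, so structural induction on the expression suffices.
Recursion of the program is handled outside, by inductions that supply `Fn` for the recursive calls.
-/
theorem wp_sound {F : List Expr} {e : Expr} {env : List Val} {Q : Val → ℕ → Prop}
    (h : wp F e env Q) : ∃ v t, Eval F env e v t ∧ Q v t := by
  induction e generalizing env Q with
  | var n => obtain ⟨v, h1, h2⟩ := lookup_sound h; exact ⟨v, 1, .var h1, h2⟩
  | nil => exact ⟨_, _, .nil, h⟩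
  | const q => exact ⟨_, _, .const q, h⟩
  | pair a b iha ihb =>
    obtain ⟨u, s, hu, h⟩ := iha h
    obtain ⟨w, t, hw, h⟩ := ihb h
    exact ⟨_, _, .pair hu hw, h⟩
  | arith o a b iha ihb =>
    obtain ⟨u, s, hu, h⟩ := iha h
    obtain ⟨w, t, hw, h⟩ := ihb h
    cases u <;> try exact h.elim
    cases w <;> try exact h.elim
    exact ⟨_, _, .arith o hu hw, h⟩
  | letIn a b iha ihb =>
    obtain ⟨u, s, hu, h⟩ := iha h
    obtain ⟨w, t, hw, h⟩ := ihb h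
    exact ⟨_, _, .letIn hu hw, h⟩
  | ifLe a b y n iha ihb ihy ihn =>
    obtain ⟨u, s, hu, h⟩ := iha h
    obtain ⟨w, t, hw, h⟩ := ihb h
    match u, w, hu, hw, h with
    | .num x, .num z, hu, hw, h =>
    by_cases hxy : x ≤ z
    · obtain ⟨v, r, hv, h⟩ := ihy (h.1 hxy)
      exact ⟨_, _, .ifLe_yes hu hw hxy hv, h⟩
    · obtain ⟨v, r, hv, h⟩ := ihn (h.2 hxy)
      exact ⟨_, _, .ifLe_no hu hw hxy hv, h⟩
  | casePair a y n iha ihy ihn =>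
    obtain ⟨u, s, hu, h⟩ := iha h
    cases u with
    | pair u w =>
      obtain ⟨v, r, hv, h⟩ := ihy h
      exact ⟨_, _, .casePair_yes hu hv, h⟩
    | nil =>
      obtain ⟨v, r, hv, h⟩ := ihn h
      exact ⟨_, _, .casePair_no hu (by simp) hv, h⟩
    | num x =>
      obtain ⟨v, r, hv, h⟩ := ihn h
      exact ⟨_, _, .casePair_no hu (by simp) hv, h⟩
  | call f a iha =>
    obtain ⟨u, s, hu, v, t, ⟨body, hb, hv⟩, h⟩ := iha h
    exact ⟨_, _, .call hu hb hv, h⟩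

theorem Fn.of_wp {F : List Expr} {f : ℕ} {body : Expr} {u : Val} {Q : Val → ℕ → Prop}
    (hf : F[f]? = some body) (h : wp F body [u] Q) : ∃ v t, Fn F f u v t ∧ Q v t := by
  obtain ⟨v, t, hv, h⟩ := wp_sound h
  exact ⟨v, t, ⟨body, hf, hv⟩, h⟩

/-- `Fn.of_wp` for a known value and a bound on the number of steps. -/
theorem Fn.intro {F : List Expr} {f : ℕ} {body : Expr} {u v : Val} {B : ℕ}
    (hf : F[f]? = some body) (h : wp F body [u] fun v' t => v' = v ∧ t ≤ B) :
    ∃ t, Fn F f u v t ∧ t ≤ B := by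
  obtain ⟨v, t, hv, rfl, hB⟩ := Fn.of_wp hf h
  exact ⟨t, hv, hB⟩

attribute [simp] lookup wp Arith.eval

/-! ### Lists, comparison, and division with remainder -/

/-- A list as a value. -/
def encList {α : Type*} (f : α → Val) : List α → Val
  | [] => .nil
  | a :: l => .pair (f a) (encList f l)

@[simp] theorem encList_nil {α : Type*} (f : α → Val) : encList f [] = .nil := rfl
@[simp] theorem encList_cons {α : Type*} (f : α → Val) (a : α) (l : List α) :
    encList f (a :: l) = .pair (f a) (encList f l) := rfl

/-- The lexicographic comparison of two lists, up to the length of the shorter one. -/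
noncomputable def cmpList : List ℝ → List ℝ → ℤ
  | a :: l, b :: l' => if a ≤ b then if b ≤ a then cmpList l l' else -1 else 1
  | _, _ => 0

/-- Comparison of two lists of numbers. -/
def cmpE : Expr :=
  .casePair (.var 0)
    (.casePair (.var 0)
      (.casePair (.var 3)
        (.ifLe (.var 2) (.var 0)
          (.ifLe (.var 0) (.var 2) (.call 0 (.pair (.var 3) (.var 1))) (.const (-1)))
          (.const 1))
        (.const 0))
      (.const 0))
    .nil


theorem cmp_spec {F : List Expr} (hF : F[0]? = some cmpE) (a b : List ℝ) :
    ∃ t, Fn F 0 (.pair (encList .num a) (encList .num b)) (.num (cmpList a b)) t ∧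
      t ≤ 20 * a.length + 20 := by
  induction a generalizing b with
  | nil => exact Fn.intro hF (by simp [cmpE, cmpList])
  | cons x a ih =>
    cases b with
    | nil => exact Fn.intro hF (by simp [cmpE, cmpList])
    | cons y b =>
      obtain ⟨t, ht, hb⟩ := ih b
      refine Fn.intro hF ?_
      simp only [cmpE, cmpList, wp, lookup, encList_cons, Val.onPair_pair, Val.onNum_num]
      refine ⟨fun h1 => ⟨fun h2 => ⟨_, t, ht, ?_⟩, fun h2 => ?_⟩, fun h1 => ?_⟩
      · simp [h1, h2]; omega
      · simp [h1, h2]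
      · simp [h1]

/-- Equal lengths matter: a proper prefix also compares as 0. This is exploited for thresholds
shorter than a key, which constrain only its first coordinates. -/
theorem cmpList_of_length_eq {a b : List ℝ} (h : a.length = b.length) :
    (a < b ∧ cmpList a b = -1) ∨ (a = b ∧ cmpList a b = 0) ∨ (b < a ∧ cmpList a b = 1) := by
  induction a generalizing b with
  | nil => cases b <;> simp_all [cmpList]
  | cons x a ih =>
    cases b with
    | nil => simp at h
    | cons y b =>
      have := @ih b (by simpa using h)
      rw [cmpList, List.cons_lt_cons_iff, List.cons_lt_cons_iff, List.cons_eq_cons]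
      rcases lt_trichotomy x y with hxy | rfl | hxy
      · simp [hxy.le, not_le.2 hxy, hxy]
      · simpa using this
      · simp [not_le.2 hxy, hxy]

/-- Truncated comparison is monotone. -/
theorem cmpList_mono {a b t : List ℝ} (h : a.length = b.length) (hab : a ≤ b)
    (hb : cmpList b t ≤ 0) : cmpList a t ≤ 0 := by
  induction a generalizing b t with
  | nil => simp [cmpList]
  | cons x a ih =>
    cases b with
    | nil => simp at h
    | cons y b =>
      cases t with
      | nil => simp [cmpList]
      | cons z t =>
        rcases hab.lt_or_eq with hab | hab
        swap
        · rw [hab]; exact hb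
        rw [List.cons_lt_cons_iff] at hab
        rw [cmpList] at hb ⊢
        rcases hab with hxy | ⟨rfl, hlt⟩
        · by_cases hyz : y ≤ z
          · have h1 : x ≤ z := hxy.le.trans hyz
            have h2 : ¬ z ≤ x := not_le.2 (hxy.trans_le hyz)
            simp [h1, h2]
          · simp [hyz] at hb
        · by_cases hxz : x ≤ z
          · by_cases hzx : z ≤ x
            · simp only [hxz, hzx, if_true] at hb ⊢
              exact ih (by simpa using h) hlt.le hb
            · simp [hxz, hzx]
          · simp [hxz] at hb

/-- The length of a list. -/
def lenE : Expr :=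
  .casePair (.var 0) (.arith .add (.const 1) (.call 1 (.var 1))) (.const 0)

theorem len_spec {F : List Expr} (hF : F[1]? = some lenE) {α : Type*} (f : α → Val) (L : List α) :
    ∃ t, Fn F 1 (encList f L) (.num (L.length : ℝ)) t ∧ t ≤ 10 * L.length + 10 := by
  induction L with
  | nil => exact Fn.intro hF (by simp [lenE])
  | cons a L ih =>
    obtain ⟨t, ht, hb⟩ := ih
    refine Fn.intro hF ?_
    simp only [lenE, wp, lookup, encList_cons, Val.onPair_pair, Val.onNum_num]
    exact ⟨_, t, ht, by simp [add_comm], by simp; omega⟩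

/-- The entry of a list whose index is the integer part of a given number. -/
def nthE : Expr :=
  .casePair (.var 0)
    (.casePair (.var 0)
      (.ifLe (.const 1) (.var 3) (.call 3 (.pair (.var 1) (.arith .sub (.var 3) (.const 1))))
        (.var 0))
      .nil)
    .nil

/-- The index is a real number with integer part `k`, so the middle of a list of length n is
addressed by n * (1/2) without rounding. -/
theorem nth_spec {F : List Expr} (hF : F[3]? = some nthE) {α : Type*} (f : α → Val) (L : List α)
    (k : ℕ) (s : ℝ) (h1 : (k : ℝ) ≤ s) (h2 : s < k + 1) (a : α) (ha : L[k]? = some a) :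
    ∃ t, Fn F 3 (.pair (encList f L) (.num s)) (f a) t ∧ t ≤ 20 * L.length + 10 := by
  induction L generalizing k s with
  | nil => simp at ha
  | cons b L ih =>
    cases k with
    | zero =>
      refine Fn.intro hF ?_
      simp only [nthE, wp, lookup, encList_cons, Val.onPair_pair, Val.onNum_num]
      simp at h2 ha
      refine ⟨fun h => ?_, fun _ => ⟨by rw [ha], by simp⟩⟩
      norm_num at h; linarith
    | succ k =>
      obtain ⟨t, ht, hb⟩ := ih k (s - 1) (by push_cast at h1; linarith)
        (by push_cast at h2; linarith) (by simpa using ha)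
      refine Fn.intro hF ?_
      simp only [nthE, wp, lookup, encList_cons, Val.onPair_pair, Val.onNum_num]
      push_cast at h1
      have : (0 : ℝ) ≤ k := Nat.cast_nonneg k
      refine ⟨fun h => ⟨_, t, by simpa using ht, by simp; omega⟩, fun h => ?_⟩
      norm_num at h; linarith

/-- Distribution of a list onto two lists. -/
def splitE : Expr :=
  .casePair (.var 0)
    (.casePair (.call 4 (.var 1)) (.pair (.pair (.var 2) (.var 1)) (.var 0)) .nil)
    (.pair .nil .nil)

/-- The two lists exchange roles at every entry, which balances them without knowing the length. -/
theorem split_spec {F : List Expr} (hF : F[4]? = some splitE) {α : Type*} (f : α → Val)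
    (L : List α) : ∃ L₁ L₂ t, Fn F 4 (encList f L) (.pair (encList f L₁) (encList f L₂)) t ∧
      t ≤ 20 * L.length + 10 ∧ (L₁ ++ L₂).Perm L ∧ L₁.length = (L.length + 1) / 2 ∧
      L₂.length = L.length / 2 := by
  induction L with
  | nil =>
    obtain ⟨t, ht, hb⟩ := Fn.intro (u := encList f []) (v := .pair .nil .nil) (B := 10) hF
      (by simp [splitE])
    exact ⟨[], [], t, ht, by simpa using hb, by simp⟩
  | cons a L ih =>
    obtain ⟨L₁, L₂, t, ht, hb, hp, h1, h2⟩ := ih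
    obtain ⟨t', ht', hb'⟩ := Fn.intro (u := encList f (a :: L))
        (v := .pair (encList f (a :: L₂)) (encList f L₁)) (B := 20 * (a :: L).length + 10) hF (by
      simp only [splitE, wp, lookup, encList_cons, Val.onPair_pair]
      exact ⟨_, t, ht, by simp; omega⟩)
    refine ⟨a :: L₂, L₁, t', ht', hb', ?_, by simp; omega, by simp; omega⟩
    exact (List.Perm.cons a (List.perm_append_comm.trans hp))

/-- Division with remainder of natural numbers. -/
def divModE : Expr :=
  .casePair (.var 0)
    (.ifLe (.var 1) (.var 0)
      (.casePair (.call 5 (.pair (.var 0) (.arith .add (.var 1) (.var 1))))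
        (.ifLe (.var 3) (.var 1)
          (.pair (.arith .add (.arith .add (.var 0) (.var 0)) (.const 1))
            (.arith .sub (.var 1) (.var 3)))
          (.pair (.arith .add (.var 0) (.var 0)) (.var 1)))
        .nil)
      (.pair (.const 0) (.var 0)))
    .nil

/-- Division by 2p gives a quotient q, and one comparison decides between 2q and 2q + 1. The
exponent `k` bounds the number of doublings, so the time is logarithmic. -/
theorem divMod_spec {F : List Expr} (hF : F[5]? = some divModE) (k n p : ℕ) (hp : 0 < p)
    (hk : n < p * 2 ^ k) :
    ∃ t, Fn F 5 (.pair (.num (n : ℝ)) (.num (p : ℝ))) (.pair (.num ((n / p : ℕ) : ℝ))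
      (.num ((n % p : ℕ) : ℝ))) t ∧ t ≤ 40 * k + 20 := by
  induction k generalizing p with
  | zero =>
    have hn : n < p := by simpa using hk
    refine Fn.intro hF ?_
    simp only [divModE, wp, lookup, Val.onPair_pair, Val.onNum_num]
    refine ⟨fun h => ?_, fun h => ?_⟩
    · exact absurd (Nat.cast_le.1 h) (not_le.2 hn)
    · simp [Nat.div_eq_of_lt hn, Nat.mod_eq_of_lt hn]
  | succ k ih =>
    obtain ⟨t, ht, hb⟩ := ih (p + p) (by omega) (by rw [pow_succ] at hk; linarith)
    refine Fn.intro hF ?_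
    simp only [divModE, wp, lookup, Val.onPair_pair, Val.onNum_num]
    refine ⟨fun h => ⟨_, t, by simpa using ht, ?_⟩, fun h => ?_⟩
    · have e1 := Nat.div_add_mod n (p + p)
      have e2 := Nat.mod_lt n (show 0 < p + p by omega)
      simp only [Val.onPair_pair, Val.onNum_num, Arith.eval]
      set q := n / (p + p)
      set r := n % (p + p)
      refine ⟨fun h' => ?_, fun h' => ?_⟩
      · have h' : p ≤ r := Nat.cast_le.1 h'
        have : n / p = q + q + 1 ∧ n % p = r - p := by
          rw [Nat.div_mod_unique hp]
          refine ⟨?_, by omega⟩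
          have : r = (r - p) + p := by omega
          nlinarith
        simp [this.1, this.2, Nat.cast_sub h']; omega
      · have h' : ¬ p ≤ r := fun h => h' (Nat.cast_le.2 h)
        have : n / p = q + q ∧ n % p = r := by
          rw [Nat.div_mod_unique hp]
          refine ⟨?_, by omega⟩
          nlinarith
        simp [this.1, this.2]; omega
    · have hn : n < p := by simpa using h
      simp [Nat.div_eq_of_lt hn, Nat.mod_eq_of_lt hn]

/-! ### Points and their keys -/

/-- A labelled point; label `-1` marks squares, label `i` marks members of the `i`-th conflict
set. -/
@[ext]
structure Pt where
  lab : ℝ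
  x : ℝ
  y : ℝ
  w : ℝ

noncomputable instance : DecidableEq Pt := Classical.decEq _

/-- A point as a value. -/
def Pt.enc (p : Pt) : Val := .pair (.num p.lab) (.pair (.num p.x) (.pair (.num p.y) (.num p.w)))

/-- The list of coordinates by which trees of level `d` are ordered. -/
def mkKey {α : Type} (d : ℕ) (lab x y w : α) : List α :=
  match d with
  | 1 => [w, x, y, lab]
  | 2 => [lab, y]
  | 3 => [x, y, w]
  | _ => []

/-- The key of a point at level `d`. -/
def key (d : ℕ) (p : Pt) : List ℝ := mkKey d p.lab p.x p.y p.w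

theorem key_length (d : ℕ) (p q : Pt) : (key d p).length = (key d q).length := by
  unfold key mkKey; split <;> rfl

/-- Only level 1 orders by all coordinates. At level 3 a square and its members in conflict sets
share a key, and keys repeat at level 2 as well; points whose key equals that of a node lie in its
payload but in neither subtree. -/
theorem key_one_injective : Function.Injective (key 1) := by
  intro p q h
  simp only [key, mkKey, List.cons.injEq, and_true] at h
  ext <;> tauto

/-! ### The program for trees -/

/-- A list of expressions as an expression. -/
def listE : List Expr → Expr
  | [] => .nil
  | a :: l => .pair a (listE l)

/-- A tree node. -/
def nodeE (k n c l r a : Expr) : Expr :=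
  .pair k (.pair n (.pair c (.pair l (.pair r a))))

/-- Case distinction on a tree. A node puts its parts into the environment: right subtree at `0`,
payload at `1`, left subtree at `2`, counter at `4`, initial size at `6`, key point at `8`. -/
def onNode (T yes no : Expr) : Expr :=
  .casePair T
    (.casePair (.var 1)
      (.casePair (.var 1) (.casePair (.var 1) (.casePair (.var 1) yes .nil) .nil) .nil) .nil) no

/-- Comparison of two points at level `d`. -/
def keyCmpE (d : ℕ) : Expr :=
  .casePair (.var 0) (.casePair (.var 0) (.casePair (.var 1) (.casePair (.var 1)
    (.casePair (.var 7) (.casePair (.var 1) (.casePair (.var 1)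
      (.call 0 (.pair (listE (mkKey d (.var 10) (.var 8) (.var 6) (.var 7)))
        (listE (mkKey d (.var 4) (.var 2) (.var 0) (.var 1)))))
    .nil) .nil) .nil) .nil) .nil) .nil) .nil

/-- Comparison of a point with a threshold at level `d`. -/
def thrCmpE (d : ℕ) : Expr :=
  .casePair (.var 0) (.casePair (.var 0) (.casePair (.var 1) (.casePair (.var 1)
    (.call 0 (.pair (listE (mkKey d (.var 4) (.var 2) (.var 0) (.var 1))) (.var 7)))
    .nil) .nil) .nil) .nil

/-- Update of a payload of level `0`. -/
def updZeroE : Expr :=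
  .casePair (.var 0) (.casePair (.var 1) (.arith .add (.var 2) (.var 1)) .nil) .nil

/-- Reconstruction of a tree whose root has seen too many updates. -/
def balanceE (d : ℕ) : Expr :=
  onNode (.var 0)
    (.ifLe (.arith .mul (.const 4) (.var 4)) (.var 6) (.var 10)
      (.call (12 * d + 3) (.call (12 * d + 4) (.var 10))))
    .nil

/-- Insertion or deletion of a point. -/
def updE (d : ℕ) : Expr :=
  .casePair (.var 0) (.casePair (.var 1) (onNode (.var 2)
    (.letIn (.call (12 * (d - 1) + 2) (.pair (.var 1) (.var 13)))
      (.letIn (.call (12 * d) (.pair (.var 11) (.var 9)))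
        (.call (8 + d)
          (.ifLe (.const 0) (.var 0)
            (.ifLe (.var 0) (.const 0)
              (nodeE (.var 10) (.var 8) (.arith .add (.var 6) (.const 1)) (.var 4) (.var 2) (.var 1))
              (nodeE (.var 10) (.var 8) (.arith .add (.var 6) (.const 1)) (.var 4)
                (.call (12 * d + 2) (.pair (.var 2) (.var 15))) (.var 1)))
            (nodeE (.var 10) (.var 8) (.arith .add (.var 6) (.const 1))
              (.call (12 * d + 2) (.pair (.var 4) (.var 15))) (.var 2) (.var 1))))))
    (.call (12 * d + 3) (.pair (.var 0) .nil))) .nil) .nil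

/-- Linear-time construction of a tree of level `1` from the first `n` entries of a sorted list;
also returns the rest of the list. -/
def buildAuxE : Expr :=
  .casePair (.var 0)
    (.ifLe (.const 1) (.var 0)
      (.letIn (.casePair (.call 5 (.pair (.arith .sub (.var 0) (.const 1)) (.const 2))) (.var 0) .nil)
        (.casePair (.call 6 (.pair (.var 0) (.var 2)))
          (.casePair (.var 1)
            (.casePair
              (.call 6 (.pair (.arith .sub (.arith .sub (.var 5) (.const 1)) (.var 4)) (.var 1)))
              (.pair (nodeE (.var 2) (.var 7) (.const 0) (.var 4) (.var 0) (.var 7)) (.var 1))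
              .nil)
            .nil)
          .nil))
      (.pair .nil (.var 1)))
    .nil

/-- The list of the points of a tree of level `1`, put in front of a given list. -/
def travE : Expr :=
  .casePair (.var 0)
    (onNode (.var 0)
      (.letIn (.call 7 (.pair (.var 0) (.var 11)))
        (.call 7 (.pair (.var 3)
          (.ifLe (.const 1)
            (.arith .sub (.var 2) (.arith .add (onNode (.var 3) (.var 1) (.const 0))
              (onNode (.var 1) (.var 1) (.const 0))))
            (.pair (.var 9) (.var 0)) (.var 0)))))
      (.var 1))
    .nil

/-- Construction of a tree from a list that is sorted at level `1`. -/
def buildE : ℕ → Expr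
  | 1 => .casePair (.call 6 (.pair (.call 1 (.var 0)) (.var 0))) (.var 0) .nil
  | d => .call (12 * d + 11) (.pair (.call (12 * d + 8) (.var 0)) (.var 0))

/-- The list of the points of a tree, sorted at level `1`. -/
def toListE : ℕ → Expr
  | 1 => .call 7 (.pair (.var 0) .nil)
  | d => onNode (.var 0) (.call (12 * (d - 1) + 4) (.var 1)) .nil

/-- The value of a query on the payload of the root. -/
def valE : ℕ → Expr
  | 1 => .casePair (.var 0) (onNode (.var 0) (.var 1) (.const 0)) .nil
  | 2 => .casePair (.var 0) (onNode (.var 0) (.call 18 (.pair (.var 1) (.var 11))) (.const 0)) .nil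
  | _ => .casePair (.var 0)
      (onNode (.var 0)
        (.casePair (.var 11) (.casePair (.var 1)
          (.arith .sub
            (.call 30 (.pair (.var 5) (.pair (listE [.const (-1), .var 0]) (.var 1))))
            (.arith .sub
              (.call 30 (.pair (.var 5) (.pair (listE [.var 2, .var 0]) (.var 1))))
              (.call 30 (.pair (.var 5)
                (.pair (listE [.arith .sub (.var 2) (.const (1 / 2)), .const 0]) (.var 1))))))
          .nil) .nil)
        (.const 0)) .nil

/-- The value of a query on the points up to a threshold. -/
def cntE (d : ℕ) : Expr :=
  .casePair (.var 0) (.casePair (.var 1) (onNode (.var 2)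
    (.ifLe (.call (12 * d + 1) (.pair (.var 8) (.var 10))) (.const 0)
      (.arith .add
        (.arith .sub (.call (12 * d + 5) (.pair (.var 12) (.var 11)))
          (.call (12 * d + 5) (.pair (.var 0) (.var 11))))
        (.call (12 * d + 6) (.pair (.var 0) (.var 13))))
      (.call (12 * d + 6) (.pair (.var 2) (.var 13))))
    (.const 0)) .nil) .nil

/-- Selection of a key by rank. -/
def selE (d : ℕ) : Expr :=
  .casePair (.var 0) (.casePair (.var 1) (onNode (.var 2)
    (.letIn (.call (12 * d + 5) (.pair (.var 2) (.var 11)))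
      (.ifLe (.var 0) (.var 11)
        (.letIn (.arith .sub (.call (12 * d + 5) (.pair (.var 13) (.var 12)))
            (.call (12 * d + 5) (.pair (.var 1) (.var 12))))
          (.ifLe (.var 0) (.var 12)
            (.call (12 * d + 7)
              (.pair (.var 2) (.pair (.arith .sub (.var 12) (.var 0)) (.var 13))))
            (.var 10)))
        (.call (12 * d + 7) (.pair (.var 3) (.var 14)))))
    .nil) .nil) .nil

/-- Merge sort. -/
def sortE (d : ℕ) : Expr :=
  .casePair (.var 0)
    (.casePair (.var 1)
      (.casePair (.call 4 (.var 4))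
        (.call (12 * d + 9) (.pair (.call (12 * d + 8) (.var 0)) (.call (12 * d + 8) (.var 1))))
        .nil)
      (.var 2))
    .nil

/-- Merging of sorted lists. -/
def mergeE (d : ℕ) : Expr :=
  .casePair (.var 0)
    (.casePair (.var 0)
      (.casePair (.var 3)
        (.ifLe (.call (12 * d) (.pair (.var 2) (.var 0))) (.const 0)
          (.pair (.var 2) (.call (12 * d + 9) (.pair (.var 3) (.var 5))))
          (.pair (.var 0) (.call (12 * d + 9) (.pair (.var 4) (.var 1)))))
        (.var 2))
      (.var 1))
    .nil

/-- The points of a list that are smaller (or larger) than a given point. -/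
def filtE (d : ℕ) : Expr :=
  .casePair (.var 0) (.casePair (.var 1)
    (.casePair (.var 1)
      (.letIn (.call (12 * d + 10) (.pair (.var 4) (.pair (.var 2) (.var 1))))
        (.ifLe (.const 1) (.arith .mul (.var 5) (.call (12 * d) (.pair (.var 1) (.var 3))))
          (.pair (.var 1) (.var 0)) (.var 0)))
      .nil) .nil) .nil

/-- Construction of a tree from two lists of the same points, sorted at level `d` and at
level `1`. -/
def buildRecE (d : ℕ) : Expr :=
  .casePair (.var 0)
    (.casePair (.var 0)
      (.letIn (.call 1 (.var 2))
        (.letIn (.call 3 (.pair (.var 3) (.arith .mul (.var 0) (.const (1 / 2)))))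
          (nodeE (.var 0) (.var 1) (.const 0)
            (.call (12 * d + 11) (.pair
              (.call (12 * d + 10) (.pair (.const (-1)) (.pair (.var 0) (.var 4))))
              (.call (12 * d + 10) (.pair (.const (-1)) (.pair (.var 0) (.var 5))))))
            (.call (12 * d + 11) (.pair
              (.call (12 * d + 10) (.pair (.const 1) (.pair (.var 0) (.var 4))))
              (.call (12 * d + 10) (.pair (.const 1) (.pair (.var 0) (.var 5))))))
            (.call (12 * (d - 1) + 3) (.var 5)))))
      .nil)
    .nil

/-- The functions that serve trees of level `d`. -/
def levelFuns (d : ℕ) : List Expr :=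
  [keyCmpE d, thrCmpE d, updE d, buildE d, toListE d, valE d, cntE d, selE d, sortE d, mergeE d,
    filtE d, buildRecE d]

/-- The functions for lists, numbers and trees. -/
def treeFuns : List Expr :=
  [cmpE, lenE, updZeroE, nthE, splitE, divModE, buildAuxE, travE, .nil, balanceE 1, balanceE 2,
    balanceE 3] ++
    levelFuns 1 ++ levelFuns 2 ++ levelFuns 3

/-! ### Trees as values -/

/-- An upper bound for the depth of a tree that was built from `n` points. -/
def depthBound : ℕ → ℕ
  | 0 => 0
  | n + 1 => 1 + depthBound (3 * (n + 1) / 4)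
decreasing_by omega

theorem depthBound_of_pos {n : ℕ} (hn : 0 < n) : depthBound n = 1 + depthBound (3 * n / 4) := by
  obtain ⟨n, rfl⟩ : ∃ k, n = k + 1 := ⟨n - 1, by omega⟩
  rw [depthBound]

theorem depthBound_mono {a b : ℕ} (h : a ≤ b) : depthBound a ≤ depthBound b := by
  induction b using Nat.strong_induction_on generalizing a with
  | _ b ih =>
    rcases Nat.eq_zero_or_pos a with rfl | ha
    · rw [depthBound]; exact Nat.zero_le _
    · rw [depthBound_of_pos ha, depthBound_of_pos (ha.trans_le h)]
      exact Nat.add_le_add_left (ih _ (by omega) (by omega)) 1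

/-- Used along every search path: with 4c ≤ N ≤ n, the bound N / 2 + c of a child is at most 3n / 4.
-/
theorem depthBound_succ_le {a n : ℕ} (hn : 0 < n) (h : a ≤ 3 * n / 4) :
    depthBound a + 1 ≤ depthBound n := by
  rw [depthBound_of_pos hn, add_comm]
  exact Nat.add_le_add_left (depthBound_mono h) 1

/-- The value of a tree node. -/
def nodeVal (k : Pt) (N c : ℕ) (l r a : Val) : Val :=
  .pair k.enc (.pair (.num N) (.pair (.num c) (.pair l (.pair r a))))

/-- The points with smaller key. -/
noncomputable def ptsBelow (key : Pt → List ℝ) (k : Pt) (P : Finset Pt) : Finset Pt :=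
  P.filter fun p => key p < key k

/-- The points with larger key. -/
noncomputable def ptsAbove (key : Pt → List ℝ) (k : Pt) (P : Finset Pt) : Finset Pt :=
  P.filter fun p => key k < key p

/-- `Tree key B R n s v P φ`: the value `v` is a search tree for the set `P` of points, built from
at most `n` points, with `s` nodes and potential `φ`. Every node carries a payload, described
by `R`, for all points of its subtree; its counter `c` counts the updates since it was built from
`N` points, and contributes `c * B N` to the potential. -/
inductive Tree (key : Pt → List ℝ) (B : ℕ → ℕ) (R : Val → Finset Pt → ℕ → Prop) :
    ℕ → ℕ → Val → Finset Pt → ℕ → Prop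
  | nil {n} : Tree key B R n 0 .nil ∅ 0
  | node {n N c sl sr k vl vr va P φl φr φa} (hN : 1 ≤ N) (hn : N ≤ n) (hc : 4 * c ≤ N)
      (hP : P.card ≤ n) (hPN : P.card ≤ N + c) (hNP : N ≤ P.card + c) (hs : sl + sr + 1 ≤ N + c)
      (hl : Tree key B R (N / 2 + c) sl vl (ptsBelow key k P) φl)
      (hr : Tree key B R (N / 2 + c) sr vr (ptsAbove key k P) φr)
      (ha : R va P φa) :
      Tree key B R n (sl + sr + 1) (nodeVal k N c vl vr va) P (c * B N + φl + φr + φa)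

/-- The constants of the time bounds for building a tree. -/
def buildConst : ℕ → ℕ
  | 0 => 0
  | 1 => 1000
  | d + 1 => 10 * buildConst d + 5000

/-- The potential of one update at a node of level `d`. -/
def unitPotential (d N : ℕ) : ℕ := (8 * buildConst d + 5000) * (depthBound (4 * N) + 1) ^ (d - 1)

/-- `Rep d v P φ`: the value `v` is a structure of level `d` for the set `P`, of potential `φ`. -/
def Rep : ℕ → Val → Finset Pt → ℕ → Prop
  | 0 => fun v P φ => v = .num (P.card : ℝ) ∧ φ = 0
  | d + 1 => fun v P φ =>
      ∃ s, Tree (key (d + 1)) (unitPotential (d + 1)) (Rep d) (2 * P.card) s v P φ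

/-! ### Evaluation of the functions for lists -/

/-- The program starts with the functions for lists, numbers and trees. -/
def HasTreeFuns (F : List Expr) : Prop := ∀ i < 48, F[i]? = treeFuns[i]?

theorem HasTreeFuns.level {F : List Expr} (hF : HasTreeFuns F) {d k : ℕ} (h1 : 1 ≤ d) (h3 : d ≤ 3)
    (hk : k < 12) : F[12 * d + k]? = (levelFuns d)[k]? := by
  rw [hF _ (by omega)]
  interval_cases d <;> interval_cases k <;> rfl

theorem keyCmp_spec {F : List Expr} (hF : HasTreeFuns F) {d : ℕ} (h1 : 1 ≤ d) (h3 : d ≤ 3)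
    (p q : Pt) :
    ∃ t, Fn F (12 * d) (.pair p.enc q.enc) (.num (cmpList (key d p) (key d q))) t ∧ t ≤ 200 := by
  obtain ⟨t, ht, hb⟩ := cmp_spec (hF 0 (by norm_num)) (key d p) (key d q)
  have hl : (key d p).length ≤ 4 := by unfold key mkKey; split <;> simp
  refine Fn.intro (hF.level h1 h3 (k := 0) (by norm_num)) ?_
  have e : wp F (keyCmpE d) [.pair p.enc q.enc] (fun v' t => v' =
      (.num (cmpList (key d p) (key d q))) ∧ t ≤ 200) := by
    interval_cases d <;> simp [keyCmpE, Pt.enc, mkKey, listE, key] at ht hl hb ⊢ <;>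
      exact ⟨t, ht, by omega⟩
  exact e

theorem thrCmp_spec {F : List Expr} (hF : HasTreeFuns F) {d : ℕ} (h1 : 1 ≤ d) (h3 : d ≤ 3)
    (p : Pt) (thr : List ℝ) :
    ∃ t, Fn F (12 * d + 1) (.pair p.enc (encList .num thr)) (.num (cmpList (key d p) thr)) t ∧
      t ≤ 200 := by
  obtain ⟨t, ht, hb⟩ := cmp_spec (hF 0 (by norm_num)) (key d p) thr
  have hl : (key d p).length ≤ 4 := by unfold key mkKey; split <;> simp
  refine Fn.intro (hF.level h1 h3 (k := 1) (by norm_num)) ?_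
  have e : wp F (thrCmpE d) [.pair p.enc (encList .num thr)] (fun v' t => v' =
      (.num (cmpList (key d p) thr)) ∧ t ≤ 200) := by
    interval_cases d <;> simp [thrCmpE, Pt.enc, mkKey, listE, key] at ht hl hb ⊢ <;>
      exact ⟨t, ht, by omega⟩
  exact e

theorem cmpList_key_nonpos (d : ℕ) (p q : Pt) :
    cmpList (key d p) (key d q) ≤ 0 ↔ key d p ≤ key d q := by
  rcases cmpList_of_length_eq (key_length d p q) with ⟨h, e⟩ | ⟨h, e⟩ | ⟨h, e⟩
  · rw [e]; simp [h.le]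
  · rw [e]; simp [h]
  · rw [e]; simp [h]

theorem cmpList_key_neg (d : ℕ) (p q : Pt) :
    1 ≤ -1 * cmpList (key d p) (key d q) ↔ key d p < key d q := by
  rcases cmpList_of_length_eq (key_length d p q) with ⟨h, e⟩ | ⟨h, e⟩ | ⟨h, e⟩
  · rw [e]; simp [h]
  · rw [e]; simp [h]
  · rw [e]; simp [h.le]

theorem cmpList_key_pos (d : ℕ) (p q : Pt) :
    1 ≤ 1 * cmpList (key d p) (key d q) ↔ key d q < key d p := by
  rcases cmpList_of_length_eq (key_length d p q) with ⟨h, e⟩ | ⟨h, e⟩ | ⟨h, e⟩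
  · rw [e]; simp [h.le]
  · rw [e]; simp [h]
  · rw [e]; simp [h]

/-! ### Sorting and filtering by the keys of a level. -/

/-- The list is sorted by the keys of level `d`. -/
def SortedBy (d : ℕ) (L : List Pt) : Prop := L.Pairwise fun p q => key d p ≤ key d q

theorem merge_spec {F : List Expr} (hF : HasTreeFuns F) {d : ℕ} (h1 : 1 ≤ d) (h3 : d ≤ 3)
    (L₁ L₂ : List Pt) (hL₁ : SortedBy d L₁) (hL₂ : SortedBy d L₂) :
    ∃ L t, Fn F (12 * d + 9) (.pair (encList Pt.enc L₁) (encList Pt.enc L₂)) (encList Pt.enc L) t ∧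
      t ≤ 300 * (L₁.length + L₂.length) + 20 ∧ L.Perm (L₁ ++ L₂) ∧ SortedBy d L := by
  have hf := hF.level h1 h3 (k := 9) (by norm_num)
  induction hn : L₁.length + L₂.length generalizing L₁ L₂ with
  | zero =>
    obtain ⟨rfl, rfl⟩ : L₁ = [] ∧ L₂ = [] := by
      constructor <;> apply List.eq_nil_of_length_eq_zero <;> omega
    obtain ⟨t, ht, hb⟩ := Fn.intro (u := .pair .nil .nil) (v := .nil) (B := 20) hf
      (by simp [mergeE])
    exact ⟨[], t, ht, by simpa using hb, .refl _, .nil⟩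
  | succ n ih =>
    match L₁, L₂ with
    | [], L₂ =>
      obtain ⟨t, ht, hb⟩ := Fn.intro (u := .pair .nil (encList Pt.enc L₂)) (v := encList Pt.enc L₂)
        (B := 20) hf (by simp [mergeE])
      exact ⟨L₂, t, ht, by omega, .refl _, hL₂⟩
    | p :: L₁, [] =>
      obtain ⟨t, ht, hb⟩ := Fn.intro (u := .pair (encList Pt.enc (p :: L₁)) .nil)
        (v := encList Pt.enc (p :: L₁)) (B := 20) hf (by simp [mergeE])
      exact ⟨p :: L₁, t, ht, by omega, by simp, hL₁⟩
    | p :: L₁, q :: L₂ =>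
      obtain ⟨s, hs, hsb⟩ := keyCmp_spec hF h1 h3 p q
      rw [SortedBy, List.pairwise_cons] at hL₁ hL₂
      simp only [List.length_cons] at hn
      by_cases hpq : key d p ≤ key d q
      · obtain ⟨L, t, ht, hb, hp, hL⟩ := ih L₁ (q :: L₂) hL₁.2
          (by rw [SortedBy, List.pairwise_cons]; exact hL₂) (by simp; omega)
        have hc := (cmpList_key_nonpos d p q).2 hpq
        obtain ⟨t', ht', hb'⟩ := Fn.intro
          (u := .pair (encList Pt.enc (p :: L₁)) (encList Pt.enc (q :: L₂)))
          (v := encList Pt.enc (p :: L)) (B := 300 * (n + 1) + 20) hf (by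
            simp only [mergeE, wp, lookup, encList_cons, Val.onPair_pair]
            refine ⟨_, s, hs, ?_⟩
            simp only [Val.onNum_num]
            refine ⟨fun _ => ⟨_, t, ht, rfl, by omega⟩, fun h => absurd ?_ h⟩
            simpa using hc)
        refine ⟨p :: L, t', ht', hb', by simpa using hp, List.pairwise_cons.2 ⟨fun r hr => ?_, hL⟩⟩
        rcases List.mem_append.1 (hp.mem_iff.1 hr) with hr | hr
        · exact hL₁.1 r hr
        · rcases List.mem_cons.1 hr with rfl | hr
          · exact hpq
          · exact hpq.trans (hL₂.1 r hr)
      · obtain ⟨L, t, ht, hb, hp, hL⟩ := ih (p :: L₁) L₂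
          (by rw [SortedBy, List.pairwise_cons]; exact hL₁) hL₂.2 (by simp; omega)
        have hc := mt (cmpList_key_nonpos d p q).1 hpq
        obtain ⟨t', ht', hb'⟩ := Fn.intro
          (u := .pair (encList Pt.enc (p :: L₁)) (encList Pt.enc (q :: L₂)))
          (v := encList Pt.enc (q :: L)) (B := 300 * (n + 1) + 20) hf (by
            simp only [mergeE, wp, lookup, encList_cons, Val.onPair_pair]
            refine ⟨_, s, hs, ?_⟩
            simp only [Val.onNum_num]
            refine ⟨fun h => absurd ?_ hc, fun _ => ⟨_, t, ht, rfl, by omega⟩⟩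
            simpa using h)
        have hqp : key d q ≤ key d p := (not_le.1 hpq).le
        refine ⟨q :: L, t', ht', hb', ?_, List.pairwise_cons.2 ⟨fun r hr => ?_, hL⟩⟩
        · exact (List.Perm.cons q hp).trans (List.perm_middle (l₁ := p :: L₁)).symm
        rcases List.mem_append.1 (hp.mem_iff.1 hr) with hr | hr
        · rcases List.mem_cons.1 hr with rfl | hr
          · exact hqp
          · exact hqp.trans (hL₁.1 r hr)
        · exact hL₂.1 r hr

theorem sort_spec {F : List Expr} (hF : HasTreeFuns F) {d : ℕ} (h1 : 1 ≤ d) (h3 : d ≤ 3)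
    (L : List Pt) :
    ∃ L' t, Fn F (12 * d + 8) (encList Pt.enc L) (encList Pt.enc L') t ∧
      t ≤ 700 * L.length * depthBound L.length + 20 ∧ L'.Perm L ∧ SortedBy d L' := by
  have hf := hF.level h1 h3 (k := 8) (by norm_num)
  induction hn : L.length using Nat.strong_induction_on generalizing L with
  | _ n ih =>
    match L with
    | [] =>
      obtain ⟨t, ht, hb⟩ := Fn.intro (u := .nil) (v := .nil) (B := 20) hf (by simp [sortE])
      exact ⟨[], t, ht, by omega, .refl _, .nil⟩
    | [p] =>
      obtain ⟨t, ht, hb⟩ := Fn.intro (u := encList Pt.enc [p]) (v := encList Pt.enc [p])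
        (B := 20) hf (by simp [sortE])
      exact ⟨[p], t, ht, by omega, .refl _, List.pairwise_singleton _ _⟩
    | p :: q :: L =>
      obtain ⟨L₁, L₂, t, ht, hb, hp, e1, e2⟩ := split_spec (hF 4 (by norm_num)) Pt.enc (p :: q :: L)
      rw [hn] at e1 e2 hb
      have hn2 : 2 ≤ n := by simp at hn; omega
      obtain ⟨L₁', t₁, ht₁, hb₁, hp₁, hs₁⟩ := ih _ (by omega) L₁ rfl
      obtain ⟨L₂', t₂, ht₂, hb₂, hp₂, hs₂⟩ := ih _ (by omega) L₂ rfl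
      obtain ⟨L', t', ht', hb', hp', hs'⟩ := merge_spec hF h1 h3 L₁' L₂' hs₁ hs₂
      -- Both halves have at most (n + 1) / 2 ≤ 3n / 4 entries because n ≥ 2, so the depth bound of
      -- the trees also bounds the depth of the recursion.
      have d1 := depthBound_succ_le (a := L₁.length) (n := n) (by omega) (by omega)
      have d2 := depthBound_succ_le (a := L₂.length) (n := n) (by omega) (by omega)
      rw [hp₁.length_eq, hp₂.length_eq] at hb'
      have hB : t + t₁ + t₂ + t' + 30 ≤ 700 * n * depthBound n + 20 := by
        have e3 : L₁.length + L₂.length = n := by omega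
        obtain ⟨k, hk⟩ : ∃ k, depthBound n = k + 1 := ⟨depthBound n - 1, by omega⟩
        rw [hk] at d1 d2 ⊢
        have h₁ : 700 * L₁.length * depthBound L₁.length ≤ 700 * L₁.length * k :=
          Nat.mul_le_mul_left _ (by omega)
        have h₂ : 700 * L₂.length * depthBound L₂.length ≤ 700 * L₂.length * k :=
          Nat.mul_le_mul_left _ (by omega)
        have : 700 * n * (k + 1) = 700 * L₁.length * k + 700 * L₂.length * k + 700 * n := by
          rw [← e3]; ring
        omega
      obtain ⟨t'', ht'', hb''⟩ := Fn.intro (u := encList Pt.enc (p :: q :: L))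
        (v := encList Pt.enc L') (B := 700 * n * depthBound n + 20) hf (by
          simp only [sortE, wp, lookup, encList_cons, Val.onPair_pair]
          refine ⟨_, t, ht, ?_⟩
          simp only [Val.onPair_pair]
          exact ⟨_, t₁, ht₁, _, t₂, ht₂, _, t', ht', rfl, by omega⟩)
      exact ⟨L', t'', ht'', hb'', hp'.trans ((hp₁.append hp₂).trans hp), hs'⟩

theorem filt_spec {F : List Expr} (hF : HasTreeFuns F) {d : ℕ} (h1 : 1 ≤ d) (h3 : d ≤ 3)
    (s : ℤ) (k : Pt) (L : List Pt) :
    ∃ t, Fn F (12 * d + 10) (.pair (.num s) (.pair k.enc (encList Pt.enc L)))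
      (encList Pt.enc (L.filter fun p => 1 ≤ s * cmpList (key d p) (key d k))) t ∧
      t ≤ 300 * L.length + 20 := by
  have hf := hF.level h1 h3 (k := 10) (by norm_num)
  induction L with
  | nil => exact Fn.intro hf (by simp [filtE])
  | cons p L ih =>
    obtain ⟨t, ht, hb⟩ := ih
    obtain ⟨s', hs, hsb⟩ := keyCmp_spec hF h1 h3 p k
    refine Fn.intro hf ?_
    simp only [filtE, wp, lookup, encList_cons, Val.onPair_pair, Val.onNum_num]
    refine ⟨_, t, ht, _, s', hs, ?_⟩
    simp only [Val.onNum_num, Arith.eval]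
    have e : (((1 : ℚ) : ℝ) ≤ s * (cmpList (key d p) (key d k) : ℝ)) ↔
        1 ≤ s * cmpList (key d p) (key d k) := by
      rw [← Int.cast_mul]; norm_num
      exact_mod_cast Iff.rfl
    refine ⟨fun h => ⟨?_, by simp; omega⟩, fun h => ⟨?_, by simp; omega⟩⟩
    · rw [List.filter_cons_of_pos (by simpa using e.1 h)]; rfl
    · rw [List.filter_cons_of_neg (by simpa using mt e.2 h)]

theorem filt_below_spec {F : List Expr} (hF : HasTreeFuns F) {d : ℕ} (h1 : 1 ≤ d) (h3 : d ≤ 3)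
    (k : Pt) (L : List Pt) :
    ∃ t, Fn F (12 * d + 10) (.pair (.num (-1)) (.pair k.enc (encList Pt.enc L)))
      (encList Pt.enc (L.filter fun p => key d p < key d k)) t ∧ t ≤ 300 * L.length + 20 := by
  obtain ⟨t, ht, hb⟩ := filt_spec hF h1 h3 (-1) k L
  simp only [cmpList_key_neg] at ht
  exact ⟨t, by simpa using ht, hb⟩

theorem filt_above_spec {F : List Expr} (hF : HasTreeFuns F) {d : ℕ} (h1 : 1 ≤ d) (h3 : d ≤ 3)
    (k : Pt) (L : List Pt) :
    ∃ t, Fn F (12 * d + 10) (.pair (.num 1) (.pair k.enc (encList Pt.enc L)))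
      (encList Pt.enc (L.filter fun p => key d k < key d p)) t ∧ t ≤ 300 * L.length + 20 := by
  obtain ⟨t, ht, hb⟩ := filt_spec hF h1 h3 1 k L
  simp only [cmpList_key_pos] at ht
  exact ⟨t, by simpa using ht, hb⟩

/-! ### Building trees -/

theorem below_subset (key : Pt → List ℝ) (k : Pt) (P : Finset Pt) : ptsBelow key k P ⊆ P :=
  Finset.filter_subset _ _

theorem above_subset (key : Pt → List ℝ) (k : Pt) (P : Finset Pt) : ptsAbove key k P ⊆ P :=
  Finset.filter_subset _ _

theorem disjoint_below_above (key : Pt → List ℝ) (k : Pt) (P : Finset Pt) :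
    Disjoint (ptsBelow key k P) (ptsAbove key k P) := by
  refine Finset.disjoint_filter.2 fun p _ h => not_lt.2 h.le

theorem card_below_add_card_above_le (key : Pt → List ℝ) (k : Pt) (P : Finset Pt) :
    (ptsBelow key k P).card + (ptsAbove key k P).card ≤ P.card := by
  rw [← Finset.card_union_of_disjoint (disjoint_below_above key k P)]
  exact Finset.card_le_card (Finset.union_subset (below_subset key k P) (above_subset key k P))

/-- The key of `k` itself lies on neither side. This makes the number of nodes of a fresh tree at
most the number of distinct keys, so that a rebuilt tree has no more nodes than its predecessor. -/
theorem card_image_below_add_above_lt (key : Pt → List ℝ) {k : Pt} {P : Finset Pt} (hk : k ∈ P) :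
    ((ptsBelow key k P).image key).card + ((ptsAbove key k P).image key).card + 1 ≤
      (P.image key).card := by
  have hd : Disjoint ((ptsBelow key k P).image key) ((ptsAbove key k P).image key) := by
    rw [Finset.disjoint_left]
    intro a ha hb
    obtain ⟨p, hp, rfl⟩ := Finset.mem_image.1 ha
    obtain ⟨q, hq, e⟩ := Finset.mem_image.1 hb
    have h1 := (Finset.mem_filter.1 hp).2
    have h2 := (Finset.mem_filter.1 hq).2
    rw [e] at h2
    exact absurd h1 (not_lt.2 h2.le)
  rw [← Finset.card_union_of_disjoint hd]
  have hk' : key k ∉ (ptsBelow key k P).image key ∪ (ptsAbove key k P).image key := by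
    intro h
    rcases Finset.mem_union.1 h with h | h
    · obtain ⟨p, hp, e⟩ := Finset.mem_image.1 h
      exact absurd (Finset.mem_filter.1 hp).2 (by rw [e]; exact lt_irrefl _)
    · obtain ⟨p, hp, e⟩ := Finset.mem_image.1 h
      exact absurd (Finset.mem_filter.1 hp).2 (by rw [e]; exact lt_irrefl _)
  rw [← Finset.card_insert_of_notMem hk']
  refine Finset.card_le_card (Finset.insert_subset (Finset.mem_image_of_mem _ hk)
    (Finset.union_subset ?_ ?_))
  · exact Finset.image_subset_image (below_subset key k P)
  · exact Finset.image_subset_image (above_subset key k P)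

theorem Tree.mono {key : Pt → List ℝ} {B : ℕ → ℕ} {R : Val → Finset Pt → ℕ → Prop}
    {n n' s : ℕ} {v : Val} {P : Finset Pt} {φ : ℕ} (h : Tree key B R n s v P φ) (hn : n ≤ n') :
    Tree key B R n' s v P φ := by
  cases h with
  | nil => exact .nil
  | node hN h1 hc hP hPN hNP hs hl hr ha =>
    exact .node hN (h1.trans hn) hc (hP.trans hn) hPN hNP hs hl hr ha

/-- Strictly sorted at level `1`. -/
def StrictSorted (L : List Pt) : Prop := L.Pairwise fun p q => key 1 p < key 1 q

theorem StrictSorted.nodup {L : List Pt} (h : StrictSorted L) : L.Nodup :=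
  List.Pairwise.imp (fun {p q} hpq e => absurd hpq (by rw [e]; exact lt_irrefl _)) h

theorem StrictSorted.filter {L : List Pt} (h : StrictSorted L) (p : Pt → Bool) :
    StrictSorted (L.filter p) := List.Pairwise.filter p h

theorem below_append {A B : List Pt} {k : Pt} (h : StrictSorted (A ++ k :: B)) :
    ptsBelow (key 1) k (A ++ k :: B).toFinset = A.toFinset := by
  rw [StrictSorted, List.pairwise_append, List.pairwise_cons] at h
  ext p
  simp only [ptsBelow, Finset.mem_filter, List.mem_toFinset, List.mem_append, List.mem_cons]
  refine ⟨fun hp => ?_, fun hp => ⟨.inl hp, h.2.2 p hp k (by simp)⟩⟩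
  rcases hp.1 with h' | rfl | h'
  · exact h'
  · exact absurd hp.2 (lt_irrefl _)
  · exact absurd hp.2 (not_lt.2 (h.2.1.1 p h').le)

theorem above_append {A B : List Pt} {k : Pt} (h : StrictSorted (A ++ k :: B)) :
    ptsAbove (key 1) k (A ++ k :: B).toFinset = B.toFinset := by
  rw [StrictSorted, List.pairwise_append, List.pairwise_cons] at h
  ext p
  simp only [ptsAbove, Finset.mem_filter, List.mem_toFinset, List.mem_append, List.mem_cons]
  refine ⟨fun hp => ?_, fun hp => ⟨.inr (.inr hp), h.2.1.1 p hp⟩⟩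
  rcases hp.1 with h' | rfl | h'
  · exact absurd hp.2 (not_lt.2 (h.2.2 p h' k (by simp)).le)
  · exact absurd hp.2 (lt_irrefl _)
  · exact h'

/-- Halving the number costs a logarithmic division at each node. The reserve 40 (log + 7) on the
left closes the induction: the two subtrees release it twice, which covers the division and one new
reserve, so the total stays linear. -/
theorem buildAux_spec {F : List Expr} (hF : HasTreeFuns F) (A L : List Pt) (hA : StrictSorted A) :
    ∃ v t, Fn F 6 (.pair (.num (A.length : ℝ)) (encList Pt.enc (A ++ L)))
        (.pair v (encList Pt.enc L)) t ∧
      Tree (key 1) (unitPotential 1) (Rep 0) A.length A.length v A.toFinset 0 ∧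
      t + 40 * (Nat.log 2 (A.length + 1) + 7) ≤ 300 * (A.length + 1) := by
  have hf : F[6]? = some buildAuxE := hF 6 (by norm_num)
  induction hn : A.length using Nat.strong_induction_on generalizing A L with
  | _ n ih =>
    rcases Nat.eq_zero_or_pos n with rfl | hpos
    · obtain rfl := List.eq_nil_of_length_eq_zero hn
      obtain ⟨t, ht, hb⟩ := Fn.intro (u := .pair (.num ((0 : ℕ) : ℝ)) (encList Pt.enc L))
        (v := .pair .nil (encList Pt.enc L)) (B := 20) hf (by
          simp only [buildAuxE, wp, lookup, Val.onPair_pair, Val.onNum_num]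
          refine ⟨fun h => ?_, fun _ => by simp⟩
          norm_num at h)
      exact ⟨.nil, t, ht, by simpa using Tree.nil, by simpa using by omega⟩
    · set a := (n - 1) / 2 with ha
      obtain ⟨A₁, k, A₂, rfl, e1⟩ : ∃ A₁ k A₂, A = A₁ ++ k :: A₂ ∧ A₁.length = a := by
        have hlt : a < A.length := by omega
        refine ⟨A.take a, A[a], A.drop (a + 1), ?_, by simp; omega⟩
        rw [← List.drop_eq_getElem_cons hlt, List.take_append_drop]
      have e2 : A₂.length = n - 1 - a := by simp at hn; omega
      have hA' := hA
      rw [StrictSorted, List.pairwise_append, List.pairwise_cons] at hA'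
      obtain ⟨v₁, t₁, ht₁, hT₁, hb₁⟩ := ih _ (by omega) A₁ (k :: A₂ ++ L) hA'.1 rfl
      obtain ⟨v₂, t₂, ht₂, hT₂, hb₂⟩ := ih _ (by omega) A₂ L hA'.2.1.2 rfl
      have hlog := Nat.lt_pow_succ_log_self (b := 2) (by norm_num) (n + 1)
      obtain ⟨t₀, ht₀, hb₀⟩ := divMod_spec (hF 5 (by norm_num)) (Nat.log 2 (n + 1)) (n - 1) 2
        (by norm_num) (by rw [pow_succ] at hlog; omega)
      have hl₁ : Nat.log 2 (A₁.length + 1) = Nat.log 2 (n + 1) - 1 := by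
        rw [← Nat.log_div_base]; congr 1; omega
      have hl₂ : Nat.log 2 (n + 1) - 1 ≤ Nat.log 2 (A₂.length + 1) := by
        rw [← hl₁]; exact Nat.log_mono_right (by omega)
      have ht₁' : Fn F 6 (.pair (.num ((n - 1) / 2 : ℕ)) (encList Pt.enc (A₁ ++ k :: A₂ ++ L)))
        (.pair v₁ (.pair k.enc (encList Pt.enc (A₂ ++ L)))) t₁ := by
        rw [← ha, ← e1]; simpa using ht₁
      have hc : (((n - 1 : ℕ) : ℝ)) = n - 1 := by push_cast [Nat.cast_sub hpos]; ring
      have ht₂' : Fn F 6 (.pair (.num ((n : ℝ) - 1 - ((n - 1) / 2 : ℕ))) (encList Pt.enc (A₂ ++ L)))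
        (.pair v₂ (encList Pt.enc L)) t₂ := by
        have : (n : ℝ) - 1 - ((n - 1) / 2 : ℕ) = (A₂.length : ℝ) := by
          rw [e2, Nat.cast_sub (by omega), hc]
        rw [this]; exact ht₂
      obtain ⟨t, ht, hb⟩ := Fn.intro
        (u := .pair (.num (n : ℝ)) (encList Pt.enc (A₁ ++ k :: A₂ ++ L)))
        (v := .pair (nodeVal k n 0 v₁ v₂ (.num n)) (encList Pt.enc L))
        (B := t₀ + t₁ + t₂ + 100) hf (by
          simp only [buildAuxE, nodeE, wp, lookup, Val.onPair_pair, Val.onNum_num, Arith.eval]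
          refine ⟨fun _ => ⟨_, t₀, by simpa [hc] using ht₀, ?_⟩, fun h => absurd ?_ h⟩
          · simp only [Val.onPair_pair, Val.onNum_num]
            refine ⟨_, t₁, ht₁', ?_⟩
            simp only [Val.onPair_pair]
            refine ⟨_, t₂, by simpa using ht₂', ?_⟩
            simp [nodeVal]; omega
          · simpa using (show 1 ≤ n from hpos))
      have hbound : t + 40 * (Nat.log 2 (n + 1) + 7) ≤ 300 * (n + 1) := by
        rw [hl₁] at hb₁
        have e3 : A₁.length + A₂.length + 1 = n := by omega
        generalize Nat.log 2 (n + 1) = l at *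
        generalize Nat.log 2 (A₂.length + 1) = l' at *
        clear hl₁ ha e1 e2 hlog hn hpos
        rw [← e3]
        rcases l with _ | l
        · simp only [Nat.zero_sub] at *; linarith
        · simp only [Nat.add_sub_cancel] at *; linarith
      refine ⟨_, t, ht, ?_, hbound⟩
      have hs : n = A₁.length + A₂.length + 1 := by omega
      have hcard : (A₁ ++ k :: A₂).toFinset.card = n := by
        rw [List.toFinset_card_of_nodup hA.nodup, hn]
      have := Tree.node (key := key 1) (B := unitPotential 1) (R := Rep 0) (n := n) (N := n)
        (c := 0) (sl := A₁.length) (sr := A₂.length) (k := k) (vl := v₁) (vr := v₂) (va := .num n)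
        (P := (A₁ ++ k :: A₂).toFinset) (φl := 0) (φr := 0) (φa := 0)
        hpos le_rfl (by omega) hcard.le hcard.le hcard.ge (by omega)
        (by rw [below_append hA]; exact hT₁.mono (by omega))
        (by rw [above_append hA]; exact hT₂.mono (by omega))
        ⟨by rw [hcard], rfl⟩
      rw [← hs] at this
      simpa using this

/-- The specification of the function that builds trees of level `d + 1`. -/
def BuildSpec (F : List Expr) (d : ℕ) : Prop :=
  ∀ L : List Pt, StrictSorted L → ∃ v t s, Fn F (12 * (d + 1) + 3) (encList Pt.enc L) v t ∧
    Tree (key (d + 1)) (unitPotential (d + 1)) (Rep d) L.length s v L.toFinset 0 ∧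
    s ≤ (L.toFinset.image (key (d + 1))).card ∧
    t ≤ buildConst (d + 1) * (L.length + 1) * (depthBound L.length + 1) ^ d

theorem buildSpec_zero {F : List Expr} (hF : HasTreeFuns F) : BuildSpec F 0 := by
  intro L hL
  obtain ⟨v, t, ht, hT, hb⟩ := buildAux_spec hF L [] hL
  obtain ⟨t₁, ht₁, hb₁⟩ := len_spec (hF 1 (by norm_num)) Pt.enc L
  rw [List.append_nil] at ht
  obtain ⟨t', ht', hb'⟩ := Fn.intro (u := encList Pt.enc L) (v := v) (B := t + t₁ + 20)
    (hF.level (d := 1) (k := 3) (by norm_num) (by norm_num) (by norm_num)) (by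
      simp only [buildE, wp, lookup]
      refine ⟨_, t₁, ht₁, _, t, ht, ?_⟩
      simp; omega)
  refine ⟨v, t', L.length, ht', hT, ?_, ?_⟩
  · rw [Finset.card_image_of_injective _ key_one_injective, List.toFinset_card_of_nodup hL.nodup]
  · simp only [zero_add, buildConst, pow_zero, mul_one]; omega

/-- Ties with the median only drop out: nothing after `k` is strictly smaller and nothing before it
strictly larger. Splitting at the median therefore halves the list even if keys repeat. -/
theorem length_filter_le_of_append {S A B : List Pt} {k : Pt} {d : ℕ} (h : S = A ++ k :: B)
    (hS : SortedBy d S) :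
    (S.filter fun p => key d p < key d k).length ≤ A.length ∧
      (S.filter fun p => key d k < key d p).length ≤ B.length := by
  subst h
  rw [SortedBy, List.pairwise_append, List.pairwise_cons] at hS
  have h1 : (B.filter fun p => key d p < key d k) = [] :=
    List.filter_eq_nil_iff.2 fun p hp => by simpa using hS.2.1.1 p hp
  have h2 : (A.filter fun p => key d k < key d p) = [] :=
    List.filter_eq_nil_iff.2 fun p hp => by simpa using hS.2.2 p hp k (by simp)
  constructor
  · rw [List.filter_append, List.filter_cons_of_neg (by simp), h1, List.append_nil]
    exact List.length_filter_le _ _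
  · rw [List.filter_append, List.filter_cons_of_neg (by simp), h2, List.nil_append]
    exact List.length_filter_le _ _

/-- Both orders are passed down by filtering, so no list is sorted below the root. A depth costs
linear time for filtering plus the construction of payloads from the list in level-1 order; `H` is a
common bound for the depths of all these payloads. -/
theorem buildRec_spec {F : List Expr} (hF : HasTreeFuns F) {d : ℕ} (h1 : 1 ≤ d) (h3 : d ≤ 2)
    (hB : BuildSpec F (d - 1)) (S L : List Pt) (hS : SortedBy (d + 1) S) (hL : StrictSorted L)
    (hSL : S.Perm L) (H : ℕ) (hH : depthBound L.length + 1 ≤ H) :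
    ∃ v t s, Fn F (12 * (d + 1) + 11) (.pair (encList Pt.enc S) (encList Pt.enc L)) v t ∧
      Tree (key (d + 1)) (unitPotential (d + 1)) (Rep d) L.length s v L.toFinset 0 ∧
      s ≤ (L.toFinset.image (key (d + 1))).card ∧
      t ≤ 20 + L.length * depthBound L.length * (2000 + 2 * buildConst d * H ^ (d - 1)) := by
  have hf := hF.level (d := d + 1) (k := 11) (by omega) (by omega) (by norm_num)
  induction hn : L.length using Nat.strong_induction_on generalizing S L with
  | _ n ih =>
    rcases Nat.eq_zero_or_pos n with rfl | hpos
    · obtain rfl := List.eq_nil_of_length_eq_zero hn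
      obtain rfl := List.Perm.eq_nil hSL
      obtain ⟨t, ht, hb⟩ := Fn.intro (u := .pair .nil .nil) (v := .nil) (B := 20) hf
        (by simp [buildRecE])
      exact ⟨_, t, 0, ht, by simpa using Tree.nil, by simp, by omega⟩
    · have hSn : S.length = n := by rw [hSL.length_eq, hn]
      obtain ⟨A, k, B, e, eA⟩ : ∃ A k B, S = A ++ k :: B ∧ A.length = n / 2 := by
        have hlt : n / 2 < S.length := by omega
        refine ⟨S.take (n / 2), S[n / 2], S.drop (n / 2 + 1), ?_, by simp; omega⟩
        rw [← List.drop_eq_getElem_cons hlt, List.take_append_drop]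
      have eB : B.length = n - 1 - n / 2 := by rw [e] at hSn; simp at hSn; omega
      obtain ⟨f1, f2⟩ := length_filter_le_of_append e hS
      have hk : k ∈ L := hSL.mem_iff.1 (by rw [e]; simp)
      have hget : S[n / 2]? = some k := by rw [e, ← eA]; simp
      have p1 := hSL.filter fun p => key (d + 1) p < key (d + 1) k
      have p2 := hSL.filter fun p => key (d + 1) k < key (d + 1) p
      have g1 : (L.filter fun p => key (d + 1) p < key (d + 1) k).length ≤ n / 2 := by
        rw [← p1.length_eq]; omega
      have g2 : (L.filter fun p => key (d + 1) k < key (d + 1) p).length ≤ n / 2 := by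
        rw [← p2.length_eq]; omega
      have b1 : (L.filter fun p => key (d + 1) p < key (d + 1) k).toFinset =
          ptsBelow (key (d + 1)) k L.toFinset := by ext p; simp [ptsBelow]
      have b2 : (L.filter fun p => key (d + 1) k < key (d + 1) p).toFinset =
          ptsAbove (key (d + 1)) k L.toFinset := by ext p; simp [ptsAbove]
      have d1 := depthBound_succ_le (n := n) hpos (show _ ≤ 3 * n / 4 by omega)
        (a := (L.filter fun p => key (d + 1) p < key (d + 1) k).length)
      have d2 := depthBound_succ_le (n := n) hpos (show _ ≤ 3 * n / 4 by omega)
        (a := (L.filter fun p => key (d + 1) k < key (d + 1) p).length)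
      rw [hn] at hH
      obtain ⟨v₁, t₁, s₁, ht₁, hT₁, hs₁, hb₁⟩ := ih _ (by omega)
        _ _ (List.Pairwise.filter _ hS) (hL.filter _) p1 (by omega) rfl
      obtain ⟨v₂, t₂, s₂, ht₂, hT₂, hs₂, hb₂⟩ := ih _ (by omega)
        _ _ (List.Pairwise.filter _ hS) (hL.filter _) p2 (by omega) rfl
      obtain ⟨va, ta, sa, hta, hTa, hsa, hba⟩ := hB L hL
      obtain ⟨u₁, hu₁, c₁⟩ := filt_below_spec hF (d := d + 1) (by omega) (by omega) k S
      obtain ⟨u₂, hu₂, c₂⟩ := filt_below_spec hF (d := d + 1) (by omega) (by omega) k L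
      obtain ⟨u₃, hu₃, c₃⟩ := filt_above_spec hF (d := d + 1) (by omega) (by omega) k S
      obtain ⟨u₄, hu₄, c₄⟩ := filt_above_spec hF (d := d + 1) (by omega) (by omega) k L
      obtain ⟨u₅, hu₅, c₅⟩ := len_spec (hF 1 (by norm_num)) Pt.enc S
      obtain ⟨u₆, hu₆, c₆⟩ := nth_spec (hF 3 (by norm_num)) Pt.enc S (n / 2) ((n : ℝ) * (1 / 2))
        (by have := Nat.cast_div_le (α := ℝ) (m := n) (n := 2); push_cast at this; linarith)
        (by
          have : n + 1 ≤ 2 * (n / 2 + 1) := by omega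
          have : (n : ℝ) + 1 ≤ 2 * ((n / 2 : ℕ) + 1) := by exact_mod_cast this
          linarith) k hget
      rw [hSn] at c₁ c₃ c₅ c₆ hu₅
      rw [hn] at c₂ c₄ hba
      obtain ⟨q, S', hS'⟩ : ∃ q S', S = q :: S' := by
        cases S with
        | nil => simp at hSn; omega
        | cons q S' => exact ⟨q, S', rfl⟩
      have hd : d - 1 + 1 = d := by omega
      rw [hd] at hta hTa hsa hba
      obtain ⟨t, ht, hb⟩ := Fn.intro (u := .pair (encList Pt.enc S) (encList Pt.enc L))
        (v := nodeVal k n 0 v₁ v₂ va) (B := t₁ + t₂ + ta + u₁ + u₂ + u₃ + u₄ + u₅ + u₆ + 100) hf (by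
          have e0 : encList Pt.enc S = .pair q.enc (encList Pt.enc S') := by rw [hS']; rfl
          simp only [buildRecE, nodeE, wp, lookup, Val.onPair_pair, Val.onNum_num, Arith.eval,
            Nat.add_sub_cancel]
          simp only [e0, Val.onPair_pair]
          rw [← e0]
          refine ⟨_, u₅, hu₅, _, u₆, by simpa using hu₆, _, u₁, by simpa using hu₁, _, u₂,
            by simpa using hu₂, _, t₁, ht₁, _, u₃, by simpa using hu₃, _, u₄, by simpa using hu₄,
            _, t₂, ht₂, _, ta, hta, ?_⟩
          simp [nodeVal]; omega)
      have hcard : L.toFinset.card = n := by rw [List.toFinset_card_of_nodup hL.nodup, hn]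
      have hss : s₁ + s₂ + 1 ≤ (L.toFinset.image (key (d + 1))).card := by
        have := card_image_below_add_above_lt (key (d + 1)) (List.mem_toFinset.2 hk)
        rw [← b1, ← b2] at this
        omega
      refine ⟨_, t, s₁ + s₂ + 1, ht, ?_, hss, ?_⟩
      · have := Tree.node (key := key (d + 1)) (B := unitPotential (d + 1)) (R := Rep d) (n := n)
          (N := n) (c := 0) (sl := s₁) (sr := s₂) (k := k) (vl := v₁) (vr := v₂) (va := va)
          (P := L.toFinset) (φl := 0) (φr := 0) (φa := 0)
          hpos le_rfl (by omega) hcard.le hcard.le hcard.ge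
          (hss.trans (Finset.card_image_le.trans hcard.le))
          (by rw [← b1]; exact hT₁.mono (by omega))
          (by rw [← b2]; exact hT₂.mono (by omega))
          (by
            obtain ⟨e, rfl⟩ : ∃ e, d = e + 1 := ⟨d - 1, by omega⟩
            exact ⟨sa, hTa.mono (by rw [hcard, hn]; omega)⟩)
        simpa using this
      · set X := 2000 + 2 * buildConst d * H ^ (d - 1) with hX
        have hlen : (L.filter fun p => key (d + 1) p < key (d + 1) k).length +
            (L.filter fun p => key (d + 1) k < key (d + 1) p).length ≤ n := by
          rw [← List.toFinset_card_of_nodup (hL.filter _).nodup,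
            ← List.toFinset_card_of_nodup (hL.filter _).nodup, b1, b2, ← hcard]
          exact card_below_add_card_above_le _ _ _
        set n₁ := (L.filter fun p => key (d + 1) p < key (d + 1) k).length
        set n₂ := (L.filter fun p => key (d + 1) k < key (d + 1) p).length
        obtain ⟨m, hm⟩ : ∃ m, depthBound n = m + 1 := ⟨depthBound n - 1, by omega⟩
        rw [hm] at d1 d2 ⊢
        have i1 : n₁ * depthBound n₁ * X ≤ n₁ * m * X := by gcongr; omega
        have i2 : n₂ * depthBound n₂ * X ≤ n₂ * m * X := by gcongr; omega
        have i3 : n₁ * m * X + n₂ * m * X ≤ n * m * X := by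
          rw [← add_mul, ← add_mul]; gcongr
        have i4 : ta ≤ buildConst d * (n + 1) * H ^ (d - 1) := by
          refine hba.trans ?_; gcongr
        have i5 : buildConst d * (n + 1) * H ^ (d - 1) ≤ n * (2 * buildConst d * H ^ (d - 1)) := by
          have : buildConst d * (n + 1) * H ^ (d - 1) ≤ buildConst d * (2 * n) * H ^ (d - 1) := by
            gcongr; omega
          exact this.trans (le_of_eq (by ring))
        have i6 : n * (m + 1) * X = n * m * X + 2000 * n +
            n * (2 * buildConst d * H ^ (d - 1)) := by rw [hX]; ring
        omega

/-- Each level above the first adds one factor `depthBound`, and the single sort at the root is of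
no larger order. As level 1 is linear, level d + 1 has exponent d only, which leaves one logarithm
for the depth of the updates. -/
theorem buildSpec_succ {F : List Expr} (hF : HasTreeFuns F) {d : ℕ} (h1 : 1 ≤ d) (h3 : d ≤ 2)
    (hB : BuildSpec F (d - 1)) : BuildSpec F d := by
  intro L hL
  obtain ⟨S, t₁, ht₁, hb₁, hp, hS⟩ := sort_spec hF (d := d + 1) (by omega) (by omega) L
  obtain ⟨v, t₂, s, ht₂, hT, hs, hb₂⟩ := buildRec_spec hF h1 h3 hB S L hS hL hp _ le_rfl
  obtain ⟨t, ht, hb⟩ := Fn.intro (u := encList Pt.enc L) (v := v) (B := t₁ + t₂ + 20)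
    (hF.level (d := d + 1) (k := 3) (by omega) (by omega) (by norm_num)) (by
      obtain ⟨e, rfl⟩ : ∃ e, d = e + 1 := ⟨d - 1, by omega⟩
      simp only [buildE, wp, lookup]
      exact ⟨_, t₁, ht₁, _, t₂, ht₂, rfl, by omega⟩)
  refine ⟨v, t, s, ht, hT, hs, ?_⟩
  obtain ⟨e, rfl⟩ : ∃ e, d = e + 1 := ⟨d - 1, by omega⟩
  set n := L.length
  set H := depthBound n + 1 with hH
  simp only [buildConst, Nat.add_sub_cancel] at hb₂ ⊢
  set b := buildConst (e + 1)
  have hH1 : 1 ≤ H := by omega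
  have hP : 1 ≤ H ^ e := Nat.one_le_pow _ _ hH1
  have j1 : n * depthBound n ≤ n * H := by gcongr; omega
  have j2 : n * depthBound n * (2000 + 2 * b * H ^ e) ≤ n * H * (2000 * H ^ e + 2 * b * H ^ e) := by
    gcongr; nlinarith
  have j3 : 700 * n * depthBound n ≤ 700 * (n * H * H ^ e) := by
    rw [mul_assoc]
    exact Nat.mul_le_mul_left _ (j1.trans (Nat.le_mul_of_pos_right _ (by omega)))
  have j4 : 1 ≤ H * H ^ e := Nat.mul_pos hH1 hP
  have j5 : (10 * b + 5000) * (n + 1) * H ^ (e + 1) =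
      (2000 + 2 * b) * (n * H * H ^ e) + (3000 + 8 * b) * (n * H * H ^ e) +
        (10 * b + 5000) * (H * H ^ e) := by ring
  have j6 : n * H * (2000 * H ^ e + 2 * b * H ^ e) = (2000 + 2 * b) * (n * H * H ^ e) := by ring
  have j7 : 5000 * 1 ≤ (10 * b + 5000) * (H * H ^ e) := Nat.mul_le_mul (by omega) j4
  have j8 : 700 * (n * H * H ^ e) ≤ (3000 + 8 * b) * (n * H * H ^ e) :=
    Nat.mul_le_mul_right _ (by omega)
  omega

/-! ### The points of a tree -/

/-- A deletion keeps the key in its node. The traversal recognises whether that point is still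
present by comparing the cardinality of the node with those of its children. -/
theorem card_eq_of_injective {key : Pt → List ℝ} (hk : Function.Injective key) (k : Pt)
    (P : Finset Pt) :
    P.card = (ptsBelow key k P).card + (ptsAbove key k P).card + if k ∈ P then 1 else 0 := by
  have e : P = ptsBelow key k P ∪ ptsAbove key k P ∪ P.filter (fun p => p = k) := by
    ext p
    simp only [ptsBelow, ptsAbove, Finset.mem_union, Finset.mem_filter]
    rcases lt_trichotomy (key p) (key k) with h | h | h
    · tauto
    · have := hk h; tauto
    · tauto
  have hd : Disjoint (ptsBelow key k P ∪ ptsAbove key k P) (P.filter fun p => p = k) := by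
    rw [Finset.disjoint_left]
    rintro p hp hq
    obtain ⟨-, rfl⟩ := Finset.mem_filter.1 hq
    rcases Finset.mem_union.1 hp with h | h
    · exact lt_irrefl _ (Finset.mem_filter.1 h).2
    · exact lt_irrefl _ (Finset.mem_filter.1 h).2
  conv_lhs => rw [e]
  rw [Finset.card_union_of_disjoint hd,
    Finset.card_union_of_disjoint (disjoint_below_above key k P), Finset.filter_eq']
  split_ifs <;> simp

/-- Only an inequality, because deletions leave keys in nodes that no point of `P` has any more. -/
theorem Tree.image_card_le {key : Pt → List ℝ} {B : ℕ → ℕ} {R : Val → Finset Pt → ℕ → Prop}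
    {n s : ℕ} {v : Val} {P : Finset Pt} {φ : ℕ} (h : Tree key B R n s v P φ) :
    (P.image key).card ≤ s := by
  induction h with
  | nil => simp
  | @node n N c sl sr k vl vr va P φl φr φa hN hn hc hP hPN hNP hs hl hr ha ihl ihr =>
    have e : P.image key ⊆
        insert (key k) ((ptsBelow key k P).image key ∪ (ptsAbove key k P).image key) := by
      intro a h
      obtain ⟨p, hp, rfl⟩ := Finset.mem_image.1 h
      rw [Finset.mem_insert, Finset.mem_union]
      rcases lt_trichotomy (key p) (key k) with h | h | h
      · exact .inr (.inl (Finset.mem_image_of_mem _ (Finset.mem_filter.2 ⟨hp, h⟩)))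
      · exact .inl h
      · exact .inr (.inr (Finset.mem_image_of_mem _ (Finset.mem_filter.2 ⟨hp, h⟩)))
    have h1 := Finset.card_le_card e
    have h2 := Finset.card_insert_le (key k) ((ptsBelow key k P).image key ∪ (ptsAbove key k P).image key)
    have h3 := Finset.card_union_le ((ptsBelow key k P).image key) ((ptsAbove key k P).image key)
    omega

/-- A tree whose payload is a number. -/
theorem Tree.nil_or_num {key : Pt → List ℝ} {B : ℕ → ℕ} {n s : ℕ} {v : Val} {P : Finset Pt} {φ : ℕ}
    (h : Tree key B (Rep 0) n s v P φ) :
    (v = .nil ∧ P.card = 0) ∨ ∃ k N c l r, v = nodeVal k N c l r (.num P.card) := by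
  cases h with
  | nil => exact .inl ⟨rfl, rfl⟩
  | node hN h1 hc hP hPN hNP hs hl hr ha =>
    obtain ⟨rfl, -⟩ := ha
    exact .inr ⟨_, _, _, _, _, rfl⟩

/-- The specification of the traversal of a tree of level `1`. -/
def TravSpec (F : List Expr) (v : Val) (P : Finset Pt) (s : ℕ) : Prop :=
  ∀ acc : List Pt, ∃ L t, Fn F 7 (.pair v (encList Pt.enc acc)) (encList Pt.enc (L ++ acc)) t ∧
    StrictSorted L ∧ L.toFinset = P ∧ t ≤ 100 * s + 20

theorem travSpec_nil {F : List Expr} (hF : HasTreeFuns F) : TravSpec F .nil ∅ 0 := by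
  intro acc
  have hf : F[7]? = some travE := hF 7 (by norm_num)
  obtain ⟨t, ht, hb⟩ := Fn.intro (u := .pair .nil (encList Pt.enc acc)) (v := encList Pt.enc acc)
    (B := 20) hf (by simp [travE, onNode])
  exact ⟨[], t, ht, .nil, rfl, by omega⟩

/-- The right subtree is put in front of the accumulator first, then the key if it is still present,
then the left subtree. No lists are appended, so the time is linear in the number of nodes. -/
theorem travSpec_node {F : List Expr} (hF : HasTreeFuns F) {B : ℕ → ℕ} {n n' sl sr N c : ℕ}
    {k : Pt} {vl vr : Val} {P : Finset Pt} {φl φr : ℕ}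
    (hl : Tree (key 1) B (Rep 0) n sl vl (ptsBelow (key 1) k P) φl)
    (hr : Tree (key 1) B (Rep 0) n' sr vr (ptsAbove (key 1) k P) φr)
    (hl' : TravSpec F vl (ptsBelow (key 1) k P) sl) (hr' : TravSpec F vr (ptsAbove (key 1) k P) sr) :
    TravSpec F (nodeVal k N c vl vr (.num P.card)) P (sl + sr + 1) := by
  intro acc
  have hf : F[7]? = some travE := hF 7 (by norm_num)
  obtain ⟨Lr, tr, htr, hLr, eLr, hbr⟩ := hr' acc
  have hcard := card_eq_of_injective key_one_injective k P
  set mid : List Pt := if k ∈ P then [k] else [] with hmid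
  obtain ⟨Ll, tl, htl, hLl, eLl, hbl⟩ := hl' (mid ++ Lr ++ acc)
  have hcond : (((1 : ℚ) : ℝ) ≤ (P.card : ℝ) -
      ((ptsBelow (key 1) k P).card + (ptsAbove (key 1) k P).card)) ↔ k ∈ P := by
    rw [hcard]
    split_ifs with h
    · simp [h]
    · simp [h]
  obtain ⟨t, ht, hb⟩ := Fn.intro
    (u := .pair (nodeVal k N c vl vr (.num P.card)) (encList Pt.enc acc))
    (v := encList Pt.enc (Ll ++ mid ++ Lr ++ acc)) (B := tl + tr + 60) hf (by
      simp only [travE, onNode, nodeVal, wp, lookup, Val.onPair_pair]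
      refine ⟨_, tr, htr, ?_⟩
      by_cases hk : k ∈ P
      · have htl' : Fn F 7 (.pair vl (.pair k.enc (encList Pt.enc (Lr ++ acc))))
            (encList Pt.enc (Ll ++ mid ++ Lr ++ acc)) tl := by
          rw [hmid, if_pos hk] at htl ⊢; simpa using htl
        rcases hl.nil_or_num with ⟨rfl, e1⟩ | ⟨k1, N1, c1, l1, r1, rfl⟩ <;>
        rcases hr.nil_or_num with ⟨rfl, e2⟩ | ⟨k2, N2, c2, l2, r2, rfl⟩
        all_goals
          try rw [e1] at hcond
          try rw [e2] at hcond
          simp only [nodeVal, Val.onPair_pair, Val.onPair_nil, Val.onNum_num, Arith.eval]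
          refine ⟨fun _ => ⟨_, tl, htl', rfl, by omega⟩, fun h => absurd ?_ h⟩
          simpa using hcond.2 hk
      · have htl' : Fn F 7 (.pair vl (encList Pt.enc (Lr ++ acc)))
            (encList Pt.enc (Ll ++ mid ++ Lr ++ acc)) tl := by
          rw [hmid, if_neg hk] at htl ⊢; simpa using htl
        rcases hl.nil_or_num with ⟨rfl, e1⟩ | ⟨k1, N1, c1, l1, r1, rfl⟩ <;>
        rcases hr.nil_or_num with ⟨rfl, e2⟩ | ⟨k2, N2, c2, l2, r2, rfl⟩
        all_goals
          try rw [e1] at hcond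
          try rw [e2] at hcond
          simp only [nodeVal, Val.onPair_pair, Val.onPair_nil, Val.onNum_num, Arith.eval]
          refine ⟨fun h => absurd (hcond.1 ?_) hk, fun _ => ⟨_, tl, htl', rfl, by omega⟩⟩
          simpa using h)
  refine ⟨Ll ++ mid ++ Lr, t, ht, ?_, ?_, by omega⟩
  · have h1 : ∀ p ∈ Ll, key 1 p < key 1 k := fun p hp => by
      have := List.mem_toFinset.2 hp
      rw [eLl] at this
      exact (Finset.mem_filter.1 this).2
    have h2 : ∀ p ∈ Lr, key 1 k < key 1 p := fun p hp => by
      have := List.mem_toFinset.2 hp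
      rw [eLr] at this
      exact (Finset.mem_filter.1 this).2
    have h3 : ∀ p ∈ mid, p = k := fun p hp => by
      rw [hmid] at hp; split_ifs at hp <;> simp_all
    rw [StrictSorted, List.pairwise_append, List.pairwise_append]
    refine ⟨⟨hLl, ?_, fun a ha b hb => ?_⟩, hLr, fun a ha b hb => ?_⟩
    · rw [hmid]; split_ifs <;> simp
    · rw [h3 b hb]; exact h1 a ha
    · rcases List.mem_append.1 ha with ha | ha
      · exact (h1 a ha).trans (h2 b hb)
      · rw [h3 a ha]; exact h2 b hb
  · rw [List.toFinset_append, List.toFinset_append, eLl, eLr]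
    ext p
    simp only [ptsBelow, ptsAbove, Finset.mem_union, Finset.mem_filter, List.mem_toFinset]
    have h3 : p ∈ mid ↔ p = k ∧ k ∈ P := by
      rw [hmid]; split_ifs with h <;> simp [h]
    rw [h3]
    rcases lt_trichotomy (key 1 p) (key 1 k) with h | h | h
    · have : p ≠ k := by rintro rfl; exact lt_irrefl _ h
      tauto
    · have := key_one_injective h; subst this; tauto
    · have : p ≠ k := by rintro rfl; exact lt_irrefl _ h
      tauto

theorem Tree.travSpec {F : List Expr} (hF : HasTreeFuns F) {B : ℕ → ℕ} {n s : ℕ} {v : Val}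
    {P : Finset Pt} {φ : ℕ} (h : Tree (key 1) B (Rep 0) n s v P φ) : TravSpec F v P s := by
  induction h with
  | nil => exact travSpec_nil hF
  | node hN hn hc hP hPN hNP hs hl hr ha ihl ihr =>
    obtain ⟨rfl, -⟩ := ha
    exact travSpec_node hF hl hr ihl ihr

/-- The specification of the function that lists the points of a tree of level `d + 1`. -/
def ToListSpec (F : List Expr) (d : ℕ) : Prop :=
  ∀ {n n' sl sr N c : ℕ} {k : Pt} {vl vr va : Val} {P : Finset Pt} {φl φr φa : ℕ},
    Tree (key (d + 1)) (unitPotential (d + 1)) (Rep d) n sl vl (ptsBelow (key (d + 1)) k P) φl →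
    Tree (key (d + 1)) (unitPotential (d + 1)) (Rep d) n' sr vr (ptsAbove (key (d + 1)) k P) φr →
    Rep d va P φa →
    ∃ L t, Fn F (12 * (d + 1) + 4) (nodeVal k N c vl vr va) (encList Pt.enc L) t ∧
      StrictSorted L ∧ L.toFinset = P ∧
      t ≤ 200 * (if d = 0 then sl + sr + 1 else 2 * P.card) + 100 * (d + 1)

theorem toListSpec_zero {F : List Expr} (hF : HasTreeFuns F) : ToListSpec F 0 := by
  intro n n' sl sr N c k vl vr va P φl φr φa hl hr ha
  obtain ⟨rfl, -⟩ := ha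
  obtain ⟨L, t, ht, hL, eL, hb⟩ :=
    travSpec_node hF (N := N) (c := c) hl hr (hl.travSpec hF) (hr.travSpec hF) []
  rw [List.append_nil] at ht
  obtain ⟨t', ht', hb'⟩ := Fn.intro (u := nodeVal k N c vl vr (.num P.card))
    (v := encList Pt.enc L) (B := t + 20)
    (hF.level (d := 1) (k := 4) (by norm_num) (by norm_num) (by norm_num)) (by
      simp only [toListE, wp, lookup]
      exact ⟨_, t, ht, rfl, by omega⟩)
  exact ⟨L, t', ht', hL, eL, by simp; omega⟩

/-- The payload of the root contains all points, so it suffices to descend to the innermost level.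
The number of nodes there is at most N + c, and 4c ≤ N ≤ |P| + c turns this into at most 2|P|. -/
theorem toListSpec_succ {F : List Expr} (hF : HasTreeFuns F) {d : ℕ} (h3 : d ≤ 1)
    (hT : ToListSpec F d) : ToListSpec F (d + 1) := by
  intro n n' sl sr N c k vl vr va P φl φr φa hl hr ha
  obtain ⟨s, ha⟩ := ha
  have main : ∃ L t, Fn F (12 * (d + 1) + 4) va (encList Pt.enc L) t ∧ StrictSorted L ∧
      L.toFinset = P ∧ t ≤ 400 * P.card + 100 * (d + 1) := by
    cases ha with
    | nil =>
      obtain ⟨t, ht, hb⟩ := Fn.intro (u := .nil) (v := .nil) (B := 50)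
        (hF.level (d := d + 1) (k := 4) (by omega) (by omega) (by norm_num)) (by
          rcases d with _ | d
          · obtain ⟨L, t, ht, hL, eL, hb⟩ := travSpec_nil hF []
            obtain rfl : L = [] := by simpa using eL
            simp only [toListE, wp, lookup]
            exact ⟨_, t, ht, rfl, by omega⟩
          · simp [toListE, onNode])
      exact ⟨[], t, ht, .nil, rfl, by omega⟩
    | node hN h1 hc hP hPN hNP hs hl hr ha =>
      obtain ⟨L, t, ht, hL, eL, hb⟩ := hT hl hr ha
      refine ⟨L, t, ht, hL, eL, hb.trans ?_⟩
      split_ifs <;> omega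
  obtain ⟨L, t, ht, hL, eL, hb⟩ := main
  obtain ⟨t', ht', hb'⟩ := Fn.intro (u := nodeVal k N c vl vr va)
    (v := encList Pt.enc L) (B := t + 50)
    (hF.level (d := d + 1 + 1) (k := 4) (by omega) (by omega) (by norm_num)) (by
      simp only [toListE, onNode, nodeVal, wp, lookup, Val.onPair_pair, Nat.add_sub_cancel]
      exact ⟨_, t, ht, rfl, by omega⟩)
  exact ⟨L, t', ht', hL, eL, by simp; omega⟩

/-! ### Updates -/

/-- If the rebuilding takes place, then N < 4c and |P| ≤ N + c, so |P| < 5c: the cost is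
proportional to c up to the logarithmic factors in `unitPotential`, and the potential of the root
pays for it. The slack in 4c ≤ N + 4 is there because the counter has just been raised. -/
theorem balance_spec {F : List Expr} (hF : HasTreeFuns F) {d : ℕ} (h3 : d ≤ 2)
    (hB : BuildSpec F d) (hT : ToListSpec F d) {n sl sr N c : ℕ} {k : Pt} {vl vr va : Val}
    {P : Finset Pt} {φl φr φa : ℕ} (hN : 1 ≤ N) (hn : N ≤ n) (hc1 : 1 ≤ c) (hc : 4 * c ≤ N + 4)
    (hP : P.card ≤ n) (hPN : P.card ≤ N + c) (hNP : N ≤ P.card + c) (hs : sl + sr + 1 ≤ N + c)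
    (hl : Tree (key (d + 1)) (unitPotential (d + 1)) (Rep d) (N / 2 + c) sl vl
      (ptsBelow (key (d + 1)) k P) φl)
    (hr : Tree (key (d + 1)) (unitPotential (d + 1)) (Rep d) (N / 2 + c) sr vr
      (ptsAbove (key (d + 1)) k P) φr)
    (ha : Rep d va P φa) :
    ∃ v t s φ, Fn F (8 + (d + 1)) (nodeVal k N c vl vr va) v t ∧
      Tree (key (d + 1)) (unitPotential (d + 1)) (Rep d) n s v P φ ∧ s ≤ sl + sr + 1 ∧
      t + φ ≤ c * unitPotential (d + 1) N + φl + φr + φa + 100 := by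
  have hf : F[8 + (d + 1)]? = some (balanceE (d + 1)) := by
    rw [hF _ (by omega)]; interval_cases d <;> rfl
  have e : ((4 : ℚ) : ℝ) * c ≤ N ↔ 4 * c ≤ N := by norm_num; exact_mod_cast Iff.rfl
  by_cases h : 4 * c ≤ N
  · obtain ⟨t, ht, hb⟩ := Fn.intro (u := nodeVal k N c vl vr va) (v := nodeVal k N c vl vr va)
      (B := 100) hf (by
        simp only [balanceE, onNode, nodeVal, wp, lookup, Val.onPair_pair, Val.onNum_num,
          Arith.eval]
        refine ⟨fun _ => ⟨trivial, by omega⟩, fun h' => absurd (e.2 h) h'⟩)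
    exact ⟨_, t, _, _, ht, .node hN hn h hP hPN hNP hs hl hr ha, le_rfl, by omega⟩
  · obtain ⟨L, t₁, ht₁, hL, eL, hb₁⟩ := hT (N := N) (c := c) hl hr ha
    obtain ⟨v, t₂, s, ht₂, hv, hs', hb₂⟩ := hB L hL
    have hlen : L.length = P.card := by rw [← eL, List.toFinset_card_of_nodup hL.nodup]
    rw [eL] at hv hs'
    rw [hlen] at hv hb₂
    obtain ⟨t, ht, hb⟩ := Fn.intro (u := nodeVal k N c vl vr va) (v := v)
      (B := t₁ + t₂ + 100) hf (by
        simp only [balanceE, onNode, wp, lookup]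
        simp only [nodeVal, Val.onPair_pair, Val.onNum_num, Arith.eval]
        refine ⟨fun h' => absurd (e.1 h') h, fun _ => ⟨_, t₁, ht₁, _, t₂, ht₂, rfl, by omega⟩⟩)
    refine ⟨v, t, s, 0, ht, hv.mono hP, ?_, ?_⟩
    -- Every key in `P` occurs in the old tree, so rebuilding does not increase the number of nodes
    -- and the invariants of the ancestors survive.
    · have him : (P.image (key (d + 1))).card ≤ sl + sr + 1 := by
        have e : P.image (key (d + 1)) ⊆
            insert (key (d + 1) k) ((ptsBelow (key (d + 1)) k P).image (key (d + 1)) ∪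
              (ptsAbove (key (d + 1)) k P).image (key (d + 1))) := by
          intro a h
          obtain ⟨p, hp, rfl⟩ := Finset.mem_image.1 h
          rw [Finset.mem_insert, Finset.mem_union]
          rcases lt_trichotomy (key (d + 1) p) (key (d + 1) k) with h | h | h
          · exact .inr (.inl (Finset.mem_image_of_mem _ (Finset.mem_filter.2 ⟨hp, h⟩)))
          · exact .inl h
          · exact .inr (.inr (Finset.mem_image_of_mem _ (Finset.mem_filter.2 ⟨hp, h⟩)))
        have h1 := Finset.card_le_card e
        have h2 := Finset.card_insert_le (key (d + 1) k)
          ((ptsBelow (key (d + 1)) k P).image (key (d + 1)) ∪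
              (ptsAbove (key (d + 1)) k P).image (key (d + 1)))
        have h3 := Finset.card_union_le ((ptsBelow (key (d + 1)) k P).image (key (d + 1)))
          ((ptsAbove (key (d + 1)) k P).image (key (d + 1)))
        have h4 := hl.image_card_le
        have h5 := hr.image_card_le
        omega
      omega
    · have hW : 1 ≤ (depthBound (4 * N) + 1) ^ d := Nat.one_le_pow _ _ (by omega)
      rw [unitPotential, Nat.add_sub_cancel]
      -- The argument 4N in `unitPotential` is chosen so that it still dominates |P| at the moment
      -- of rebuilding.
      have j1 : t₂ ≤ buildConst (d + 1) * (5 * c) * (depthBound (4 * N) + 1) ^ d := by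
        refine hb₂.trans ?_
        have := depthBound_mono (show P.card ≤ 4 * N by omega)
        gcongr
        omega
      have j2 : t₁ ≤ 200 * (10 * c) + 300 := by
        refine hb₁.trans ?_
        split_ifs <;> omega
      set W := (depthBound (4 * N) + 1) ^ d
      set b := buildConst (d + 1)
      have j3 : c * ((8 * b + 5000) * W) = b * (5 * c) * W + 3 * (b * c * W) + 5000 * (c * W) := by
        ring
      have j4 : c * 1 ≤ c * W := Nat.mul_le_mul_left _ hW
      omega

/-- `P'` arises from `P` by insertion (`δ = 1`) or deletion (`δ = -1`) of the point `p`. -/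
def Change (p : Pt) (δ : ℝ) (P P' : Finset Pt) : Prop :=
  (δ = 1 ∧ p ∉ P ∧ P' = insert p P) ∨ (δ = -1 ∧ p ∈ P ∧ P' = P.erase p)

theorem Change.card_cast {p : Pt} {δ : ℝ} {P P' : Finset Pt} (h : Change p δ P P') :
    (P'.card : ℝ) = P.card + δ := by
  rcases h with ⟨rfl, hp, rfl⟩ | ⟨rfl, hp, rfl⟩
  · rw [Finset.card_insert_of_notMem hp]; simp
  · rw [← Finset.card_erase_add_one hp]; simp

theorem Change.card_le {p : Pt} {δ : ℝ} {P P' : Finset Pt} (h : Change p δ P P') :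
    P'.card ≤ P.card + 1 ∧ P.card ≤ P'.card + 1 := by
  rcases h with ⟨rfl, hp, rfl⟩ | ⟨rfl, hp, rfl⟩
  · rw [Finset.card_insert_of_notMem hp]; omega
  · rw [← Finset.card_erase_add_one hp]; omega

theorem Change.filter_pos {p : Pt} {δ : ℝ} {P P' : Finset Pt} (h : Change p δ P P')
    (f : Pt → Prop) [DecidablePred f] (hf : f p) : Change p δ (P.filter f) (P'.filter f) := by
  rcases h with ⟨rfl, hp, rfl⟩ | ⟨rfl, hp, rfl⟩
  · exact .inl ⟨rfl, fun h => hp (Finset.mem_filter.1 h).1, by rw [Finset.filter_insert, if_pos hf]⟩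
  · exact .inr ⟨rfl, Finset.mem_filter.2 ⟨hp, hf⟩, by rw [Finset.filter_erase]⟩

theorem Change.filter_neg {p : Pt} {δ : ℝ} {P P' : Finset Pt} (h : Change p δ P P')
    (f : Pt → Prop) [DecidablePred f] (hf : ¬ f p) : P'.filter f = P.filter f := by
  rcases h with ⟨rfl, hp, rfl⟩ | ⟨rfl, hp, rfl⟩
  · rw [Finset.filter_insert, if_neg hf]
  · rw [Finset.filter_erase, Finset.erase_eq_of_notMem fun h => hf (Finset.mem_filter.1 h).2]

/-- The constants of the amortized time bounds for updates. -/
def updConst : ℕ → ℕ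
  | 0 => 20
  | d + 1 => updConst d + 10 * buildConst (d + 1) + 6000

/-- The specification of updates at level `d`. -/
def UpdSpec (F : List Expr) (d : ℕ) : Prop :=
  ∀ {v : Val} {P P' : Finset Pt} {φ : ℕ} {p : Pt} {δ : ℝ} {H : ℕ}, Rep d v P φ → Change p δ P P' →
    depthBound (8 * (P.card + 1)) + 1 ≤ H →
    ∃ v' t φ', Fn F (12 * d + 2) (.pair v (.pair p.enc (.num δ))) v' t ∧ Rep d v' P' φ' ∧
      t + φ' ≤ φ + updConst d * H ^ d

theorem updSpec_zero {F : List Expr} (hF : HasTreeFuns F) : UpdSpec F 0 := by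
  rintro v P P' φ p δ H ⟨rfl, rfl⟩ h hH
  have hf : F[2]? = some updZeroE := hF 2 (by norm_num)
  obtain ⟨t, ht, hb⟩ := Fn.intro (u := .pair (.num P.card) (.pair p.enc (.num δ)))
    (v := .num P'.card) (B := 20) hf (by simp [updZeroE, h.card_cast])
  exact ⟨_, t, 0, ht, ⟨rfl, rfl⟩, by simp [updConst]; exact hb⟩

/-- Every node on the path pays for the update of its payload, a comparison, and one more unit of
potential; the extra 1 in the number of nodes is for a new leaf. The bound grows from n to n + 1
just as N / 2 + c does when the counter rises. `M` is fixed so that one `H` serves all payloads on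
the path. -/
theorem upd_tree {F : List Expr} (hF : HasTreeFuns F) {d : ℕ} (h3 : d ≤ 2)
    (hB : BuildSpec F d) (hT : ToListSpec F d) (hU : UpdSpec F d) {M H : ℕ}
    (hH : depthBound (8 * (M + 1)) + 1 ≤ H) {n s : ℕ} {v : Val} {P : Finset Pt} {φ : ℕ}
    (h : Tree (key (d + 1)) (unitPotential (d + 1)) (Rep d) n s v P φ) {p : Pt} {δ : ℝ}
    {P' : Finset Pt} (hM : P.card ≤ M) (hch : Change p δ P P') :
    ∃ v' t s' φ', Fn F (12 * (d + 1) + 2) (.pair v (.pair p.enc (.num δ))) v' t ∧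
      Tree (key (d + 1)) (unitPotential (d + 1)) (Rep d) (n + 1) s' v' P' φ' ∧ s' ≤ s + 1 ∧
      t + φ' ≤ φ + (depthBound n + 1) * (updConst (d + 1) * H ^ d) := by
  have hf : F[12 * (d + 1) + 2]? = some (updE (d + 1)) :=
    hF.level (d := d + 1) (k := 2) (by omega) (by omega) (by norm_num)
  have hH1 : 1 ≤ H ^ d := Nat.one_le_pow _ _ (by omega)
  induction h generalizing P' with
  | @nil n =>
    obtain ⟨rfl, rfl⟩ : δ = 1 ∧ P' = {p} := by
      rcases hch with ⟨rfl, -, rfl⟩ | ⟨-, hp, -⟩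
      · exact ⟨rfl, rfl⟩
      · simp at hp
    obtain ⟨v, t₁, s, ht₁, hv, hs, hb⟩ := hB [p] (List.pairwise_singleton _ _)
    obtain ⟨t, ht, hb'⟩ := Fn.intro (u := .pair .nil (.pair p.enc (.num 1))) (v := v)
      (B := t₁ + 50) hf (by
        simp only [updE, onNode, wp, lookup, Val.onPair_pair, Val.onPair_nil]
        exact ⟨_, t₁, ht₁, rfl, by omega⟩)
    refine ⟨v, t, s, 0, ht, hv.mono (by simp), ?_, ?_⟩
    · simpa using hs
    · simp only [List.length_singleton] at hb
      have j : (depthBound 1 + 1) ^ d ≤ H ^ d := by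
        have := depthBound_mono (show 1 ≤ 8 * (M + 1) by omega)
        gcongr; omega
      have j1 : buildConst (d + 1) * (1 + 1) * (depthBound 1 + 1) ^ d ≤
          buildConst (d + 1) * (1 + 1) * H ^ d := by gcongr
      have j2 : updConst (d + 1) * H ^ d ≤
          (depthBound n + 1) * (updConst (d + 1) * H ^ d) :=
        Nat.le_mul_of_pos_left _ (by omega)
      have j3 : updConst (d + 1) * H ^ d = buildConst (d + 1) * (1 + 1) * H ^ d +
        (updConst d + 8 * buildConst (d + 1)) * H ^ d + 6000 * H ^ d := by rw [updConst]; ring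
      omega
  | @node n N c sl sr k vl vr va P φl φr φa hN hn hc hP hPN hNP hs hl hr ha ihl ihr =>
    have hcard := hch.card_le
    obtain ⟨va', ta, φa', hta, ha', hba⟩ := hU (H := H) ha hch
      ((Nat.add_le_add_right (depthBound_mono (by omega)) 1).trans hH)
    obtain ⟨tc, htc, hbc⟩ := keyCmp_spec hF (d := d + 1) (by omega) (by omega) p k
    have hchild := depthBound_succ_le (a := N / 2 + c) (n := n) (by omega) (by omega)
    obtain ⟨D, hD⟩ : ∃ D, depthBound n = D + 1 := ⟨depthBound n - 1, by omega⟩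
    have hunit : unitPotential (d + 1) N ≤ (8 * buildConst (d + 1) + 5000) * H ^ d := by
      rw [unitPotential, Nat.add_sub_cancel]
      have := depthBound_mono (show 4 * N ≤ 8 * (M + 1) by omega)
      gcongr; omega
    set X := updConst (d + 1) * H ^ d with hX
    -- The budget of a node: the payload, one unit of potential, and a remainder. The remainder
    -- covers the comparison and bookkeeping.
    have hX' : X = updConst d * H ^ d + (8 * buildConst (d + 1) + 5000) * H ^ d +
        2 * buildConst (d + 1) * H ^ d + 1000 * H ^ d := by rw [hX, updConst]; ring
    have hcc : (c + 1) * unitPotential (d + 1) N =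
      c * unitPotential (d + 1) N + unitPotential (d + 1) N := by ring
    have hDX : (depthBound n + 1) * X = (D + 1) * X + X := by rw [hD]; ring
    have hcast : ((c + 1 : ℕ) : ℝ) = c + 1 := by push_cast; ring
    have hbelow : key (d + 1) p < key (d + 1) k →
        Change p δ (ptsBelow (key (d + 1)) k P) (ptsBelow (key (d + 1)) k P') := fun h =>
      hch.filter_pos _ h
    have hbelow' : ¬ key (d + 1) p < key (d + 1) k →
        ptsBelow (key (d + 1)) k P' = ptsBelow (key (d + 1)) k P := fun h => hch.filter_neg _ h
    have habove : key (d + 1) k < key (d + 1) p →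
        Change p δ (ptsAbove (key (d + 1)) k P) (ptsAbove (key (d + 1)) k P') := fun h =>
      hch.filter_pos _ h
    have habove' : ¬ key (d + 1) k < key (d + 1) p →
        ptsAbove (key (d + 1)) k P' = ptsAbove (key (d + 1)) k P := fun h => hch.filter_neg _ h
    -- What the three outcomes of the comparison have in common. `tx` is the time of the recursive
    -- call, which is absent if the keys agree and only the payload changes; the last clause leaves
    -- the call of the balancing function open.
    have hchildren : ∃ vl' vr' sl' sr' φl' φr' tx,
        Tree (key (d + 1)) (unitPotential (d + 1)) (Rep d) (N / 2 + (c + 1)) sl' vl'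
          (ptsBelow (key (d + 1)) k P') φl' ∧
        Tree (key (d + 1)) (unitPotential (d + 1)) (Rep d) (N / 2 + (c + 1)) sr' vr'
          (ptsAbove (key (d + 1)) k P') φr' ∧
        sl' + sr' ≤ sl + sr + 1 ∧ tx + φl' + φr' ≤ φl + φr + (D + 1) * X ∧
        ∀ v' t', Fn F (8 + (d + 1)) (nodeVal k N (c + 1) vl' vr' va') v' t' →
          wp F (updE (d + 1)) [.pair (nodeVal k N c vl vr va) (.pair p.enc (.num δ))]
            fun v t => v = v' ∧ t ≤ ta + tc + tx + t' + 100 := by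
      have hmono : ∀ {s v Q φ}, Tree (key (d + 1)) (unitPotential (d + 1)) (Rep d)
          (N / 2 + c) s v Q φ → Tree (key (d + 1)) (unitPotential (d + 1)) (Rep d)
          (N / 2 + (c + 1)) s v Q φ := fun h => h.mono (by omega)
      have hstep : (depthBound (N / 2 + c) + 1) * X ≤ (D + 1) * X :=
        Nat.mul_le_mul_right _ (by omega)
      have hcb := card_below_add_card_above_le (key (d + 1)) k P
      rcases cmpList_of_length_eq (key_length (d + 1) p k) with ⟨hlt, ec⟩ | ⟨heq, ec⟩ | ⟨hlt, ec⟩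
      · obtain ⟨vl', tl, sl', φl', htl, hl', hsl', hbl⟩ := ihl (by omega) (hbelow hlt)
        refine ⟨vl', vr, sl', sr, φl', φr, tl, hl', ?_, by omega, by omega, fun v' t' hv' => ?_⟩
        · rw [habove' (not_lt.2 hlt.le)]; exact hmono hr
        · simp only [updE, onNode, nodeE, nodeVal, wp, lookup, Val.onPair_pair, Val.onNum_num,
            Arith.eval, Nat.add_sub_cancel]
          refine ⟨_, ta, hta, _, tc, htc, ?_⟩
          simp only [Val.onNum_num, ec]
          refine ⟨fun h => ?_, fun _ => ⟨_, tl, htl, _, t', ?_, rfl, by omega⟩⟩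
          · norm_num at h
          · simpa [nodeVal] using hv'
      · refine ⟨vl, vr, sl, sr, φl, φr, 0, ?_, ?_, by omega, by omega, fun v' t' hv' => ?_⟩
        · rw [hbelow' (by rw [heq]; exact lt_irrefl _)]; exact hmono hl
        · rw [habove' (by rw [heq]; exact lt_irrefl _)]; exact hmono hr
        · simp only [updE, onNode, nodeE, nodeVal, wp, lookup, Val.onPair_pair, Val.onNum_num,
            Arith.eval, Nat.add_sub_cancel]
          refine ⟨_, ta, hta, _, tc, htc, ?_⟩
          simp only [Val.onNum_num, ec]
          refine ⟨fun _ => ⟨fun _ => ⟨_, t', ?_, rfl, by omega⟩, fun h => ?_⟩, fun h => ?_⟩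
          · simpa [nodeVal] using hv'
          · norm_num at h
          · norm_num at h
      · obtain ⟨vr', tr, sr', φr', htr, hr', hsr', hbr⟩ := ihr (by omega) (habove hlt)
        refine ⟨vl, vr', sl, sr', φl, φr', tr, ?_, hr', by omega, by omega, fun v' t' hv' => ?_⟩
        · rw [hbelow' (not_lt.2 hlt.le)]; exact hmono hl
        · simp only [updE, onNode, nodeE, nodeVal, wp, lookup, Val.onPair_pair, Val.onNum_num,
            Arith.eval, Nat.add_sub_cancel]
          refine ⟨_, ta, hta, _, tc, htc, ?_⟩
          simp only [Val.onNum_num, ec]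
          refine ⟨fun _ => ⟨fun h => ?_, fun _ => ⟨_, tr, htr, _, t', ?_, rfl, by omega⟩⟩,
            fun h => ?_⟩
          · norm_num at h
          · simpa [nodeVal] using hv'
          · norm_num at h
    obtain ⟨vl', vr', sl', sr', φl', φr', tx, hl', hr', hss, hbx, hev⟩ := hchildren
    obtain ⟨v', t', s', φ', ht', hv', hs', hb'⟩ := balance_spec hF h3 hB hT (n := n + 1) (N := N)
      (c := c + 1) (k := k) (P := P') hN (by omega) (by omega) (by omega) (by omega) (by omega)
      (by omega) (by omega) hl' hr' ha'
    obtain ⟨t, ht, hb⟩ := Fn.intro hf (hev v' t' ht')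
    refine ⟨v', t, s', φ', ht, hv', by omega, ?_⟩
    omega

theorem updSpec_succ {F : List Expr} (hF : HasTreeFuns F) {d : ℕ} (h3 : d ≤ 2)
    (hB : BuildSpec F d) (hT : ToListSpec F d) (hU : UpdSpec F d) : UpdSpec F (d + 1) := by
  rintro v P P' φ p δ H ⟨s, h⟩ hch hH
  obtain ⟨v', t, s', φ', ht, hv', hs', hb⟩ := upd_tree hF h3 hB hT hU hH h le_rfl hch
  refine ⟨v', t, φ', ht, ⟨s', ?_⟩, hb.trans ?_⟩
  -- The bound of the root can be reset to 2|P'|: 4c ≤ N and N ≤ |P'| + c give N ≤ 2|P'|, whatever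
  -- the bound was before.
  · cases hv' with
    | nil => exact .nil
    | node hN hn hc hP hPN hNP hs hl hr ha =>
      exact .node hN (by omega) hc (by omega) hPN hNP hs hl hr ha
  · have := depthBound_mono (show 2 * P.card ≤ 8 * (P.card + 1) by omega)
    have : (depthBound (2 * P.card) + 1) * (updConst (d + 1) * H ^ d) ≤
        H * (updConst (d + 1) * H ^ d) := Nat.mul_le_mul_right _ (by omega)
    calc _ ≤ φ + H * (updConst (d + 1) * H ^ d) := by omega
      _ = _ := by ring

/-! ### Queries -/

/-- Trees of level `d + 1`. -/
abbrev LevelTree (d : ℕ) := Tree (key (d + 1)) (unitPotential (d + 1)) (Rep d)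

/-- On trees of level `d + 1` with at most `M` points, the query `q` on the payload of the root is
answered with the sum of `g` over all points, within `T` steps. -/
def ValSpec (F : List Expr) (d : ℕ) (q : Val) (g : Pt → ℤ) (M T : ℕ) : Prop :=
  ∀ {n s v P φ}, LevelTree d n s v P φ → P.card ≤ M →
    ∃ t, Fn F (12 * (d + 1) + 5) (.pair v q) (.num ((∑ p ∈ P, g p : ℤ) : ℝ)) t ∧ t ≤ T

theorem sum_split (key : Pt → List ℝ) (k : Pt) (P : Finset Pt) (g : Pt → ℤ) :
    ∑ p ∈ P, g p = (∑ p ∈ P.filter fun p => key p ≤ key k, g p) + ∑ p ∈ ptsAbove key k P, g p := by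
  rw [← Finset.sum_filter_add_sum_filter_not P fun p => key p ≤ key k]
  simp only [not_le, ptsAbove]

/-- The value of the whole tree minus that of the right subtree is the sum over keys up to that of
the node, including points that lie in no subtree. So two payload queries per depth suffice, and the
search follows a single path. -/
theorem cnt_spec {F : List Expr} (hF : HasTreeFuns F) {d : ℕ} (h3 : d ≤ 2) {q : Val} {g : Pt → ℤ}
    {M T : ℕ} (hV : ValSpec F d q g M T) (thr : List ℝ) {n s : ℕ} {v : Val} {P : Finset Pt} {φ : ℕ}
    (h : LevelTree d n s v P φ) (hM : P.card ≤ M) :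
    ∃ t, Fn F (12 * (d + 1) + 6) (.pair v (.pair (encList .num thr) q))
      (.num ((∑ p ∈ P.filter (fun p => cmpList (key (d + 1) p) thr ≤ 0), g p : ℤ) : ℝ)) t ∧
      t ≤ (depthBound n + 1) * (2 * T + 400) := by
  have hf : F[12 * (d + 1) + 6]? = some (cntE (d + 1)) :=
    hF.level (k := 6) (by omega) (by omega) (by norm_num)
  induction h with
  | nil =>
    refine Fn.intro hf ?_
    simp only [cntE, onNode, wp, lookup, Val.onPair_pair, Val.onPair_nil]
    refine ⟨by simp, ?_⟩
    nlinarith [Nat.zero_le T]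
  | @node n N c sl sr k vl vr va P φl φr φa hN hn hc hP hPN hNP hs hl hr ha ihl ihr =>
    have hcb := card_below_add_card_above_le (key (d + 1)) k P
    obtain ⟨t₁, ht₁, hb₁⟩ := hV (.node hN hn hc hP hPN hNP hs hl hr ha) hM
    obtain ⟨t₂, ht₂, hb₂⟩ := hV hr (by omega)
    obtain ⟨tl, htl, hbl⟩ := ihl (by omega)
    obtain ⟨tr, htr, hbr⟩ := ihr (by omega)
    obtain ⟨tc, htc, hbc⟩ := thrCmp_spec hF (d := d + 1) (by omega) (by omega) k thr
    have hchild := depthBound_succ_le (a := N / 2 + c) (n := n) (by omega) (by omega)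
    have hstep : (depthBound (N / 2 + c) + 1) * (2 * T + 400) + (2 * T + 400) ≤
        (depthBound n + 1) * (2 * T + 400) := by
      rw [← Nat.succ_mul]; exact Nat.mul_le_mul_right _ (by omega)
    refine Fn.intro hf ?_
    simp only [cntE, onNode, nodeVal, wp, lookup, Val.onPair_pair]
    refine ⟨_, tc, htc, ?_⟩
    simp only [Val.onNum_num]
    have hcond : ((cmpList (key (d + 1) k) thr : ℤ) : ℝ) ≤ ((0 : ℚ) : ℝ) ↔
        cmpList (key (d + 1) k) thr ≤ 0 := by norm_num
    refine ⟨fun hk => ⟨_, t₁, ht₁, _, t₂, ht₂, ?_⟩, fun hk => ⟨_, tl, htl, ?_, by omega⟩⟩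
    · simp only [Val.onNum_num, Arith.eval]
      refine ⟨_, tr, htr, ?_⟩
      simp only [Val.onNum_num]
      refine ⟨?_, by omega⟩
      rw [hcond] at hk
      have e1 := sum_split (key (d + 1)) k P g
      have e2 := sum_split (key (d + 1)) k
        (P.filter fun p => cmpList (key (d + 1) p) thr ≤ 0) g
      have e3 : (P.filter fun p => cmpList (key (d + 1) p) thr ≤ 0).filter
          (fun p => key (d + 1) p ≤ key (d + 1) k) =
          P.filter fun p => key (d + 1) p ≤ key (d + 1) k := by
        ext p
        simp only [Finset.mem_filter]
        exact ⟨fun h => ⟨h.1.1, h.2⟩,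
          fun h => ⟨⟨h.1, cmpList_mono (key_length _ _ _) h.2 hk⟩, h.2⟩⟩
      have e4 : ptsAbove (key (d + 1)) k (P.filter fun p => cmpList (key (d + 1) p) thr ≤ 0) =
          (ptsAbove (key (d + 1)) k P).filter fun p => cmpList (key (d + 1) p) thr ≤ 0 := by
        rw [ptsAbove, ptsAbove, Finset.filter_comm]
      rw [e2, e3, e4, e1]
      push_cast; ring_nf
    · rw [hcond] at hk
      congr 3
      ext p
      simp only [ptsBelow, Finset.mem_filter]
      refine ⟨fun h => ⟨h.1.1, h.2⟩, fun h => ⟨⟨h.1, ?_⟩, h.2⟩⟩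
      by_contra hp
      exact hk (cmpList_mono (key_length _ _ _) (not_lt.1 hp) h.2)

/-- `g` may be negative, so prefix sums need not be monotone. The search merely keeps a subtree
whose total exceeds the remaining rank whenever it turns left, and the result is some key at which
the prefix sum jumps past `r`. -/
theorem sel_spec {F : List Expr} (hF : HasTreeFuns F) {d : ℕ} (h3 : d ≤ 2) {q : Val} {g : Pt → ℤ}
    {M T : ℕ} (hV : ValSpec F d q g M T) {n s : ℕ} {v : Val} {P : Finset Pt} {φ : ℕ}
    (h : LevelTree d n s v P φ) (hM : P.card ≤ M) (r : ℤ) (hr0 : 0 ≤ r) :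
    ∃ u t, Fn F (12 * (d + 1) + 7) (.pair v (.pair (.num (r : ℝ)) q)) u t ∧
      t ≤ (depthBound n + 1) * (3 * T + 400) ∧
      ((u = .nil ∧ ∑ p ∈ P, g p ≤ r) ∨
        ∃ k : Pt, u = k.enc ∧
          ∑ p ∈ P.filter (fun p => key (d + 1) p < key (d + 1) k), g p ≤ r ∧
          r < ∑ p ∈ P.filter (fun p => key (d + 1) p ≤ key (d + 1) k), g p) := by
  have hf : F[12 * (d + 1) + 7]? = some (selE (d + 1)) :=
    hF.level (k := 7) (by omega) (by omega) (by norm_num)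
  -- Keys stored in nodes may be stale, but a jump of the prefix sum forces a point with that key.
  -- This shows on which side of `k` the key found in a subtree lies.
  have hexists : ∀ {Q : Finset Pt} {k : Pt} {r : ℤ},
      ∑ p ∈ Q.filter (fun p => key (d + 1) p < key (d + 1) k), g p ≤ r →
      r < ∑ p ∈ Q.filter (fun p => key (d + 1) p ≤ key (d + 1) k), g p →
      ∃ p ∈ Q, key (d + 1) p = key (d + 1) k := by
    intro Q k r h1 h2
    by_contra hno
    push Not at hno
    refine absurd h1 (not_le.2 (h2.trans_eq ?_))
    congr 1
    ext p
    simp only [Finset.mem_filter]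
    exact ⟨fun h => ⟨h.1, lt_of_le_of_ne h.2 (hno p h.1)⟩, fun h => ⟨h.1, h.2.le⟩⟩
  induction h generalizing r with
  | nil =>
    obtain ⟨t, ht, hb⟩ := Fn.intro (u := .pair .nil (.pair (.num (r : ℝ)) q)) (v := .nil)
      (B := 400) hf (by simp [selE, onNode])
    exact ⟨_, t, ht, by nlinarith [Nat.zero_le T], .inl ⟨rfl, by simpa using hr0⟩⟩
  | @node n N c sl sr k vl vr va P φl φr φa hN hn hc hP hPN hNP hs hl hr ha ihl ihr =>
    have hcb := card_below_add_card_above_le (key (d + 1)) k P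
    obtain ⟨t₁, ht₁, hb₁⟩ := hV (.node hN hn hc hP hPN hNP hs hl hr ha) hM
    obtain ⟨t₂, ht₂, hb₂⟩ := hV hr (by omega)
    obtain ⟨t₃, ht₃, hb₃⟩ := hV hl (by omega)
    have hchild := depthBound_succ_le (a := N / 2 + c) (n := n) (by omega) (by omega)
    have hstep : (depthBound (N / 2 + c) + 1) * (3 * T + 400) + (3 * T + 400) ≤
        (depthBound n + 1) * (3 * T + 400) := by
      rw [← Nat.succ_mul]; exact Nat.mul_le_mul_right _ (by omega)
    have e1 := sum_split (key (d + 1)) k P g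
    by_cases hrl : ∑ p ∈ ptsBelow (key (d + 1)) k P, g p ≤ r
    · have hrl' : ((∑ p ∈ ptsBelow (key (d + 1)) k P, g p : ℤ) : ℝ) ≤ r := by exact_mod_cast hrl
      by_cases hrm : ∑ p ∈ P.filter (fun p => key (d + 1) p ≤ key (d + 1) k), g p ≤ r
      · have hrm' : ((∑ p ∈ P, g p : ℤ) : ℝ) - ((∑ p ∈ ptsAbove (key (d + 1)) k P, g p : ℤ) : ℝ) ≤
            r := by rw [e1]; push_cast; rw [add_sub_cancel_right]; exact_mod_cast hrm
        obtain ⟨u, t', ht', hb', hu⟩ := ihr (by omega)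
          (r - ∑ p ∈ P.filter (fun p => key (d + 1) p ≤ key (d + 1) k), g p) (by omega)
        obtain ⟨t, ht, hb⟩ := Fn.intro
          (u := .pair (nodeVal k N c vl vr va) (.pair (.num (r : ℝ)) q)) (v := u)
          (B := t₁ + t₂ + t₃ + t' + 200) hf (by
            simp only [selE, onNode, nodeVal, wp, lookup, Val.onPair_pair]
            refine ⟨_, t₃, ht₃, ?_⟩
            simp only [Val.onNum_num]
            refine ⟨fun _ => ⟨_, t₁, ht₁, _, t₂, ht₂, ?_⟩, fun h => absurd hrl' h⟩
            simp only [Val.onNum_num, Arith.eval]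
            refine ⟨fun _ => ⟨_, t', ?_, rfl, by omega⟩, fun h => absurd hrm' h⟩
            have e : (r : ℝ) - (((∑ p ∈ P, g p : ℤ) : ℝ) -
                ((∑ p ∈ ptsAbove (key (d + 1)) k P, g p : ℤ) : ℝ)) =
                ((r - ∑ p ∈ P.filter (fun p => key (d + 1) p ≤ key (d + 1) k), g p : ℤ) : ℝ) := by
              rw [e1]; push_cast; ring
            rw [e]; exact ht')
        refine ⟨u, t, ht, by omega, ?_⟩
        rcases hu with ⟨rfl, hu⟩ | ⟨k', rfl, h1, h2⟩
        · exact .inl ⟨rfl, by omega⟩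
        · obtain ⟨p, hp, hpk⟩ := hexists h1 h2
          have hk : key (d + 1) k < key (d + 1) k' := hpk ▸ (Finset.mem_filter.1 hp).2
          have i1 := sum_split (key (d + 1)) k
            (P.filter fun p => key (d + 1) p < key (d + 1) k') g
          have i2 := sum_split (key (d + 1)) k
            (P.filter fun p => key (d + 1) p ≤ key (d + 1) k') g
          rw [Finset.filter_filter, ptsAbove, Finset.filter_comm] at i1 i2
          have i3 : (P.filter fun p => key (d + 1) p < key (d + 1) k' ∧
              key (d + 1) p ≤ key (d + 1) k) =
              P.filter fun p => key (d + 1) p ≤ key (d + 1) k :=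
            Finset.filter_congr fun p _ => ⟨fun h => h.2, fun h => ⟨h.trans_lt hk, h⟩⟩
          have i4 : (P.filter fun p => key (d + 1) p ≤ key (d + 1) k' ∧
              key (d + 1) p ≤ key (d + 1) k) =
              P.filter fun p => key (d + 1) p ≤ key (d + 1) k :=
            Finset.filter_congr fun p _ => ⟨fun h => h.2, fun h => ⟨h.trans hk.le, h⟩⟩
          rw [i3] at i1
          rw [i4] at i2
          rw [ptsAbove] at h1 h2
          exact .inr ⟨k', rfl, by omega, by omega⟩
      · have hrm' : ¬ ((∑ p ∈ P, g p : ℤ) : ℝ) -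
            ((∑ p ∈ ptsAbove (key (d + 1)) k P, g p : ℤ) : ℝ) ≤ r := by
          rw [e1]; push_cast; rw [add_sub_cancel_right]; exact_mod_cast hrm
        obtain ⟨t, ht, hb⟩ := Fn.intro
          (u := .pair (nodeVal k N c vl vr va) (.pair (.num (r : ℝ)) q)) (v := k.enc)
          (B := t₁ + t₂ + t₃ + 200) hf (by
            simp only [selE, onNode, nodeVal, wp, lookup, Val.onPair_pair]
            refine ⟨_, t₃, ht₃, ?_⟩
            simp only [Val.onNum_num]
            refine ⟨fun _ => ⟨_, t₁, ht₁, _, t₂, ht₂, ?_⟩, fun h => absurd hrl' h⟩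
            simp only [Val.onNum_num, Arith.eval]
            exact ⟨fun h => absurd h hrm', fun _ => ⟨trivial, by omega⟩⟩)
        exact ⟨_, t, ht, by omega, .inr ⟨k, rfl, hrl, not_le.1 hrm⟩⟩
    · have hrl' : ¬ ((∑ p ∈ ptsBelow (key (d + 1)) k P, g p : ℤ) : ℝ) ≤ r := by
        exact_mod_cast hrl
      obtain ⟨u, t', ht', hb', hu⟩ := ihl (by omega) r hr0
      obtain ⟨t, ht, hb⟩ := Fn.intro
        (u := .pair (nodeVal k N c vl vr va) (.pair (.num (r : ℝ)) q)) (v := u)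
        (B := t₃ + t' + 200) hf (by
          simp only [selE, onNode, nodeVal, wp, lookup, Val.onPair_pair]
          refine ⟨_, t₃, ht₃, ?_⟩
          simp only [Val.onNum_num]
          exact ⟨fun h => absurd h hrl', fun _ => ⟨_, t', ht', rfl, by omega⟩⟩)
      refine ⟨u, t, ht, by omega, ?_⟩
      rcases hu with ⟨rfl, hu⟩ | ⟨k', rfl, h1, h2⟩
      · omega
      · obtain ⟨p, hp, hpk⟩ := hexists h1 h2
        have hk : key (d + 1) k' < key (d + 1) k := hpk ▸ (Finset.mem_filter.1 hp).2
        rw [ptsBelow, Finset.filter_filter] at h1 h2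
        have i3 : (P.filter fun p => key (d + 1) p < key (d + 1) k ∧
            key (d + 1) p < key (d + 1) k') =
            P.filter fun p => key (d + 1) p < key (d + 1) k' :=
          Finset.filter_congr fun p _ => ⟨fun h => h.2, fun h => ⟨h.trans hk, h⟩⟩
        have i4 : (P.filter fun p => key (d + 1) p < key (d + 1) k ∧
            key (d + 1) p ≤ key (d + 1) k') =
            P.filter fun p => key (d + 1) p ≤ key (d + 1) k' :=
          Finset.filter_congr fun p _ => ⟨fun h => h.2, fun h => ⟨h.trans_lt hk, h⟩⟩
        rw [i3] at h1
        rw [i4] at h2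
        exact .inr ⟨k', rfl, h1, h2⟩

theorem valSpec_zero {F : List Expr} (hF : HasTreeFuns F) (q : Val) (M : ℕ) :
    ValSpec F 0 q (fun _ => 1) M 100 := by
  intro n s v P φ h _
  have hf : F[12 * (0 + 1) + 5]? = some (valE 1) :=
    hF.level (d := 1) (k := 5) (by norm_num) (by norm_num) (by norm_num)
  refine Fn.intro hf ?_
  cases h with
  | nil => simp [valE, onNode]
  | node hN hn hc hP hPN hNP hs hl hr ha =>
    obtain ⟨rfl, -⟩ := ha
    simp [valE, onNode, nodeVal]

/-- The indicator of the points up to a threshold at level `d`. -/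
noncomputable def upTo (d : ℕ) (thr : List ℝ) (p : Pt) : ℤ :=
  if cmpList (key d p) thr ≤ 0 then 1 else 0

/-- `cnt_spec` for the structures of level `d + 1`. -/
theorem Rep.cnt {F : List Expr} (hF : HasTreeFuns F) {d : ℕ} (h3 : d ≤ 2) {q : Val} {g : Pt → ℤ}
    {M T H : ℕ} (hV : ValSpec F d q g M T) (hH : depthBound (8 * (M + 1)) + 1 ≤ H) (thr : List ℝ)
    {v : Val} {P : Finset Pt} {φ : ℕ} (h : Rep (d + 1) v P φ) (hM : P.card ≤ M) :
    ∃ t, Fn F (12 * (d + 1) + 6) (.pair v (.pair (encList .num thr) q))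
      (.num ((∑ p ∈ P, upTo (d + 1) thr p * g p : ℤ) : ℝ)) t ∧
      t ≤ (2 * T + 400) * H := by
  obtain ⟨s, h⟩ := h
  obtain ⟨t, ht, hb⟩ := cnt_spec hF h3 hV thr h hM
  refine ⟨t, ?_, hb.trans ?_⟩
  · have e : ∑ p ∈ P, upTo (d + 1) thr p * g p =
        ∑ p ∈ P.filter (fun p => cmpList (key (d + 1) p) thr ≤ 0), g p := by
      rw [Finset.sum_filter]
      exact Finset.sum_congr rfl fun p _ => by unfold upTo; split_ifs <;> simp
    rw [e]; exact ht
  · rw [mul_comm]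
    have := depthBound_mono (show 2 * P.card ≤ 8 * (M + 1) by omega)
    exact Nat.mul_le_mul_left _ (by omega)

theorem valSpec_one {F : List Expr} (hF : HasTreeFuns F) (q : Val) (thr : List ℝ) {M H : ℕ}
    (hH : depthBound (8 * (M + 1)) + 1 ≤ H) :
    ValSpec F 1 (.pair (encList .num thr) q) (upTo 1 thr) M (700 * H) := by
  intro n s v P φ h hM
  have hf : F[12 * (1 + 1) + 5]? = some (valE 2) :=
    hF.level (d := 2) (k := 5) (by norm_num) (by norm_num) (by norm_num)
  refine Fn.intro hf ?_
  cases h with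
  | nil => simp [valE, onNode]; omega
  | node hN hn hc hP hPN hNP hs hl hr ha =>
    obtain ⟨t, ht, hb⟩ := Rep.cnt hF (by norm_num) (valSpec_zero hF q M) hH thr ha hM
    simp only [valE, onNode, nodeVal, wp, lookup, Val.onPair_pair]
    exact ⟨_, t, ht, by simp, by omega⟩

/-- The contribution of a point to the number of squares outside of the `i`-th conflict set. -/
noncomputable def surplus (i b : ℝ) (thr : List ℝ) (p : Pt) : ℤ :=
  upTo 2 [-1, b] p * upTo 1 thr p -
    (upTo 2 [i, b] p * upTo 1 thr p - upTo 2 [i - 1 / 2, 0] p * upTo 1 thr p)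

/-- Three prefix counts at level 2, each of which costs at most 1800 H². -/
theorem valSpec_two {F : List Expr} (hF : HasTreeFuns F) (q : Val) (i b : ℝ) (thr : List ℝ)
    {M H : ℕ} (hH : depthBound (8 * (M + 1)) + 1 ≤ H) :
    ValSpec F 2 (.pair (.num i) (.pair (.num b) (.pair (encList .num thr) q))) (surplus i b thr) M
      (6000 * H ^ 2) := by
  intro n s v P φ h hM
  have hf : F[12 * (2 + 1) + 5]? = some (valE 3) :=
    hF.level (d := 3) (k := 5) (by norm_num) (by norm_num) (by norm_num)
  refine Fn.intro hf ?_
  have hH1 : 1 ≤ H := by omega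
  cases h with
  | nil => simp [valE, onNode]; nlinarith
  | node hN hn hc hP hPN hNP hs hl hr ha =>
    obtain ⟨t₁, ht₁, hb₁⟩ := Rep.cnt hF (by norm_num) (valSpec_one hF q thr hH) hH [-1, b] ha hM
    obtain ⟨t₂, ht₂, hb₂⟩ := Rep.cnt hF (by norm_num) (valSpec_one hF q thr hH) hH [i, b] ha hM
    obtain ⟨t₃, ht₃, hb₃⟩ := Rep.cnt hF (by norm_num) (valSpec_one hF q thr hH) hH
      [i - 1 / 2, 0] ha hM
    simp only [encList_cons, encList_nil] at ht₁ ht₂ ht₃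
    simp only [valE, onNode, nodeVal, listE, wp, lookup, Val.onPair_pair, Val.onNum_num, Arith.eval]
    refine ⟨_, t₁, by simpa using ht₁, _, t₂, ht₂, _, t₃, by simpa using ht₃, ?_⟩
    simp only [Val.onNum_num, surplus, Finset.sum_sub_distrib]
    refine ⟨by push_cast; ring_nf, ?_⟩
    have : (2 * (700 * H) + 400) * H ≤ 1800 * H ^ 2 := by nlinarith
    have : 1 ≤ H ^ 2 := Nat.one_le_pow _ _ hH1
    omega

/-! ### Size -/

/-- The payloads of one depth belong to disjoint sets of points, so they cost X |P| together. -/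
theorem Tree.size_le {key : Pt → List ℝ} {B : ℕ → ℕ} {R : Val → Finset Pt → ℕ → Prop} {M X : ℕ}
    (hR : ∀ {v P φ}, R v P φ → P.card ≤ M → v.size ≤ 1 + X * P.card) {n s : ℕ} {v : Val}
    {P : Finset Pt} {φ : ℕ} (h : Tree key B R n s v P φ) (hM : P.card ≤ M) :
    v.size ≤ 1 + (X + 30) * (P.card * depthBound n) := by
  induction h with
  | nil => simp [Val.size]
  | @node n N c sl sr k vl vr va P φl φr φa hN hn hc hP hPN hNP hs hl hr ha ihl ihr =>
    have hcb := card_below_add_card_above_le key k P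
    have h1 := ihl (by omega)
    have h2 := ihr (by omega)
    have h3 := hR ha hM
    have hchild := depthBound_succ_le (a := N / 2 + c) (n := n) (by omega) (by omega)
    -- N ≥ 1, 4c ≤ N and N ≤ |P| + c exclude nodes without points, so the constant size of a node
    -- can be charged to its points.
    have hpos : 1 ≤ P.card := by omega
    simp only [nodeVal, Pt.enc, Val.size]
    set D := depthBound (N / 2 + c)
    have j1 : (X + 30) * ((ptsBelow key k P).card * D) + (X + 30) * ((ptsAbove key k P).card * D) ≤
        (X + 30) * (P.card * D) := by
      rw [← mul_add, ← add_mul]; gcongr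
    have j2 : (X + 30) * (P.card * D) + X * P.card + 30 * P.card ≤
        (X + 30) * (P.card * depthBound n) := by
      calc _ = (X + 30) * (P.card * (D + 1)) := by ring
        _ ≤ _ := by gcongr
    omega

/-- The constants of the size bounds. -/
def sizeConst : ℕ → ℕ
  | 0 => 0
  | d + 1 => sizeConst d + 30

theorem Rep.size_le {d M H : ℕ} (hH : depthBound (8 * (M + 1)) + 1 ≤ H) {v : Val} {P : Finset Pt}
    {φ : ℕ} (h : Rep d v P φ) (hM : P.card ≤ M) : v.size ≤ 1 + sizeConst d * H ^ d * P.card := by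
  induction d generalizing v P φ with
  | zero => obtain ⟨rfl, -⟩ := h; simp [Val.size]
  | succ d ih =>
    obtain ⟨s, h⟩ := h
    refine (h.size_le (M := M) (fun h hM => ih h hM) hM).trans ?_
    have h1 := depthBound_mono (show 2 * P.card ≤ 8 * (M + 1) by omega)
    have hW : 1 ≤ H ^ d := Nat.one_le_pow _ _ (by omega)
    calc 1 + (sizeConst d * H ^ d + 30) * (P.card * depthBound (2 * P.card))
        ≤ 1 + (sizeConst d * H ^ d + 30 * H ^ d) * (P.card * H) := by gcongr <;> omega
      _ = _ := by rw [sizeConst]; ring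

/-! ### The program for the data structure -/

/-- The triple of trees; the empty value stands for three empty trees. -/
def normE : Expr := .casePair (.var 0) (.var 2) (.pair .nil (.pair .nil .nil))

/-- Update of three trees, for the three rotations of a point. -/
def updThreeE : Expr :=
  .casePair (.var 0) (.casePair (.var 1) (.casePair (.var 2) (.casePair (.var 1)
    (.casePair (.var 4) (.casePair (.var 1) (.casePair (.var 1)
      (.pair (.call 38 (.pair (.var 8) (.var 13)))
        (.pair
          (.call 38 (.pair (.var 6) (.pair
            (.pair (.var 4) (.pair (.var 0) (.pair (.var 1) (.var 2)))) (.var 11))))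
          (.call 38 (.pair (.var 7) (.pair
            (.pair (.var 4) (.pair (.var 1) (.pair (.var 2) (.var 0)))) (.var 11))))))
    .nil) .nil) .nil) .nil) .nil) .nil) .nil

/-- The tree of level `1` for all points. -/
def baseE : Expr :=
  .casePair (.var 0) (onNode (.var 0) (onNode (.var 1) (.var 1) .nil) .nil) .nil

/-- The number of occurrences of a point. -/
def memE : Expr :=
  .casePair (.var 0) (.casePair (.var 1) (.casePair (.var 1) (.casePair (.var 1)
    (.letIn (.call 50 (.var 6))
      (.arith .sub
        (.call 18 (.pair (.var 0) (.pair (listE [.var 2, .var 3, .var 1, .var 5]) .nil)))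
        (.call 18 (.pair (.var 0) (.pair
          (listE [.var 2, .var 3, .var 1, .arith .sub (.var 5) (.const (1 / 2))]) .nil)))))
    .nil) .nil) .nil) .nil

/-- Insertion of a point that may be present, or deletion of one that may be absent. -/
def setE : Expr :=
  .casePair (.var 0) (.casePair (.var 1)
    (.letIn (.call 51 (.pair (.var 2) (.var 0)))
      (.letIn (.arith .add (.var 2) (.arith .add (.var 0) (.var 0)))
        (.ifLe (.const 1) (.var 0)
          (.ifLe (.var 0) (.const 1) (.call 49 (.var 6)) (.var 4)) (.var 4))))
    .nil) .nil

/-- Deletion of all points with given coordinates. -/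
def deleteAllE : Expr :=
  .casePair (.var 0) (.casePair (.var 1) (.casePair (.var 1)
    (.letIn (.call 50 (.var 4))
      (.letIn (.call 18 (.pair (.var 0) (.pair
          (listE [.var 2, .var 3, .var 1, .const (-2)]) .nil)))
        (.letIn (.call 19 (.pair (.var 1) (.pair (.var 0) .nil)))
          (.casePair (.var 0)
            (.letIn (.call 13 (.pair (.var 2) (listE [.var 6, .var 7, .var 5])))
              (.ifLe (.const 0) (.var 0) (.ifLe (.var 0) (.const 0)
                (.call 53 (.pair (.call 49 (.pair (.var 10) (.pair (.var 3) (.const (-1)))))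
                  (.var 11)))
                (.var 10)) (.var 10)))
            (.var 7)))))
    .nil) .nil) .nil

/-- Search for a point in a box outside of a conflict set. -/
def findE : Expr :=
  .casePair (.var 0) (.casePair (.var 1) (.casePair (.var 1)
    (.letIn (.call 42 (.pair (.var 4) (.pair (listE [.var 2]) (.var 1))))
      (.letIn (.call 43 (.pair (.var 5) (.pair (.var 0) (.var 2))))
        (.casePair (.var 0) (.casePair (.var 1)
          (.ifLe (.var 0) (.var 6) (.var 4) .nil) .nil) .nil)))
    .nil) .nil) .nil

/-- The square with given coordinates. -/
def squareE (x y w : Expr) : Expr :=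
  .pair x (.pair (.arith .sub (.const 0) y) (.pair w
    (.arith .add w (.arith .sub (.arith .sub (.const 0) y) x))))

/-- All functions of the program. -/
def allFuns : List Expr :=
  treeFuns ++ [normE, updThreeE, baseE, memE, setE, deleteAllE, findE]

theorem hasTreeFuns : HasTreeFuns allFuns := fun i hi => by
  rw [allFuns, List.getElem?_append_left (by exact hi)]

theorem buildSpec {d : ℕ} (hd : d ≤ 2) : BuildSpec allFuns d := by
  induction d with
  | zero => exact buildSpec_zero hasTreeFuns
  | succ d ih => exact buildSpec_succ hasTreeFuns (by omega) hd (ih (by omega))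

theorem toListSpec {d : ℕ} (hd : d ≤ 2) : ToListSpec allFuns d := by
  induction d with
  | zero => exact toListSpec_zero hasTreeFuns
  | succ d ih => exact toListSpec_succ hasTreeFuns (by omega) (ih (by omega))

theorem updSpec {d : ℕ} (hd : d ≤ 3) : UpdSpec allFuns d := by
  induction d with
  | zero => exact updSpec_zero hasTreeFuns
  | succ d ih =>
    exact updSpec_succ hasTreeFuns (by omega) (buildSpec (by omega)) (toListSpec (by omega))
      (ih (by omega))

/-! ### Three trees -/

/-- Rotation of the coordinates. -/
def Pt.rot (p : Pt) : Pt := ⟨p.lab, p.y, p.w, p.x⟩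

theorem Pt.rot_injective : Function.Injective Pt.rot := by
  intro p q h
  simp only [Pt.rot, Pt.mk.injEq] at h
  ext <;> tauto

/-- The points with rotated coordinates. -/
noncomputable def rotate (P : Finset Pt) : Finset Pt := P.image Pt.rot

theorem card_rotate (P : Finset Pt) : (rotate P).card = P.card :=
  Finset.card_image_of_injective _ Pt.rot_injective

theorem mem_rotate {P : Finset Pt} {p : Pt} : p ∈ rotate P ↔ p.rot.rot ∈ P := by
  rw [rotate, Finset.mem_image]
  exact ⟨by rintro ⟨q, hq, rfl⟩; exact hq, fun h => ⟨_, h, rfl⟩⟩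

theorem Change.rotate {p : Pt} {δ : ℝ} {P P' : Finset Pt} (h : Change p δ P P') :
    Change p.rot δ (rotate P) (rotate P') := by
  rcases h with ⟨rfl, hp, rfl⟩ | ⟨rfl, hp, rfl⟩
  · exact .inl ⟨rfl, fun h => hp (mem_rotate.1 h), by rw [SquareDS.rotate, Finset.image_insert]; rfl⟩
  · exact .inr ⟨rfl, mem_rotate.2 hp, by
      rw [SquareDS.rotate, Finset.image_erase Pt.rot_injective]; rfl⟩

/-- The value is a triple of trees for the three rotations of `P`, of total potential `φ`. -/
def Triple (v : Val) (P : Finset Pt) (φ : ℕ) : Prop :=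
  ∃ a b c φa φb φc, v = .pair a (.pair b c) ∧ Rep 3 a P φa ∧ Rep 3 b (rotate P) φb ∧
    Rep 3 c (rotate (rotate P)) φc ∧ φ = φa + φb + φc

/-- The stored value: a triple of trees, or the empty value for the empty set. -/
def Stored (v : Val) (P : Finset Pt) (φ : ℕ) : Prop :=
  Triple v P φ ∨ (v = .nil ∧ P = ∅ ∧ φ = 0)

theorem rep_nil (d : ℕ) : Rep (d + 1) .nil ∅ 0 := ⟨0, .nil⟩

theorem norm_spec {v : Val} {P : Finset Pt} {φ : ℕ} (h : Stored v P φ) :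
    ∃ v' t, Fn allFuns 48 v v' t ∧ Triple v' P φ ∧ t ≤ 20 := by
  have hf : allFuns[48]? = some normE := rfl
  rcases h with h | ⟨rfl, rfl, rfl⟩
  · obtain ⟨a, b, c, φa, φb, φc, rfl, h'⟩ := id h
    obtain ⟨t, ht, hb⟩ := Fn.intro (u := .pair a (.pair b c)) (v := .pair a (.pair b c)) (B := 20)
      hf (by simp [normE])
    exact ⟨_, t, ht, h, hb⟩
  · obtain ⟨t, ht, hb⟩ := Fn.intro (u := .nil) (v := .pair .nil (.pair .nil .nil)) (B := 20)
      hf (by simp [normE])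
    exact ⟨_, t, ht, ⟨_, _, _, 0, 0, 0, rfl, rep_nil 2, rep_nil 2, rep_nil 2, rfl⟩, hb⟩

theorem updThree_spec {v : Val} {P P' : Finset Pt} {φ : ℕ} {p : Pt} {δ : ℝ} {M H : ℕ}
    (h : Triple v P φ) (hch : Change p δ P P') (hM : P.card ≤ M)
    (hH : depthBound (8 * (M + 1)) + 1 ≤ H) :
    ∃ v' t φ', Fn allFuns 49 (.pair v (.pair p.enc (.num δ))) v' t ∧ Triple v' P' φ' ∧
      t + φ' ≤ φ + (3 * updConst 3 + 100) * H ^ 3 := by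
  have hf : allFuns[49]? = some updThreeE := rfl
  have hH3 : 1 ≤ H ^ 3 := Nat.one_le_pow _ _ (by omega)
  have hH' : ∀ {Q : Finset Pt}, Q.card ≤ M → depthBound (8 * (Q.card + 1)) + 1 ≤ H := fun hQ =>
    (Nat.add_le_add_right (depthBound_mono (by omega)) 1).trans hH
  obtain ⟨a, b, c, φa, φb, φc, rfl, ha, hb, hc, rfl⟩ := h
  obtain ⟨a', ta, φa', hta, ha', hba⟩ := updSpec le_rfl ha hch (hH' hM)
  obtain ⟨b', tb, φb', htb, hb', hbb⟩ := updSpec le_rfl hb hch.rotate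
    (hH' (by rw [card_rotate]; exact hM))
  obtain ⟨c', tc, φc', htc, hc', hbc⟩ := updSpec le_rfl hc hch.rotate.rotate
    (hH' (by rw [card_rotate, card_rotate]; exact hM))
  obtain ⟨t, ht, hbt⟩ := Fn.intro (u := .pair (.pair a (.pair b c)) (.pair p.enc (.num δ)))
    (v := .pair a' (.pair b' c')) (B := ta + tb + tc + 100) hf (by
      simp only [Pt.enc, Pt.rot] at hta htb htc
      simp only [updThreeE, Pt.enc, wp, lookup, Val.onPair_pair]
      exact ⟨_, ta, hta, _, tb, htb, _, tc, htc, rfl, by omega⟩)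
  refine ⟨_, t, _, ht, ⟨a', b', c', φa', φb', φc', rfl, ha', hb', hc', rfl⟩, ?_⟩
  have : (3 * updConst 3 + 100) * H ^ 3 = 3 * (updConst 3 * H ^ 3) + 100 * H ^ 3 := by ring
  omega

theorem base_spec {v : Val} {P : Finset Pt} {φ : ℕ} (h : Triple v P φ) :
    ∃ A φ' t, Fn allFuns 50 v A t ∧ Rep 1 A P φ' ∧ t ≤ 60 := by
  have hf : allFuns[50]? = some baseE := rfl
  obtain ⟨a, b, c, φa, φb, φc, rfl, ⟨s, ha⟩, -⟩ := h
  cases ha with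
  | nil =>
    obtain ⟨t, ht, hb⟩ := Fn.intro (u := .pair .nil (.pair b c)) (v := .nil) (B := 60) hf
      (by simp [baseE, onNode])
    exact ⟨.nil, 0, t, ht, rep_nil 0, hb⟩
  | @node _ N₁ c₁ _ _ k₁ l₁ r₁ _ _ _ _ _ hN hn hc hP hPN hNP hs hl hr ha =>
    obtain ⟨s, ha⟩ := ha
    cases ha with
    | nil => simp at hNP; omega
    | @node _ N₂ c₂ _ _ k₂ l₂ r₂ A _ _ _ _ hN' hn' hc' hP' hPN' hNP' hs' hl' hr' ha' =>
      obtain ⟨t, ht, hb⟩ := Fn.intro (v := A) (B := 60)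
        (u := .pair (nodeVal k₁ N₁ c₁ l₁ r₁ (nodeVal k₂ N₂ c₂ l₂ r₂ A)) (.pair b c)) hf
        (by
          simp only [baseE, onNode, nodeVal, wp, lookup, Val.onPair_pair]
          exact ⟨trivial, by omega⟩)
      exact ⟨_, _, t, ht, ha', hb⟩

/-! ### Labels, membership and updates of single points. -/

/-- Labels are integers, and at least `-1`. -/
def IsLabel (x : ℝ) : Prop := ∃ z : ℤ, -1 ≤ z ∧ x = z

theorem IsLabel.sub_half_lt {x y : ℝ} (hx : IsLabel x) (hy : IsLabel y) :
    x ≤ y - 1 / 2 ↔ x < y := by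
  obtain ⟨z, -, rfl⟩ := hx
  obtain ⟨z', -, rfl⟩ := hy
  constructor
  · intro h; linarith
  · intro h
    have : z + 1 ≤ z' := by exact_mod_cast h
    have : (z : ℝ) + 1 ≤ z' := by exact_mod_cast this
    linarith

theorem IsLabel.neg_one_le {x : ℝ} (hx : IsLabel x) : -1 ≤ x := by
  obtain ⟨z, h, rfl⟩ := hx
  exact_mod_cast h

theorem cmpList_cons_self (a : ℝ) (l l' : List ℝ) : cmpList (a :: l) (a :: l') = cmpList l l' := by
  simp [cmpList]

theorem cmpList_cons_of_ne {a b : ℝ} (h : a ≠ b) (l l' : List ℝ) :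
    cmpList (a :: l) (b :: l') = if a ≤ b then -1 else 1 := by
  rw [cmpList]
  split_ifs with h1 h2
  · exact absurd (le_antisymm h1 h2) h
  · rfl
  · rfl

theorem cmpList_singleton (a b : ℝ) (l : List ℝ) : cmpList (a :: l) [b] ≤ 0 ↔ a ≤ b := by
  rw [cmpList]
  split_ifs with h1 h2 <;> simp [h1, cmpList]

/-- Labels are integers and come last in the key, so lowering the label of the threshold by 1/2
excludes exactly `p`. Membership thus is a difference of two prefix counts. -/
theorem upTo_sub_upTo {p q : Pt} (hp : IsLabel p.lab) (hq : IsLabel q.lab) :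
    upTo 1 [p.w, p.x, p.y, p.lab] q - upTo 1 [p.w, p.x, p.y, p.lab - 1 / 2] q =
      if q = p then 1 else 0 := by
  simp only [upTo, key, mkKey]
  by_cases h1 : q.w = p.w
  · by_cases h2 : q.x = p.x
    · by_cases h3 : q.y = p.y
      · rw [h1, h2, h3]
        simp only [cmpList_cons_self, cmpList_singleton, hq.sub_half_lt hp]
        have e : q = p ↔ q.lab = p.lab := by
          constructor
          · rintro rfl; rfl
          · intro h; ext <;> assumption
        rw [if_congr e rfl rfl]
        rcases lt_trichotomy q.lab p.lab with h | h | h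
        · simp [h.le, h, h.ne]
        · simp [h]
        · simp [not_le.2 h, not_lt.2 h.le, h.ne']
      · have : q ≠ p := fun h => h3 (by rw [h])
        rw [h1, h2]
        simp only [cmpList_cons_self, cmpList_cons_of_ne h3, if_neg this, sub_self]
    · have : q ≠ p := fun h => h2 (by rw [h])
      rw [h1]
      simp only [cmpList_cons_self, cmpList_cons_of_ne h2, if_neg this, sub_self]
  · have : q ≠ p := fun h => h1 (by rw [h])
    simp only [cmpList_cons_of_ne h1, if_neg this, sub_self]

theorem mem_spec {v : Val} {P : Finset Pt} {φ : ℕ} {p : Pt} {M H : ℕ} (h : Triple v P φ)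
    (hM : P.card ≤ M) (hH : depthBound (8 * (M + 1)) + 1 ≤ H) (hP : ∀ q ∈ P, IsLabel q.lab)
    (hp : IsLabel p.lab) :
    ∃ t, Fn allFuns 51 (.pair v p.enc) (.num (if p ∈ P then 1 else 0)) t ∧ t ≤ 2000 * H := by
  have hf : allFuns[51]? = some memE := rfl
  obtain ⟨A, φ', t, ht, hA, hb⟩ := base_spec h
  obtain ⟨t₁, ht₁, hb₁⟩ := Rep.cnt hasTreeFuns (by norm_num) (valSpec_zero hasTreeFuns .nil M) hH
    [p.w, p.x, p.y, p.lab] hA hM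
  obtain ⟨t₂, ht₂, hb₂⟩ := Rep.cnt hasTreeFuns (by norm_num) (valSpec_zero hasTreeFuns .nil M) hH
    [p.w, p.x, p.y, p.lab - 1 / 2] hA hM
  refine Fn.intro hf ?_
  simp only [encList_cons, encList_nil] at ht₁ ht₂
  simp only [memE, Pt.enc, listE, wp, lookup, Val.onPair_pair]
  refine ⟨_, t, ht, _, t₁, ht₁, ?_⟩
  simp only [Val.onNum_num, Arith.eval]
  have e : p.lab - ((1 / 2 : ℚ) : ℝ) = p.lab - 1 / 2 := by norm_num
  rw [e]
  refine ⟨_, t₂, ht₂, ?_⟩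
  simp only [Val.onNum_num]
  refine ⟨?_, by omega⟩
  rw [← Int.cast_sub, ← Finset.sum_sub_distrib]
  simp only [mul_one]
  rw [Finset.sum_congr rfl fun q hq => upTo_sub_upTo hp (hP q hq), Finset.sum_ite_eq']
  split_ifs <;> simp

theorem set_spec {v : Val} {P P' : Finset Pt} {φ : ℕ} {p : Pt} {δ : ℝ} {M H : ℕ}
    (h : Triple v P φ) (hM : P.card ≤ M) (hH : depthBound (8 * (M + 1)) + 1 ≤ H)
    (hP : ∀ q ∈ P, IsLabel q.lab) (hp : IsLabel p.lab)
    (hδ : (δ = 1 ∧ P' = insert p P) ∨ (δ = -1 ∧ P' = P.erase p)) :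
    ∃ v' t φ', Fn allFuns 52 (.pair v (.pair p.enc (.num δ))) v' t ∧ Triple v' P' φ' ∧
      t + φ' ≤ φ + (3 * updConst 3 + 3000) * H ^ 3 := by
  have hf : allFuns[52]? = some setE := rfl
  obtain ⟨t, ht, hb⟩ := mem_spec h hM hH hP hp
  have hHH : H ≤ H ^ 3 := by
    calc H = H * 1 := (mul_one H).symm
      _ ≤ H * H ^ 2 := Nat.mul_le_mul_left _ (Nat.one_le_pow _ _ (by omega))
      _ = H ^ 3 := by ring
  have hK : (3 * updConst 3 + 3000) * H ^ 3 =
    (3 * updConst 3 + 100) * H ^ 3 + 2000 * H ^ 3 + 900 * H ^ 3 := by ring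
  by_cases hc : Change p δ P P'
  · obtain ⟨v', t', φ', ht', hv', hb'⟩ := updThree_spec h hc hM hH
    obtain ⟨t'', ht'', hb''⟩ := Fn.intro (u := .pair v (.pair p.enc (.num δ))) (v := v')
      (B := t + t' + 50) hf (by
        simp only [setE, wp, lookup, Val.onPair_pair]
        refine ⟨_, t, ht, ?_⟩
        simp only [Val.onNum_num, Arith.eval]
        -- The number δ + 2 [p ∈ P] is 1 exactly if the update changes the set: δ = 1 with `p`
        -- absent, or δ = -1 with `p` present. In the other two cases it is 3 or -1.
        have e : δ + ((if p ∈ P then 1 else 0) + (if p ∈ P then 1 else 0)) = 1 := by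
          rcases hc with ⟨rfl, h1, -⟩ | ⟨rfl, h1, -⟩ <;> simp [h1]
        rw [e]
        refine ⟨fun _ => ⟨fun _ => ⟨_, t', ht', rfl, by omega⟩, fun h => ?_⟩, fun h => ?_⟩
        · norm_num at h
        · norm_num at h)
    exact ⟨v', t'', φ', ht'', hv', by omega⟩
  · have hPP : P' = P := by
      rcases hδ with ⟨rfl, rfl⟩ | ⟨rfl, rfl⟩
      · exact Finset.insert_eq_of_mem (by_contra fun h => hc (.inl ⟨rfl, h, rfl⟩))
      · exact Finset.erase_eq_of_notMem fun h => hc (.inr ⟨rfl, h, rfl⟩)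
    obtain ⟨t'', ht'', hb''⟩ := Fn.intro (u := .pair v (.pair p.enc (.num δ))) (v := v)
      (B := t + 50) hf (by
        simp only [setE, wp, lookup, Val.onPair_pair]
        refine ⟨_, t, ht, ?_⟩
        simp only [Val.onNum_num, Arith.eval]
        have e : δ + ((if p ∈ P then 1 else 0) + (if p ∈ P then 1 else 0)) ≠ 1 := by
          rcases hδ with ⟨rfl, rfl⟩ | ⟨rfl, rfl⟩
          · have : p ∈ P := by_contra fun h => hc (.inl ⟨rfl, h, rfl⟩)
            simp [this]
          · have : p ∉ P := fun h => hc (.inr ⟨rfl, h, rfl⟩)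
            simp [this]; norm_num
        refine ⟨fun h1 => ⟨fun h2 => absurd (le_antisymm ?_ ?_) e, fun _ => ⟨trivial, by omega⟩⟩,
          fun _ => ⟨trivial, by omega⟩⟩
        · simpa using h2
        · simpa using h1)
    exact ⟨v, t'', φ, ht'', hPP ▸ h, by omega⟩

/-! ### Deletion of a square from all sets -/

/-- The point has the given coordinates. -/
def AtPos (x y w : ℝ) (p : Pt) : Prop := p.x = x ∧ p.y = y ∧ p.w = w

noncomputable instance (x y w : ℝ) : DecidablePred (AtPos x y w) := fun _ => Classical.dec _

/-- The label is the last entry of a level-1 key, so the points at one position form an interval of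
the order. It starts after the key with label -2, which is smaller than all labels. -/
theorem atPos_of_between {x y w : ℝ} {k p : Pt} (h1 : key 1 ⟨-2, x, y, w⟩ < key 1 k)
    (h2 : key 1 k ≤ key 1 p) (hp : AtPos x y w p) : AtPos x y w k := by
  obtain ⟨rfl, rfl, rfl⟩ := hp
  rw [← not_lt] at h2
  simp only [key, mkKey, List.cons_lt_cons_iff] at h1 h2
  push Not at h2
  obtain ⟨a1, h2⟩ := h2
  rcases h1 with h1 | ⟨e1, h1⟩
  · exact absurd h1 (not_lt.2 a1)
  obtain ⟨a2, h2⟩ := h2 e1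
  rcases h1 with h1 | ⟨e2, h1⟩
  · exact absurd h1 (not_lt.2 a2)
  obtain ⟨a3, -⟩ := h2 e2
  rcases h1 with h1 | ⟨e3, -⟩
  · exact absurd h1 (not_lt.2 a3)
  exact ⟨e2.symm, e3.symm, e1.symm⟩

theorem lt_key_of_atPos {x y w : ℝ} {p : Pt} (hp : AtPos x y w p) (hl : -1 ≤ p.lab) :
    key 1 ⟨-2, x, y, w⟩ < key 1 p := by
  obtain ⟨rfl, rfl, rfl⟩ := hp
  simp only [key, mkKey, List.cons_lt_cons_iff, lt_irrefl, true_and, false_or]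
  left; linarith

theorem cmpList_eq_zero_iff_atPos {x y w : ℝ} {p : Pt} :
    cmpList (key 1 p) [w, x, y] = 0 ↔ AtPos x y w p := by
  simp only [key, mkKey, AtPos]
  by_cases h1 : p.w = w
  · by_cases h2 : p.x = x
    · by_cases h3 : p.y = y
      · simp [h1, h2, h3, cmpList]
      · rw [h1, h2, cmpList_cons_self, cmpList_cons_self, cmpList_cons_of_ne h3]
        split_ifs <;> simp [h3]
    · rw [h1, cmpList_cons_self, cmpList_cons_of_ne h2]
      split_ifs <;> simp [h2]
  · rw [cmpList_cons_of_ne h1]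
    split_ifs <;> simp [h1]

theorem sum_upTo_key (P : Finset Pt) (k : Pt) :
    ∑ p ∈ P, upTo 1 (key 1 k) p * 1 = ((P.filter fun p => key 1 p ≤ key 1 k).card : ℤ) := by
  rw [Finset.card_filter]
  push_cast
  exact Finset.sum_congr rfl fun p _ => by
    rw [mul_one, upTo]; exact if_congr (cmpList_key_nonpos 1 p k) rfl rfl

/-- The first point of `P` from the position `(x, y, w)` on. -/
theorem firstAt_spec {M H : ℕ} (hH : depthBound (8 * (M + 1)) + 1 ≤ H) (x y w : ℝ) {v : Val}
    {P : Finset Pt} {φ : ℕ} (h : Triple v P φ) (hM : P.card ≤ M)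
    (hP : ∀ q ∈ P, IsLabel q.lab) :
    ∃ A t₀ s t₁ u t₂, Fn allFuns 50 v A t₀ ∧
      Fn allFuns 18 (.pair A (.pair (encList .num (key 1 ⟨-2, x, y, w⟩)) .nil)) s t₁ ∧
      Fn allFuns 19 (.pair A (.pair s .nil)) u t₂ ∧ t₀ + t₁ + t₂ ≤ 1500 * H ∧
      ((u = .nil ∧ ∀ p ∈ P, ¬ AtPos x y w p) ∨ ∃ k ∈ P, u = k.enc ∧
        (¬ AtPos x y w k → ∀ p ∈ P, ¬ AtPos x y w p)) := by
  obtain ⟨A, φA, t₀, ht₀, hA, hb₀⟩ := base_spec h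
  obtain ⟨t₁, ht₁, hb₁⟩ := Rep.cnt hasTreeFuns (by norm_num) (valSpec_zero hasTreeFuns .nil M) hH
    (key 1 ⟨-2, x, y, w⟩) hA hM
  have hs := sum_upTo_key P ⟨-2, x, y, w⟩
  rw [zero_add, hs] at ht₁
  -- Exactly `s` points precede the position, so selection with rank `s`, counted from 0, returns
  -- the first point that does not.
  set s := (P.filter fun p => key 1 p ≤ key 1 ⟨-2, x, y, w⟩).card with hsdef
  obtain ⟨sA, hA'⟩ := hA
  obtain ⟨u, t₂, ht₂, hb₂, hu⟩ := sel_spec hasTreeFuns (by norm_num)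
    (valSpec_zero hasTreeFuns .nil M) hA' hM (s : ℤ) (by omega)
  simp only [Finset.sum_const, nsmul_eq_mul, mul_one, zero_add, Nat.cast_le, Nat.cast_lt] at hu
  refine ⟨A, t₀, _, t₁, u, t₂, ht₀, ht₁, ht₂, ?_, ?_⟩
  · have := depthBound_mono (show 2 * P.card ≤ 8 * (M + 1) by omega)
    nlinarith
  rcases hu with ⟨rfl, hu⟩ | ⟨k, rfl, h1, h2⟩
  · refine .inl ⟨rfl, fun p hp hpos => ?_⟩
    have e := Finset.eq_of_subset_of_card_le
      (Finset.filter_subset (fun p => key 1 p ≤ key 1 ⟨-2, x, y, w⟩) P) hu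
    rw [← e] at hp
    exact absurd (Finset.mem_filter.1 hp).2
      (not_le.2 (lt_key_of_atPos hpos (hP p (Finset.mem_filter.1 hp).1).neg_one_le))
  · have hk : k ∈ P := by
      by_contra hk
      refine absurd (h1.trans_lt h2) (not_lt.2 (Finset.card_le_card fun p hp => ?_))
      rw [Finset.mem_filter] at hp ⊢
      refine ⟨hp.1, lt_of_le_of_ne hp.2 fun e => hk ?_⟩
      rw [← key_one_injective e]; exact hp.1
    refine .inr ⟨k, hk, rfl, fun hkpos p hp hpos => hkpos ?_⟩
    have hlt : key 1 ⟨-2, x, y, w⟩ < key 1 k := by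
      by_contra hle
      refine absurd h2 (not_lt.2 (Finset.card_le_card fun q hq => ?_))
      rw [Finset.mem_filter] at hq ⊢
      exact ⟨hq.1, hq.2.trans (not_lt.1 hle)⟩
    refine atPos_of_between hlt ?_ hpos
    by_contra hpk
    refine absurd h1 (not_le.2 (Finset.card_lt_card (Finset.ssubset_iff.2 ⟨p, ?_, ?_⟩)))
    · intro hp'
      exact absurd (Finset.mem_filter.1 hp').2
        (not_le.2 (lt_key_of_atPos hpos (hP p hp).neg_one_le))
    · refine Finset.insert_subset (Finset.mem_filter.2 ⟨hp, not_le.1 hpk⟩) fun q hq => ?_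
      rw [Finset.mem_filter] at hq ⊢
      exact ⟨hq.1, hq.2.trans_lt hlt⟩

/-- Each round removes the first point at the position. One more round finds none and stops, whence
j + 1. -/
theorem deleteAll_spec {M H : ℕ} (hH : depthBound (8 * (M + 1)) + 1 ≤ H) (x y w : ℝ) {j : ℕ}
    {v : Val} {P : Finset Pt} {φ : ℕ} (h : Triple v P φ) (hM : P.card ≤ M)
    (hP : ∀ q ∈ P, IsLabel q.lab) (hj : (P.filter (AtPos x y w)).card = j) :
    ∃ v' t φ', Fn allFuns 53 (.pair v (.pair (.num x) (.pair (.num y) (.num w)))) v' t ∧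
      Triple v' (P.filter fun p => ¬ AtPos x y w p) φ' ∧
      t + φ' ≤ φ + (j + 1) * ((3 * updConst 3 + 6000) * H ^ 3) := by
  have hf : allFuns[53]? = some deleteAllE := rfl
  have hHH : H ≤ H ^ 3 := by
    calc H = H * 1 := (mul_one H).symm
      _ ≤ H * H ^ 2 := Nat.mul_le_mul_left _ (Nat.one_le_pow _ _ (by omega))
      _ = H ^ 3 := by ring
  have hK : (3 * updConst 3 + 6000) * H ^ 3 = (3 * updConst 3 + 100) * H ^ 3 + 5900 * H ^ 3 := by
    ring
  have hid : ∀ {P : Finset Pt}, (∀ p ∈ P, ¬ AtPos x y w p) →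
      (P.filter fun p => ¬ AtPos x y w p) = P := fun h => Finset.filter_true_of_mem h
  induction j generalizing v P φ with
  | zero =>
    have hno : ∀ p ∈ P, ¬ AtPos x y w p := by
      rwa [Finset.card_eq_zero, Finset.filter_eq_empty_iff] at hj
    obtain ⟨A, t₀, s, t₁, u, t₂, ht₀, ht₁, ht₂, hb, hu⟩ := firstAt_spec hH x y w h hM hP
    rw [hid hno]
    obtain ⟨t, ht, hbt⟩ := Fn.intro (u := .pair v (.pair (.num x) (.pair (.num y) (.num w))))
      (v := v) (B := 1500 * H + 400) hf (by
        simp only [key, mkKey, encList_cons, encList_nil] at ht₁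
        simp only [deleteAllE, listE, wp, lookup, Val.onPair_pair]
        refine ⟨_, t₀, ht₀, _, t₁, by simpa using ht₁, _, t₂, ht₂, ?_⟩
        rcases hu with ⟨rfl, -⟩ | ⟨k, hk, rfl, -⟩
        · simp only [Val.onPair_nil]
          exact ⟨trivial, by omega⟩
        · obtain ⟨t₃, ht₃, hb₃⟩ := thrCmp_spec hasTreeFuns (d := 1) (by norm_num) (by norm_num) k
            [w, x, y]
          simp only [encList_cons, encList_nil, Pt.enc] at ht₃
          simp only [Pt.enc, Val.onPair_pair]
          refine ⟨_, t₃, ht₃, ?_⟩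
          simp only [Val.onNum_num]
          have hne : cmpList (key 1 k) [w, x, y] ≠ 0 :=
            fun h => hno k hk (cmpList_eq_zero_iff_atPos.1 h)
          refine ⟨fun h1 => ⟨fun h2 => absurd ?_ hne, fun _ => ⟨trivial, by omega⟩⟩,
            fun _ => ⟨trivial, by omega⟩⟩
          exact le_antisymm (by simpa using h2) (by simpa using h1))
    exact ⟨v, t, φ, ht, h, by omega⟩
  | succ j ih =>
    obtain ⟨A, t₀, s, t₁, u, t₂, ht₀, ht₁, ht₂, hb, hu⟩ := firstAt_spec hH x y w h hM hP
    obtain ⟨k₀, hk₀⟩ : (P.filter (AtPos x y w)).Nonempty := by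
      rw [← Finset.card_pos]; omega
    rw [Finset.mem_filter] at hk₀
    obtain ⟨k, hk, rfl, hkk⟩ := hu.resolve_left fun h => h.2 _ hk₀.1 hk₀.2
    have hpos : AtPos x y w k := by_contra fun hn => hkk hn _ hk₀.1 hk₀.2
    obtain ⟨v', t', φ', ht', hv', hb'⟩ := updThree_spec h (p := k) (δ := -1)
      (.inr ⟨rfl, hk, rfl⟩) hM hH
    obtain ⟨v'', t'', φ'', ht'', hv'', hb''⟩ := ih hv'
      ((Finset.card_le_card (Finset.erase_subset _ _)).trans hM)
      (fun q hq => hP q (Finset.mem_of_mem_erase hq))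
      (by rw [Finset.filter_erase, Finset.card_erase_of_mem (Finset.mem_filter.2 ⟨hk, hpos⟩), hj]
          rfl)
    have e : ((P.erase k).filter fun p => ¬ AtPos x y w p) = P.filter fun p => ¬ AtPos x y w p := by
      rw [Finset.filter_erase]
      exact Finset.erase_eq_of_notMem fun h => (Finset.mem_filter.1 h).2 hpos
    rw [e] at hv''
    obtain ⟨t, ht, hbt⟩ := Fn.intro (u := .pair v (.pair (.num x) (.pair (.num y) (.num w))))
      (v := v'') (B := 1500 * H + 400 + t' + t'') hf (by
        obtain ⟨t₃, ht₃, hb₃⟩ := thrCmp_spec hasTreeFuns (d := 1) (by norm_num) (by norm_num) k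
          [w, x, y]
        simp only [key, mkKey, encList_cons, encList_nil] at ht₁
        rw [cmpList_eq_zero_iff_atPos.2 hpos] at ht₃
        simp only [encList_cons, encList_nil, Pt.enc] at ht₂ ht₃ ht'
        simp only [deleteAllE, listE, wp, lookup, Val.onPair_pair]
        refine ⟨_, t₀, ht₀, _, t₁, by simpa using ht₁, _, t₂, ht₂, ?_⟩
        simp only [Val.onPair_pair]
        refine ⟨_, t₃, ht₃, ?_⟩
        simp only [Val.onNum_num]
        refine ⟨fun _ => ⟨fun _ => ⟨_, t', by simpa using ht', _, t'', ht'', rfl, by omega⟩,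
          fun h => absurd h ?_⟩, fun h => absurd h ?_⟩ <;> norm_num)
    refine ⟨v'', t, φ'', ht, hv'', ?_⟩
    have : (j + 1 + 1) * ((3 * updConst 3 + 6000) * H ^ 3) =
      (j + 1) * ((3 * updConst 3 + 6000) * H ^ 3) + (3 * updConst 3 + 6000) * H ^ 3 := by ring
    omega

/-! ### Search -/

/-- There is a square with the coordinates of `p` that is not in the `i`-th conflict set, and the
last two coordinates are bounded by `b` and `a`. -/
def Free (P : Finset Pt) (i b a : ℝ) (p : Pt) : Prop :=
  (⟨-1, p.x, p.y, p.w⟩ : Pt) ∈ P ∧ (⟨i, p.x, p.y, p.w⟩ : Pt) ∉ P ∧ p.y ≤ b ∧ p.w ≤ a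

/-- As -1 is the smallest label, the prefix up to (-1, b) contains label -1 only. For label i the
smaller labels are subtracted by the prefix up to (i - 1/2, 0), whose second entry is irrelevant
because no label equals i - 1/2. -/
theorem surplus_eq {i b a : ℝ} {p : Pt} (hi : IsLabel i) (hp : IsLabel p.lab) :
    surplus i b [a] p = if p.y ≤ b ∧ p.w ≤ a then
      (if p.lab = -1 then 1 else 0) - (if p.lab = i then 1 else 0) else 0 := by
  have h0 : upTo 1 [a] p = if p.w ≤ a then 1 else 0 := if_congr (cmpList_singleton _ _ _) rfl rfl
  have h1 : upTo 2 [-1, b] p = if p.lab = -1 ∧ p.y ≤ b then 1 else 0 := by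
    unfold upTo
    refine if_congr ?_ rfl rfl
    by_cases h : p.lab = -1
    · simp only [key, mkKey, h, cmpList_cons_self, true_and, cmpList_singleton]
    · have : ¬ p.lab ≤ -1 := fun h' => h (le_antisymm h' hp.neg_one_le)
      simp [key, mkKey, cmpList_cons_of_ne h, h, this]
  have h2 : upTo 2 [i - 1 / 2, 0] p = if p.lab < i then 1 else 0 := by
    unfold upTo
    refine if_congr ?_ rfl rfl
    have h : p.lab ≠ i - 1 / 2 := fun h => by
      have h1 := (hp.sub_half_lt hi).1 h.le
      obtain ⟨z, -, hz⟩ := hp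
      obtain ⟨z', -, rfl⟩ := hi
      rw [hz] at h h1
      have : z + 1 ≤ z' := by exact_mod_cast h1
      have : (z : ℝ) + 1 ≤ z' := by exact_mod_cast this
      linarith
    rw [← hp.sub_half_lt hi]
    simp only [key, mkKey, cmpList_cons_of_ne h]
    split_ifs with h' <;> simp only [h'] <;> decide
  have h3 : upTo 2 [i, b] p = if p.lab < i ∨ (p.lab = i ∧ p.y ≤ b) then 1 else 0 := by
    unfold upTo
    refine if_congr ?_ rfl rfl
    by_cases h : p.lab = i
    · simp only [key, mkKey, h, cmpList_cons_self, true_and, cmpList_singleton, lt_irrefl, false_or]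
    · simp only [key, mkKey, cmpList_cons_of_ne h, h, false_and, or_false, lt_iff_le_and_ne, ne_eq,
        not_false_eq_true, and_true]
      split_ifs with h' <;> simp only [h'] <;> decide
  rw [surplus, h0, h1, h2, h3]
  by_cases ha : p.w ≤ a <;> by_cases hb : p.y ≤ b <;> by_cases h : p.lab = i <;> simp [ha, hb, h]

/-- Changing label i into -1 maps the members of R_i in the box bijectively to the squares of the
box that belong to R_i. The condition `f` is compatible with this because level-3 keys contain no
label. -/
theorem sum_surplus {P : Finset Pt} {i b a : ℝ} (hi : IsLabel i)
    (hP : ∀ p ∈ P, IsLabel p.lab) (hsub : ∀ p ∈ P, (⟨-1, p.x, p.y, p.w⟩ : Pt) ∈ P)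
    (f : List ℝ → Prop) [DecidablePred f] [DecidablePred (Free P i b a)] :
    ∑ p ∈ P.filter (fun p => f (key 3 p)), surplus i b [a] p =
      (((P.filter fun p => p.lab = -1 ∧ Free P i b a p).filter fun p => f (key 3 p)).card : ℤ) := by
  set Q := P.filter fun p => f (key 3 p) ∧ p.y ≤ b ∧ p.w ≤ a with hQ
  have e1 : ∑ p ∈ P.filter (fun p => f (key 3 p)), surplus i b [a] p =
      ((Q.filter fun p => p.lab = -1).card : ℤ) - (Q.filter fun p => p.lab = i).card := by
    rw [Finset.card_filter, Finset.card_filter]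
    push_cast
    rw [← Finset.sum_sub_distrib, hQ, ← Finset.filter_filter,
      Finset.sum_filter (fun p : Pt => p.y ≤ b ∧ p.w ≤ a)]
    exact Finset.sum_congr rfl fun p hp => surplus_eq hi (hP p (Finset.mem_filter.1 hp).1)
  have e2 : (Q.filter fun p => p.lab = i).card =
      ((Q.filter fun p => p.lab = -1).filter fun p => (⟨i, p.x, p.y, p.w⟩ : Pt) ∈ P).card := by
    refine Finset.card_bij' (fun p _ => ⟨-1, p.x, p.y, p.w⟩) (fun p _ => ⟨i, p.x, p.y, p.w⟩)
      ?_ ?_ ?_ ?_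
    · intro p hp
      simp only [hQ, Finset.mem_filter] at hp ⊢
      obtain ⟨⟨hp, h⟩, rfl⟩ := hp
      exact ⟨⟨⟨hsub p hp, h⟩, trivial⟩, hp⟩
    · intro p hp
      simp only [hQ, Finset.mem_filter] at hp ⊢
      exact ⟨⟨hp.2, hp.1.1.2⟩, trivial⟩
    · intro p hp
      rw [← (Finset.mem_filter.1 hp).2]
    · intro p hp
      rw [← (Finset.mem_filter.1 (Finset.mem_filter.1 hp).1).2]
  have e3 : ((P.filter fun p => p.lab = -1 ∧ Free P i b a p).filter fun p => f (key 3 p)) =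
      (Q.filter fun p => p.lab = -1).filter fun p => ¬ (⟨i, p.x, p.y, p.w⟩ : Pt) ∈ P := by
    ext p
    simp only [hQ, Finset.mem_filter]
    constructor
    · rintro ⟨⟨hp, hl, -, h1, h2⟩, h3⟩
      exact ⟨⟨⟨hp, h3, h2⟩, hl⟩, h1⟩
    · rintro ⟨⟨⟨hp, h3, h2⟩, hl⟩, h1⟩
      exact ⟨⟨hp, hl, hsub p hp, h1, h2⟩, h3⟩
  rw [e1, e2, e3, ← Finset.card_filter_add_card_filter_not
    (s := Q.filter fun p => p.lab = -1) fun p => (⟨i, p.x, p.y, p.w⟩ : Pt) ∈ P]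
  push_cast; ring

theorem key_three_lt {p q : Pt} (h : p.x < q.x) : key 3 p < key 3 q := by
  simp only [key, mkKey, List.cons_lt_cons_iff]; exact .inl h

theorem le_of_key_three_le {p q : Pt} (h : key 3 p ≤ key 3 q) : p.x ≤ q.x := by
  by_contra hlt
  exact absurd (key_three_lt (not_le.1 hlt)) (not_lt.2 h)

/-- If r free squares have x ≤ lo, then selection with rank r finds the first free one with x > lo.
As keys start with x, it lies within the upper bound if any of them does. -/
theorem find_spec {M H : ℕ} (hH : depthBound (8 * (M + 1)) + 1 ≤ H) {T : Val} {P : Finset Pt}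
    {φ : ℕ} (h : Rep 3 T P φ) (hM : P.card ≤ M) (hP : ∀ p ∈ P, IsLabel p.lab)
    (hsub : ∀ p ∈ P, (⟨-1, p.x, p.y, p.w⟩ : Pt) ∈ P) {i : ℝ} (hi : IsLabel i)
    (lo hi' b a : ℝ) :
    ∃ u t, Fn allFuns 54 (.pair T (.pair (.num lo) (.pair (.num hi')
        (.pair (.num i) (.pair (.num b) (.pair (encList .num [a]) .nil)))))) u t ∧
      t ≤ 40000 * H ^ 3 ∧
      ((u = .nil ∧ ∀ p, Free P i b a p → ¬ (lo < p.x ∧ p.x ≤ hi')) ∨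
        ∃ p : Pt, u = p.enc ∧ Free P i b a p ∧ lo < p.x ∧ p.x ≤ hi') := by
  classical
  have hf : allFuns[54]? = some findE := rfl
  have hV : ValSpec allFuns 2 _ _ M _ := valSpec_two hasTreeFuns .nil i b [a] hH
  set S := P.filter fun p => p.lab = -1 ∧ Free P i b a p with hS
  obtain ⟨t₁, ht₁, hb₁⟩ := Rep.cnt hasTreeFuns le_rfl hV hH [lo] h hM
  have e1 : ∑ p ∈ P, upTo (2 + 1) [lo] p * surplus i b [a] p =
      ((S.filter fun p => cmpList (key 3 p) [lo] ≤ 0).card : ℤ) := by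
    rw [← sum_surplus hi hP hsub (fun k => cmpList k [lo] ≤ 0), Finset.sum_filter]
    exact Finset.sum_congr rfl fun p _ => by unfold upTo; split_ifs <;> simp
  have e2 : (S.filter fun p => cmpList (key 3 p) [lo] ≤ 0) = S.filter fun p => p.x ≤ lo :=
    Finset.filter_congr fun p _ => cmpList_singleton _ _ _
  rw [e1, e2] at ht₁
  obtain ⟨s, h⟩ := h
  obtain ⟨u, t₂, ht₂, hb₂, hu⟩ := sel_spec hasTreeFuns le_rfl hV h hM
    ((S.filter fun p => p.x ≤ lo).card : ℤ) (by omega)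
  have hall : ∑ p ∈ P, surplus i b [a] p = (S.card : ℤ) := by
    have := sum_surplus (b := b) (a := a) hi hP hsub (fun _ => True)
    simpa using this
  have hlt : ∀ k : Pt, ∑ p ∈ P.filter (fun p => key (2 + 1) p < key (2 + 1) k), surplus i b [a] p =
      ((S.filter fun p => key 3 p < key 3 k).card : ℤ) := fun k =>
    sum_surplus hi hP hsub (fun l => l < key 3 k)
  have hle : ∀ k : Pt, ∑ p ∈ P.filter (fun p => key (2 + 1) p ≤ key (2 + 1) k), surplus i b [a] p =
      ((S.filter fun p => key 3 p ≤ key 3 k).card : ℤ) := fun k =>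
    sum_surplus hi hP hsub (fun l => l ≤ key 3 k)
  simp only [hall, hlt, hle, Nat.cast_le, Nat.cast_lt] at hu
  have hmem : ∀ p : Pt, Free P i b a p → (⟨-1, p.x, p.y, p.w⟩ : Pt) ∈ S := fun p hp =>
    Finset.mem_filter.2 ⟨hp.1, rfl, hp⟩
  have hH1 : 1 ≤ H := by omega
  have hHH : H ≤ H ^ 3 := by
    calc H = H * 1 := (mul_one H).symm
      _ ≤ H * H ^ 2 := Nat.mul_le_mul_left _ (Nat.one_le_pow _ _ (by omega))
      _ = H ^ 3 := by ring
  have hB : t₁ + t₂ + 200 ≤ 40000 * H ^ 3 := by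
    have h1 : (2 * (6000 * H ^ 2) + 400) * H = 12000 * H ^ 3 + 400 * H := by ring
    have h2 : t₂ ≤ H * (3 * (6000 * H ^ 2) + 400) := hb₂.trans (Nat.mul_le_mul_right _ (by
      have := depthBound_mono (show 2 * P.card ≤ 8 * (M + 1) by omega)
      omega))
    have h3 : H * (3 * (6000 * H ^ 2) + 400) = 18000 * H ^ 3 + 400 * H := by ring
    omega
  rcases hu with ⟨rfl, hu⟩ | ⟨k, rfl, h1, h2⟩
  · obtain ⟨t, ht, hb⟩ := Fn.intro (v := .nil) (B := t₁ + t₂ + 200)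
      (u := .pair T (.pair (.num lo) (.pair (.num hi')
        (.pair (.num i) (.pair (.num b) (.pair (encList .num [a]) .nil)))))) hf (by
        simp only [encList_cons, encList_nil] at ht₁ ht₂
        simp only [findE, listE, wp, lookup, Val.onPair_pair, encList_cons, encList_nil]
        refine ⟨_, t₁, ht₁, _, t₂, ht₂, ?_⟩
        simp only [Val.onPair_nil]
        exact ⟨trivial, by omega⟩)
    refine ⟨_, t, ht, hb.trans hB, .inl ⟨rfl, fun p hp hx => ?_⟩⟩
    have e := Finset.eq_of_subset_of_card_le (Finset.filter_subset (fun p => p.x ≤ lo) S) hu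
    have hpS := hmem p hp
    rw [← e] at hpS
    exact absurd (Finset.mem_filter.1 hpS).2 (not_le.2 hx.1)
  · have hklo : lo < k.x := by
      by_contra hk
      refine absurd h2 (not_lt.2 (Finset.card_le_card fun p hp => ?_))
      rw [Finset.mem_filter] at hp ⊢
      exact ⟨hp.1, (le_of_key_three_le hp.2).trans (not_lt.1 hk)⟩
    -- The selected key is that of a free square, but the stored point may carry another label or be
    -- deleted. `Free` depends only on the coordinates, which are all that the answer needs.
    have hkS : Free P i b a k := by
      obtain ⟨p, hp, hpk⟩ : ∃ p ∈ S, key 3 p = key 3 k := by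
        by_contra hno
        push Not at hno
        refine absurd (h1.trans_lt h2) (not_lt.2 (Finset.card_le_card fun p hp => ?_))
        rw [Finset.mem_filter] at hp ⊢
        exact ⟨hp.1, lt_of_le_of_ne hp.2 (hno p hp.1)⟩
      simp only [key, mkKey, List.cons.injEq, and_true] at hpk
      have := (Finset.mem_filter.1 hp).2.2
      rwa [Free, hpk.1, hpk.2.1, hpk.2.2] at this
    by_cases hkhi : k.x ≤ hi'
    · obtain ⟨t, ht, hb⟩ := Fn.intro (v := k.enc) (B := t₁ + t₂ + 200)
        (u := .pair T (.pair (.num lo) (.pair (.num hi')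
          (.pair (.num i) (.pair (.num b) (.pair (encList .num [a]) .nil)))))) hf (by
          simp only [encList_cons, encList_nil, Pt.enc] at ht₁ ht₂
          simp only [findE, listE, wp, lookup, Val.onPair_pair, encList_cons, encList_nil]
          refine ⟨_, t₁, ht₁, _, t₂, ht₂, ?_⟩
          simp only [Val.onPair_pair, Val.onNum_num]
          exact ⟨fun _ => ⟨rfl, by omega⟩, fun h => absurd hkhi h⟩)
      exact ⟨_, t, ht, hb.trans hB, .inr ⟨k, rfl, hkS, hklo, hkhi⟩⟩
    · obtain ⟨t, ht, hb⟩ := Fn.intro (v := .nil) (B := t₁ + t₂ + 200)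
        (u := .pair T (.pair (.num lo) (.pair (.num hi')
          (.pair (.num i) (.pair (.num b) (.pair (encList .num [a]) .nil)))))) hf (by
          simp only [encList_cons, encList_nil, Pt.enc] at ht₁ ht₂
          simp only [findE, listE, wp, lookup, Val.onPair_pair, encList_cons, encList_nil]
          refine ⟨_, t₁, ht₁, _, t₂, ht₂, ?_⟩
          simp only [Val.onPair_pair, Val.onNum_num]
          exact ⟨fun h => absurd h hkhi, fun _ => ⟨trivial, by omega⟩⟩)
      refine ⟨_, t, ht, hb.trans hB, .inl ⟨rfl, fun p hp hx => ?_⟩⟩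
      refine absurd h1 (not_le.2 (Finset.card_lt_card (Finset.ssubset_iff.2
        ⟨⟨-1, p.x, p.y, p.w⟩, fun hp' => absurd (Finset.mem_filter.1 hp').2 (not_le.2 hx.1),
          Finset.insert_subset (Finset.mem_filter.2 ⟨hmem p hp, ?_⟩) fun q hq => ?_⟩)))
      · exact key_three_lt (p := ⟨-1, p.x, p.y, p.w⟩) (hx.2.trans_lt (not_le.1 hkhi))
      · rw [Finset.mem_filter] at hq ⊢
        exact ⟨hq.1, key_three_lt (hq.2.trans_lt hklo)⟩

/-! ### The implementation -/

/-- Binds the coordinates of the square at variable `1`: bottom, top, right, left are then the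
variables `0`, `1`, `2`, `4`. -/
def onSquareE (body : Expr) : Expr :=
  .casePair (.var 1) (.casePair (.var 1) (.casePair (.var 1) body .nil) .nil) .nil

/-- Insertion or deletion of the point of a square with label `lab`. -/
def setPtE (lab : Expr) (δ : ℚ) : Expr :=
  onSquareE (.call 52 (.pair (.call 48 (.var 6)) (.pair
    (.pair lab (.pair (.var 4) (.pair (.arith .sub (.const 0) (.var 2)) (.var 0)))) (.const δ))))

/-- Deletion of a square. -/
def deleteE : Expr :=
  onSquareE (.call 53 (.pair (.call 48 (.var 6))
    (.pair (.var 4) (.pair (.arith .sub (.const 0) (.var 2)) (.var 0)))))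

/-- A search in the tree `T`. -/
def searchE (T lo hi i b a : Expr) : Expr :=
  .call 54 (.pair T (.pair lo (.pair hi (.pair i (.pair b (.pair (listE [a]) .nil))))))

/-- The square of the point at variable `0`, or `next` if there is none. -/
def answerE (x y w next : Expr) : Expr :=
  .casePair (.var 0) (.casePair (.var 1) (.casePair (.var 1) (squareE x y w) .nil) .nil) next

/-- The three searches of a query. -/
def searchesE : Expr :=
  .letIn (searchE (.var 2) (.var 6) (.var 10) (.var 16) (.arith .sub (.const 0) (.var 12)) (.var 9))
    (answerE (.var 2) (.var 0) (.var 1)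
    (.letIn (searchE (.var 1) (.arith .sub (.const 0) (.var 5)) (.arith .sub (.const 0) (.var 13))
        (.var 17) (.var 10) (.var 11))
      (answerE (.var 1) (.var 2) (.var 0)
      (.letIn (searchE (.var 3) (.var 7) (.var 11) (.var 18) (.var 12)
          (.arith .sub (.const 0) (.var 14)))
        (answerE (.var 0) (.var 1) (.var 2) .nil)))))

/-- The query. -/
def queryE : Expr :=
  .pair (.var 0) (onSquareE (.casePair (.var 9) (.casePair (.var 1)
    (.casePair (.call 48 (.var 10)) (.casePair (.var 1) searchesE .nil) .nil) .nil) .nil))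

/-- The data structure. -/
def implementation : Implementation where
  funs := allFuns
  insert := setPtE (.const (-1)) 1
  delete := deleteE
  insertConflict := setPtE (.var 8) 1
  deleteConflict := setPtE (.var 8) (-1)
  query := queryE

/-! ### The points of a configuration -/

/-- The point of a square. -/
noncomputable def Square.pt (lab : ℝ) (ρ : Square) : Pt := ⟨lab, ρ.left, 0 - ρ.right, ρ.bottom⟩

/-- The sides are equal, so the top is determined by the three stored coordinates. -/
theorem Square.pt_inj {a b : ℝ} {ρ σ : Square} : ρ.pt a = σ.pt b ↔ a = b ∧ ρ = σ := by
  simp only [Square.pt, Pt.mk.injEq, zero_sub, neg_inj]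
  refine and_congr_right fun _ => ⟨fun ⟨h1, h2, h3⟩ => ?_, by rintro rfl; simp⟩
  have := ρ.sides_eq
  have := σ.sides_eq
  exact Square.ext h1 h2 h3 (by linarith)

theorem atPos_pt {a : ℝ} {ρ σ : Square} :
    AtPos ρ.left (0 - ρ.right) ρ.bottom (σ.pt a) ↔ σ = ρ := by
  rw [← (Square.pt_inj (a := a) (b := a)).trans (and_iff_right rfl)]
  simp only [AtPos, Square.pt, Pt.mk.injEq, true_and]

namespace Config

/-- The points that represent a configuration. -/
noncomputable def points (c : Config) : Finset Pt :=
  c.squares.image (Square.pt (-1)) ∪ c.incidences.image fun p => p.2.pt p.1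

variable {c : Config}

theorem mem_points {p : Pt} : p ∈ c.points ↔
    (∃ ρ ∈ c.squares, p = ρ.pt (-1)) ∨ ∃ i ρ, (i, ρ) ∈ c.incidences ∧ p = ρ.pt i := by
  simp only [points, Finset.mem_union, Finset.mem_image, Prod.exists, eq_comm]

theorem cast_ne_neg_one (i : ℕ) : (i : ℝ) ≠ -1 := fun h => by
  have := Nat.cast_nonneg (α := ℝ) i
  linarith

theorem pt_mem_points {ρ : Square} : ρ.pt (-1) ∈ c.points ↔ ρ ∈ c.squares := by
  rw [mem_points]
  constructor
  · rintro (⟨σ, hσ, h⟩ | ⟨i, σ, -, h⟩)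
    · rwa [(Square.pt_inj.1 h).2]
    · exact absurd (Square.pt_inj.1 h).1.symm (cast_ne_neg_one i)
  · exact fun h => .inl ⟨ρ, h, rfl⟩

theorem pt_mem_points' {ρ : Square} {i : ℕ} : ρ.pt i ∈ c.points ↔ (i, ρ) ∈ c.incidences := by
  rw [mem_points]
  constructor
  · rintro (⟨σ, -, h⟩ | ⟨j, σ, hσ, h⟩)
    · exact absurd (Square.pt_inj.1 h).1 (cast_ne_neg_one i)
    · obtain ⟨h1, rfl⟩ := Square.pt_inj.1 h
      rwa [Nat.cast_injective h1]
  · exact fun h => .inr ⟨i, ρ, h, rfl⟩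

theorem mem_conflictSet {i : ℕ} {ρ : Square} : ρ ∈ c.conflictSet i ↔ (i, ρ) ∈ c.incidences := by
  simp only [conflictSet, Finset.mem_image, Finset.mem_filter, Prod.exists]
  exact ⟨by rintro ⟨j, σ, ⟨h, rfl⟩, rfl⟩; exact h, fun h => ⟨i, ρ, ⟨h, rfl⟩, rfl⟩⟩

theorem mem_labels {i : ℕ} {ρ : Square} (h : (i, ρ) ∈ c.incidences) : i ∈ c.labels :=
  Finset.mem_image.2 ⟨_, h, rfl⟩

theorem WellFormed.mem_squares (hc : c.WellFormed) {i : ℕ} {ρ : Square}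
    (h : (i, ρ) ∈ c.incidences) : ρ ∈ c.squares :=
  hc.1 i (mem_conflictSet.2 h)

theorem points_insert (ρ : Square) :
    (c.apply (.insert ρ)).points = insert (ρ.pt (-1)) c.points := by
  simp [apply, points, Finset.image_insert, Finset.insert_union]

theorem points_insertConflict (ρ : Square) (i : ℕ) :
    (c.apply (.insertConflict ρ i)).points = insert (ρ.pt i) c.points := by
  simp [apply, points, Finset.image_insert, Finset.union_insert]

theorem points_deleteConflict (ρ : Square) (i : ℕ) :
    (c.apply (.deleteConflict ρ i)).points = c.points.erase (ρ.pt i) := by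
  ext p
  rw [Finset.mem_erase, mem_points, mem_points]
  simp only [apply, Finset.mem_erase]
  constructor
  · rintro (⟨σ, hσ, rfl⟩ | ⟨j, σ, ⟨hj, hσ⟩, rfl⟩)
    · exact ⟨fun h => cast_ne_neg_one i (Square.pt_inj.1 h).1.symm, .inl ⟨σ, hσ, rfl⟩⟩
    · refine ⟨fun h => hj ?_, .inr ⟨j, σ, hσ, rfl⟩⟩
      obtain ⟨h1, rfl⟩ := Square.pt_inj.1 h
      rw [Nat.cast_injective h1]
  · rintro ⟨hne, ⟨σ, hσ, rfl⟩ | ⟨j, σ, hσ, rfl⟩⟩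
    · exact .inl ⟨σ, hσ, rfl⟩
    · refine .inr ⟨j, σ, ⟨fun h => hne ?_, hσ⟩, rfl⟩
      obtain ⟨rfl, rfl⟩ := Prod.mk.inj h
      rfl

theorem points_delete (ρ : Square) : (c.apply (.delete ρ)).points =
    c.points.filter fun p => ¬ AtPos ρ.left (0 - ρ.right) ρ.bottom p := by
  ext p
  rw [Finset.mem_filter, mem_points, mem_points]
  simp only [apply, Finset.mem_erase, Finset.mem_filter]
  constructor
  · rintro (⟨σ, ⟨hne, hσ⟩, rfl⟩ | ⟨j, σ, ⟨hσ, hne⟩, rfl⟩)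
    · exact ⟨.inl ⟨σ, hσ, rfl⟩, by rwa [atPos_pt]⟩
    · exact ⟨.inr ⟨j, σ, hσ, rfl⟩, by rwa [atPos_pt]⟩
  · rintro ⟨⟨σ, hσ, rfl⟩ | ⟨j, σ, hσ, rfl⟩, hne⟩ <;> rw [atPos_pt] at hne
    · exact .inl ⟨σ, ⟨hne, hσ⟩, rfl⟩
    · exact .inr ⟨j, σ, ⟨hσ, hne⟩, rfl⟩

theorem z_eq_card (c : Config) : c.z = c.incidences.card := by
  rw [z, labels, Finset.card_eq_sum_card_image Prod.fst]
  refine Finset.sum_congr rfl fun i _ => ?_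
  rw [conflictSet, Finset.card_image_of_injOn]
  rintro ⟨a, ρ⟩ ha ⟨b, σ⟩ hb rfl
  rw [Finset.mem_coe, Finset.mem_filter] at ha hb
  rw [Prod.mk.injEq]
  exact ⟨ha.2.trans hb.2.symm, rfl⟩

theorem card_points_le (c : Config) : c.points.card ≤ c.m + c.z := by
  rw [z_eq_card]
  exact (Finset.card_union_le _ _).trans
    (Nat.add_le_add Finset.card_image_le Finset.card_image_le)

/-- This is where k ≤ m enters: it bounds the number of points polynomially in m. -/
theorem WellFormed.z_le (hc : c.WellFormed) : c.z ≤ c.m ^ 2 := by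
  calc c.z ≤ ∑ _i ∈ c.labels, c.m := Finset.sum_le_sum fun i _ => Finset.card_le_card (hc.1 i)
    _ = c.k * c.m := by rw [Finset.sum_const, smul_eq_mul]; rfl
    _ ≤ c.m ^ 2 := by rw [sq]; exact Nat.mul_le_mul_right _ hc.2

theorem isLabel_lab {p : Pt} (hp : p ∈ c.points) : IsLabel p.lab := by
  rcases mem_points.1 hp with ⟨ρ, -, rfl⟩ | ⟨i, ρ, -, rfl⟩
  · exact ⟨-1, le_rfl, by simp [Square.pt]⟩
  · exact ⟨i, by omega, by simp [Square.pt]⟩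

theorem WellFormed.square_mem_points (hc : c.WellFormed) {p : Pt} (hp : p ∈ c.points) :
    (⟨-1, p.x, p.y, p.w⟩ : Pt) ∈ c.points := by
  rcases mem_points.1 hp with ⟨ρ, hρ, rfl⟩ | ⟨i, ρ, hρ, rfl⟩
  · exact pt_mem_points.2 hρ
  · exact pt_mem_points.2 (hc.mem_squares hρ)

theorem WellFormed.card_atPos_le (hc : c.WellFormed) (ρ : Square) :
    (c.points.filter (AtPos ρ.left (0 - ρ.right) ρ.bottom)).card ≤ 1 + c.l := by
  by_cases hρ : ρ ∈ c.squares
  · have hsub : c.points.filter (AtPos ρ.left (0 - ρ.right) ρ.bottom) ⊆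
        insert (ρ.pt (-1)) ((c.labels.filter fun i => ρ ∈ c.conflictSet i).image
          fun i : ℕ => ρ.pt i) := by
      intro p hp
      rw [Finset.mem_filter] at hp
      rw [Finset.mem_insert, Finset.mem_image]
      rcases mem_points.1 hp.1 with ⟨σ, hσ, rfl⟩ | ⟨i, σ, hσ, rfl⟩
      · exact .inl (by rw [atPos_pt.1 hp.2])
      · obtain rfl := atPos_pt.1 hp.2
        exact .inr ⟨i, Finset.mem_filter.2 ⟨mem_labels hσ, mem_conflictSet.2 hσ⟩, rfl⟩
    refine (Finset.card_le_card hsub).trans ((Finset.card_insert_le _ _).trans ?_)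
    rw [add_comm]
    exact Nat.add_le_add_left (Finset.card_image_le.trans (Finset.le_sup
      (f := fun ρ => (c.labels.filter fun i => ρ ∈ c.conflictSet i).card) hρ)) 1
  · rw [Finset.card_eq_zero.2 (Finset.filter_eq_empty_iff.2 ?_)]
    · omega
    · intro p hp hpos
      rcases mem_points.1 hp with ⟨σ, hσ, rfl⟩ | ⟨i, σ, hσ, rfl⟩ <;> rw [atPos_pt] at hpos <;>
        subst hpos
      · exact hρ hσ
      · exact hρ (hc.mem_squares hσ)

/-- The top of ρ is at least its center, hence at least the center of σ, hence at least the bottom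
of σ and the height of C. So the upper side of ρ restricts neither the intersection nor the
containment. The right sides are negated to turn all bounds of the box into upper ones. -/
theorem isHit_iff {σ : Square} {i : ℕ} {C : HSegment} (hA : c.Allows (.query σ i C)) (ρ : Square) :
    c.IsHit σ i C ρ ↔ (ρ.pt (-1) ∈ c.points ∧ ρ.pt i ∉ c.points) ∧
      (ρ.left ≤ σ.right ∧ 0 - ρ.right ≤ 0 - σ.left ∧ ρ.bottom ≤ σ.top) ∧
      (C.left < ρ.left ∨ 0 - C.right < 0 - ρ.right ∨ C.height < ρ.bottom) := by
  rw [IsHit, pt_mem_points, pt_mem_points', mem_conflictSet]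
  by_cases hρ : ρ ∈ c.squares
  · have h1 := hA.1 ρ hρ
    have h2 := hA.2
    have h3 := σ.sides_eq
    have h4 := σ.left_lt_right
    have h5 := ρ.sides_eq
    have h6 := ρ.left_lt_right
    have h7 := C.left_le_right
    simp only [Square.centerY] at h1
    have e1 : (ρ.toSet ∩ σ.toSet).Nonempty ↔
        (ρ.left ≤ σ.right ∧ 0 - ρ.right ≤ 0 - σ.left ∧ ρ.bottom ≤ σ.top) := by
      rw [Square.toSet, Square.toSet, Set.prod_inter_prod, Set.prod_nonempty_iff,
        Set.Icc_inter_Icc, Set.Icc_inter_Icc, Set.nonempty_Icc, Set.nonempty_Icc]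
      simp only [sup_le_iff, le_inf_iff]
      constructor
      · rintro ⟨⟨⟨-, b⟩, a, -⟩, -, d, -⟩
        exact ⟨a, by linarith, d⟩
      · rintro ⟨a, b, d⟩
        refine ⟨⟨⟨?_, ?_⟩, ?_, ?_⟩, ⟨?_, ?_⟩, ?_, ?_⟩ <;> linarith
    have e2 : ¬ C.toSet ⊆ ρ.toSet ↔
        (C.left < ρ.left ∨ 0 - C.right < 0 - ρ.right ∨ C.height < ρ.bottom) := by
      constructor
      · intro h
        by_contra! hn
        refine h fun p hp => ?_
        obtain ⟨⟨ha, hb⟩, hh⟩ := hp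
        rw [Set.mem_singleton_iff] at hh
        refine ⟨⟨?_, ?_⟩, ?_, ?_⟩ <;> linarith
      · intro h hs
        have ha := hs (show (C.left, C.height) ∈ C.toSet from ⟨⟨le_rfl, h7⟩, rfl⟩)
        have hb := hs (show (C.right, C.height) ∈ C.toSet from ⟨⟨h7, le_rfl⟩, rfl⟩)
        have a1 : ρ.left ≤ C.left := ha.1.1
        have a2 : ρ.bottom ≤ C.height := ha.2.1
        have a3 : C.right ≤ ρ.right := hb.1.2
        rcases h with h | h | h <;> linarith
    rw [e1, e2]
    tauto
  · simp [hρ]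

end Config

/-! ### Logarithms -/

/-- One step multiplies n by at most 3/4, and log (3/4) ≤ -1/4, so the factor 4 gains 1 per step. -/
theorem depthBound_le_log {n : ℕ} (hn : 0 < n) : (depthBound n : ℝ) ≤ 4 * Real.log n + 1 := by
  induction n using Nat.strong_induction_on with
  | _ n ih =>
    rw [depthBound_of_pos hn]
    have hn1 : (1 : ℝ) ≤ n := by exact_mod_cast hn
    rcases Nat.eq_zero_or_pos (3 * n / 4) with h0 | h0
    · rw [h0, depthBound]
      have := Real.log_nonneg hn1
      push_cast; linarith
    · have h1 := ih _ (by omega) h0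
      have h2 : ((3 * n / 4 : ℕ) : ℝ) ≤ 3 / 4 * n := by
        have : ((4 * (3 * n / 4) : ℕ) : ℝ) ≤ ((3 * n : ℕ) : ℝ) := by
          exact_mod_cast Nat.mul_div_le _ _
        push_cast at this; linarith
      have h3 := Real.log_le_log (by exact_mod_cast h0) h2
      rw [Real.log_mul (by norm_num) (by positivity)] at h3
      have h4 := Real.log_le_sub_one_of_pos (show (0 : ℝ) < 3 / 4 by norm_num)
      push_cast at h1 ⊢; linarith

/-- A bound on the depth of the trees for a configuration with `m` squares. -/
def maxDepth (m : ℕ) : ℕ := depthBound (8 * (m + m ^ 2 + 1)) + 1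

theorem depthBound_le_maxDepth (m : ℕ) :
    depthBound (8 * (m + m ^ 2 + 1)) + 1 ≤ maxDepth m := le_rfl

/-- With L = log (m + 2), the bound 8 (m + m² + 1) ≤ 2³ (m + 2)² has logarithm at most 5 L. The
depth is at most 20 L + 2, and 2 ≤ 4 L because log 2 > 1/2; this is the constant 24. -/
theorem maxDepth_cubed_le (m : ℕ) : (maxDepth m : ℝ) ^ 3 ≤ 24 ^ 3 * logCubed m := by
  rw [logCubed, ← mul_pow]
  refine pow_le_pow_left₀ (by positivity) ?_ 3
  have h1 := depthBound_le_log (n := 8 * (m + m ^ 2 + 1)) (by omega)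
  have h2 : ((8 * (m + m ^ 2 + 1) : ℕ) : ℝ) ≤ 2 ^ 3 * ((m : ℝ) + 2) ^ 2 := by
    push_cast; nlinarith [Nat.cast_nonneg (α := ℝ) m]
  have h3 := Real.log_le_log (by positivity) h2
  rw [Real.log_mul (by positivity) (by positivity), Real.log_pow, Real.log_pow] at h3
  have h4 : Real.log 2 ≤ Real.log ((m : ℝ) + 2) :=
    Real.log_le_log (by norm_num) (by linarith [Nat.cast_nonneg (α := ℝ) m])
  have h5 := Real.log_two_gt_d9
  rw [maxDepth]
  push_cast at h1 h3 ⊢; linarith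

/-! ### The operations -/

/-- The constant of the amortized bounds in terms of the depth of the trees. -/
def opConst : ℕ := 3 * updConst 3 + 200000

theorem Config.WellFormed.card_points_le {c : Config} (hc : c.WellFormed) :
    c.points.card ≤ c.m + c.m ^ 2 :=
  (Config.card_points_le c).trans (Nat.add_le_add_left hc.z_le _)

theorem one_le_maxDepth_cubed (m : ℕ) : 1 ≤ maxDepth m ^ 3 :=
  Nat.one_le_pow _ _ (Nat.succ_pos _)

/-- The label is an arbitrary expression, since it is a constant for squares and an argument of the
operation for conflict sets. -/
theorem setPt_spec {c : Config} (hc : c.WellFormed) {v : Val} {φ : ℕ} (h : Stored v c.points φ)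
    {ρ : Square} {lab : Expr} {a : ℝ} {q : ℚ} {rest : List Val} {P' : Finset Pt}
    (ha : IsLabel a) (hq : ((q : ℝ) = 1 ∧ P' = insert (ρ.pt a) c.points) ∨
      ((q : ℝ) = -1 ∧ P' = c.points.erase (ρ.pt a)))
    (hlab : ∀ Q : Val → ℕ → Prop, Q (.num a) 1 →
      wp allFuns lab ([.num ρ.bottom, .num ρ.top, .num ρ.right,
        .pair (.num ρ.bottom) (.num ρ.top), .num ρ.left,
        .pair (.num ρ.right) (.pair (.num ρ.bottom) (.num ρ.top)), v, ρ.encode] ++ rest) Q) :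
    ∃ v' t φ', Eval allFuns (v :: ρ.encode :: rest) (setPtE lab q) v' t ∧ Stored v' P' φ' ∧
      t + φ' ≤ φ + opConst * maxDepth c.m ^ 3 := by
  obtain ⟨v₁, t₁, ht₁, hv₁, hb₁⟩ := norm_spec h
  obtain ⟨v', t₂, φ', ht₂, hv', hb₂⟩ := set_spec hv₁ hc.card_points_le
    (depthBound_le_maxDepth _)
    (fun _ => Config.isLabel_lab) (p := ρ.pt a) ha hq
  have h1 := one_le_maxDepth_cubed c.m
  have e : wp allFuns (setPtE lab q) (v :: ρ.encode :: rest)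
      fun u t => u = v' ∧ t ≤ t₁ + t₂ + 100 := by
    simp only [Pt.enc, Square.pt] at ht₂
    simp only [setPtE, onSquareE, Square.encode, wp, lookup, Val.onPair_pair]
    refine ⟨_, t₁, ht₁, hlab _ ?_⟩
    simp only [Val.onNum_num, Arith.eval, Rat.cast_zero]
    exact ⟨_, t₂, ht₂, rfl, by omega⟩
  obtain ⟨u, t, hu, rfl, hb⟩ := wp_sound e
  refine ⟨_, t, φ', hu, .inl hv', ?_⟩
  have : opConst * maxDepth c.m ^ 3 =
    (3 * updConst 3 + 3000) * maxDepth c.m ^ 3 + 197000 * maxDepth c.m ^ 3 := by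
    unfold opConst; ring
  omega

theorem delete_spec {c : Config} (hc : c.WellFormed) {v : Val} {φ : ℕ} (h : Stored v c.points φ)
    (ρ : Square) :
    ∃ v' t φ', Eval allFuns [v, ρ.encode] deleteE v' t ∧
      Stored v' (c.apply (.delete ρ)).points φ' ∧
      t + φ' ≤ φ + (2 + c.l) * (opConst * maxDepth c.m ^ 3) := by
  obtain ⟨v₁, t₁, ht₁, hv₁, hb₁⟩ := norm_spec h
  obtain ⟨v', t₂, φ', ht₂, hv', hb₂⟩ := deleteAll_spec (depthBound_le_maxDepth c.m) ρ.left
    (0 - ρ.right) ρ.bottom hv₁ hc.card_points_le (fun _ => Config.isLabel_lab) rfl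
  rw [← Config.points_delete] at hv'
  have h1 := one_le_maxDepth_cubed c.m
  have e : wp allFuns deleteE [v, ρ.encode] fun u t => u = v' ∧ t ≤ t₁ + t₂ + 100 := by
    simp only [deleteE, onSquareE, Square.encode, wp, lookup, Val.onPair_pair]
    refine ⟨_, t₁, ht₁, ?_⟩
    simp only [Val.onNum_num, Arith.eval, Rat.cast_zero]
    exact ⟨_, t₂, ht₂, rfl, by omega⟩
  obtain ⟨u, t, hu, rfl, hb⟩ := wp_sound e
  refine ⟨_, t, φ', hu, .inl hv', ?_⟩
  have h2 : opConst * maxDepth c.m ^ 3 =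
    (3 * updConst 3 + 6000) * maxDepth c.m ^ 3 + 194000 * maxDepth c.m ^ 3 := by
    unfold opConst; ring
  have h3 := hb₂.trans (Nat.add_le_add_left (Nat.mul_le_mul_right _
    (show _ + 1 ≤ 2 + c.l by have := hc.card_atPos_le ρ; omega)) _)
  have h4 : (2 + c.l) * (opConst * maxDepth c.m ^ 3) =
      (2 + c.l) * ((3 * updConst 3 + 6000) * maxDepth c.m ^ 3) +
        (2 + c.l) * (194000 * maxDepth c.m ^ 3) := by rw [h2, mul_add]
  have h5 : 194000 ≤ (2 + c.l) * (194000 * maxDepth c.m ^ 3) :=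
    (show 194000 ≤ 1 * (194000 * 1) by norm_num).trans
      (Nat.mul_le_mul (by omega) (Nat.mul_le_mul_left _ h1))
  omega

theorem isLabel_rotate {P : Finset Pt} (h : ∀ p ∈ P, IsLabel p.lab) : ∀ p ∈ rotate P,
    IsLabel p.lab := fun p hp =>
  h p.rot.rot (mem_rotate.1 hp)

theorem square_mem_rotate {P : Finset Pt} (h : ∀ p ∈ P, (⟨-1, p.x, p.y, p.w⟩ : Pt) ∈ P) :
    ∀ p ∈ rotate P, (⟨-1, p.x, p.y, p.w⟩ : Pt) ∈ rotate P := fun p hp =>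
  mem_rotate.2 (h p.rot.rot (mem_rotate.1 hp))

theorem Config.mem_and_notMem_points {c : Config} {i : ℕ} {x y w : ℝ}
    (h : (⟨-1, x, y, w⟩ : Pt) ∈ c.points) (h' : (⟨i, x, y, w⟩ : Pt) ∉ c.points) :
    ∃ ρ : Square, (ρ.pt (-1) ∈ c.points ∧ ρ.pt i ∉ c.points) ∧ x = ρ.left ∧ y = 0 - ρ.right ∧
      w = ρ.bottom := by
  rcases Config.mem_points.1 h with ⟨ρ, hρ, e⟩ | ⟨j, ρ, -, e⟩
  · simp only [Square.pt, Pt.mk.injEq, true_and] at e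
    obtain ⟨rfl, rfl, rfl⟩ := e
    exact ⟨ρ, ⟨h, h'⟩, rfl, rfl, rfl⟩
  · exact absurd (Pt.mk.inj e).1.symm (Config.cast_ne_neg_one j)

/-- The right-hand side is the value that `squareE` computes from the coordinates of a point. -/
theorem Square.encode_eq (ρ : Square) : ρ.encode = .pair (.num ρ.left)
    (.pair (.num (0 - (0 - ρ.right))) (.pair (.num ρ.bottom)
      (.num (ρ.bottom + (0 - (0 - ρ.right) - ρ.left))))) := by
  have e : ρ.bottom + (0 - (0 - ρ.right) - ρ.left) = ρ.top := by
    have := ρ.sides_eq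
    linarith
  rw [e, sub_sub_cancel, Square.encode]

set_option maxRecDepth 4000 in
set_option maxHeartbeats 1000000 in
-- There is one search for each of the three ways to miss C; if all fail, there is no hit. The
-- stored value is returned unchanged, so the potential plays no role.
theorem query_spec {c : Config} (hc : c.WellFormed) {v : Val} {φ : ℕ} (h : Stored v c.points φ)
    {σ : Square} {i : ℕ} {C : HSegment} (hA : c.Allows (.query σ i C)) :
    ∃ ans t, Eval allFuns [v, σ.encode, .num (i : ℝ), C.encode] queryE (.pair v ans) t ∧
      ((∃ ρ, c.IsHit σ i C ρ ∧ ans = ρ.encode) ∨ ((∀ ρ, ¬ c.IsHit σ i C ρ) ∧ ans = .nil)) ∧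
      t ≤ opConst * maxDepth c.m ^ 3 := by
  obtain ⟨v₁, t₀, ht₀, ⟨Ta, Tb, Tc, φa, φb, φc, rfl, ha, hb, hc', -⟩, hb₀⟩ := norm_spec h
  have hM := hc.card_points_le
  have hD := depthBound_le_maxDepth c.m
  have hl : ∀ p ∈ c.points, IsLabel p.lab := fun _ => Config.isLabel_lab
  have hs : ∀ p ∈ c.points, (⟨-1, p.x, p.y, p.w⟩ : Pt) ∈ c.points := fun _ =>
    hc.square_mem_points
  have hi : IsLabel i := ⟨i, by omega, by simp⟩
  obtain ⟨u₁, t₁, ht₁, hb₁, hu₁⟩ := find_spec hD ha hM hl hs hi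
    C.left σ.right (0 - σ.left) σ.top
  -- After one rotation the two-sided coordinate is -right, after two it is the bottom. The
  -- remaining two bounds rotate accordingly.
  obtain ⟨u₂, t₂, ht₂, hb₂, hu₂⟩ := find_spec hD hb (by rwa [card_rotate]) (isLabel_rotate hl)
    (square_mem_rotate hs) hi (0 - C.right) (0 - σ.left) σ.top σ.right
  obtain ⟨u₃, t₃, ht₃, hb₃, hu₃⟩ := find_spec hD hc' (by rwa [card_rotate, card_rotate])
    (isLabel_rotate (isLabel_rotate hl)) (square_mem_rotate (square_mem_rotate hs)) hi
    C.height σ.top σ.right (0 - σ.left)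
  simp only [Free, mem_rotate, Pt.rot] at hu₁ hu₂ hu₃
  have hH := one_le_maxDepth_cubed c.m
  have hB : t₀ + t₁ + t₂ + t₃ + 400 ≤ opConst * maxDepth c.m ^ 3 := by
    have h2 : opConst * maxDepth c.m ^ 3 = 3 * (updConst 3 * maxDepth c.m ^ 3) +
      200000 * maxDepth c.m ^ 3 := by unfold opConst; ring
    omega
  have hit := fun ρ => Config.isHit_iff hA ρ
  -- In terms of squares: the label `a` of the point found is arbitrary, and its coordinates are
  -- those of a hit.
  replace hu₁ : (u₁ = .nil ∧ ∀ ρ, c.IsHit σ i C ρ → ¬ C.left < ρ.left) ∨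
      ∃ ρ a, c.IsHit σ i C ρ ∧ u₁ = (ρ.pt a).enc := by
    rcases hu₁ with ⟨rfl, hu⟩ | ⟨p, rfl, ⟨h1, h2, h3, h4⟩, h5, h6⟩
    · refine .inl ⟨rfl, fun ρ hρ h => ?_⟩
      obtain ⟨⟨a1, a2⟩, ⟨b1, b2, b3⟩, -⟩ := (hit ρ).1 hρ
      exact hu (ρ.pt (-1)) ⟨a1, a2, b2, b3⟩ ⟨h, b1⟩
    · obtain ⟨ρ, hρ, e1, e2, e3⟩ := Config.mem_and_notMem_points h1 h2
      rw [e1] at h5 h6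
      rw [e2] at h3
      rw [e3] at h4
      exact .inr ⟨ρ, p.lab, (hit ρ).2 ⟨hρ, ⟨h6, h3, h4⟩, .inl h5⟩, by
        rw [Square.pt, ← e1, ← e2, ← e3]⟩
  replace hu₂ : (u₂ = .nil ∧ ∀ ρ, c.IsHit σ i C ρ → ¬ 0 - C.right < 0 - ρ.right) ∨
      ∃ ρ a, c.IsHit σ i C ρ ∧ u₂ = (ρ.pt a).rot.enc := by
    rcases hu₂ with ⟨rfl, hu⟩ | ⟨p, rfl, ⟨h1, h2, h3, h4⟩, h5, h6⟩
    · refine .inl ⟨rfl, fun ρ hρ h => ?_⟩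
      obtain ⟨⟨a1, a2⟩, ⟨b1, b2, b3⟩, -⟩ := (hit ρ).1 hρ
      exact hu (ρ.pt (-1)).rot ⟨a1, a2, b3, b1⟩ ⟨h, b2⟩
    · obtain ⟨ρ, hρ, e1, e2, e3⟩ := Config.mem_and_notMem_points h1 h2
      rw [e1] at h4
      rw [e2] at h5 h6
      rw [e3] at h3
      exact .inr ⟨ρ, p.lab, (hit ρ).2 ⟨hρ, ⟨h4, h6, h3⟩, .inr (.inl h5)⟩, by
        rw [Square.pt, ← e1, ← e2, ← e3, Pt.rot]⟩
  replace hu₃ : (u₃ = .nil ∧ ∀ ρ, c.IsHit σ i C ρ → ¬ C.height < ρ.bottom) ∨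
      ∃ ρ a, c.IsHit σ i C ρ ∧ u₃ = (ρ.pt a).rot.rot.enc := by
    rcases hu₃ with ⟨rfl, hu⟩ | ⟨p, rfl, ⟨h1, h2, h3, h4⟩, h5, h6⟩
    · refine .inl ⟨rfl, fun ρ hρ h => ?_⟩
      obtain ⟨⟨a1, a2⟩, ⟨b1, b2, b3⟩, -⟩ := (hit ρ).1 hρ
      exact hu (ρ.pt (-1)).rot.rot ⟨a1, a2, b1, b2⟩ ⟨h, b3⟩
    · obtain ⟨ρ, hρ, e1, e2, e3⟩ := Config.mem_and_notMem_points h1 h2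
      rw [e1] at h3
      rw [e2] at h4
      rw [e3] at h5 h6
      exact .inr ⟨ρ, p.lab, (hit ρ).2 ⟨hρ, ⟨h3, h4, h6⟩, .inr (.inr h5)⟩, by
        rw [Square.pt, ← e1, ← e2, ← e3, Pt.rot, Pt.rot]⟩
  obtain ⟨ok, hok⟩ : ∃ ok : Val → Prop, ok = fun ans => (∃ ρ, c.IsHit σ i C ρ ∧ ans = ρ.encode) ∨
    ((∀ ρ, ¬ c.IsHit σ i C ρ) ∧ ans = .nil) := ⟨_, rfl⟩
  have hyes : ∀ {ρ}, c.IsHit σ i C ρ → ok (.pair (.num ρ.left)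
      (.pair (.num (0 - (0 - ρ.right))) (.pair (.num ρ.bottom)
        (.num (ρ.bottom + (0 - (0 - ρ.right) - ρ.left)))))) := fun {ρ} hρ => by
    rw [hok]; exact .inl ⟨ρ, hρ, ρ.encode_eq.symm⟩
  have e : wp allFuns queryE [v, σ.encode, .num (i : ℝ), C.encode] fun u t =>
      (∃ ans, u = .pair v ans ∧ ok ans) ∧ t ≤ t₀ + t₁ + t₂ + t₃ + 400 := by
    simp only [encList_cons, encList_nil] at ht₁ ht₂ ht₃
    simp only [queryE, onSquareE, searchesE, searchE, answerE, squareE, Square.encode,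
      HSegment.encode, listE, wp, lookup, Val.onPair_pair]
    refine ⟨_, t₀, ht₀, ?_⟩
    simp only [Val.onPair_pair, Val.onNum_num, Arith.eval, Rat.cast_zero]
    refine ⟨_, t₁, ht₁, ?_⟩
    rcases hu₁ with ⟨rfl, hn₁⟩ | ⟨ρ, a, hρ, rfl⟩
    swap
    · simp only [Pt.enc, Square.pt, Val.onPair_pair, Val.onNum_num]
      exact ⟨⟨_, rfl, hyes hρ⟩, by omega⟩
    simp only [Val.onPair_nil]
    refine ⟨_, t₂, ht₂, ?_⟩
    rcases hu₂ with ⟨rfl, hn₂⟩ | ⟨ρ, a, hρ, rfl⟩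
    swap
    · simp only [Pt.enc, Square.pt, Pt.rot, Val.onPair_pair, Val.onNum_num]
      exact ⟨⟨_, rfl, hyes hρ⟩, by omega⟩
    simp only [Val.onPair_nil]
    refine ⟨_, t₃, ht₃, ?_⟩
    rcases hu₃ with ⟨rfl, hn₃⟩ | ⟨ρ, a, hρ, rfl⟩
    swap
    · simp only [Pt.enc, Square.pt, Pt.rot, Val.onPair_pair, Val.onNum_num]
      exact ⟨⟨_, rfl, hyes hρ⟩, by omega⟩
    simp only [Val.onPair_nil]
    refine ⟨⟨_, rfl, ?_⟩, by omega⟩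
    rw [hok]
    exact .inr ⟨fun ρ hρ => ((hit ρ).1 hρ).2.2.elim (hn₁ ρ hρ) fun h =>
      h.elim (hn₂ ρ hρ) (hn₃ ρ hρ), rfl⟩
  obtain ⟨u, t, hu, ⟨ans, rfl, hans⟩, hb⟩ := wp_sound e
  rw [hok] at hans
  exact ⟨ans, t, hu, hans, hb.trans hB⟩

/-- The constant of the theorem. -/
def totalConst : ℕ := (3 * opConst + 3 * sizeConst 3 + 5) * 24 ^ 3

theorem mul_maxDepth_le {a : ℕ} (ha : a ≤ 3 * opConst + 3 * sizeConst 3 + 5) (m : ℕ) :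
    ((a * maxDepth m ^ 3 : ℕ) : ℝ) ≤ totalConst * logCubed m := by
  have h1 := maxDepth_cubed_le m
  unfold totalConst
  rw [Nat.cast_mul, Nat.cast_mul, Nat.cast_pow, Nat.cast_pow, Nat.cast_ofNat, mul_assoc]
  refine mul_le_mul (by exact_mod_cast ha) h1 (by positivity) (by positivity)

theorem step_spec {c : Config} (hc : c.WellFormed) {v : Val} {φ : ℕ} (h : Stored v c.points φ)
    (op : Op) (hA : c.Allows op) :
    ∃ v' t φ', implementation.Step c v op v' t ∧ Stored v' (c.apply op).points φ' ∧
      ((t + φ' : ℕ) : ℝ) ≤ φ + totalConst * c.opBound op := by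
  have hL : ((opConst * maxDepth c.m ^ 3 : ℕ) : ℝ) ≤ totalConst * logCubed c.m :=
    mul_maxDepth_le (by omega) _
  have hL' : ∀ {n : ℕ}, n ≤ φ + opConst * maxDepth c.m ^ 3 →
      (n : ℝ) ≤ φ + totalConst * logCubed c.m := fun {n} hn => by
    have : (n : ℝ) ≤ ((φ + opConst * maxDepth c.m ^ 3 : ℕ) : ℝ) := by exact_mod_cast hn
    rw [Nat.cast_add] at this
    linarith
  have hmono : totalConst * logCubed c.m ≤ totalConst * (max 1 (c.l : ℝ) * logCubed c.m) :=
    mul_le_mul_of_nonneg_left (le_mul_of_one_le_left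
      (pow_nonneg (Real.log_nonneg (by linarith [Nat.cast_nonneg (α := ℝ) c.m])) 3)
      (le_max_left _ _)) (Nat.cast_nonneg _)
  have hnat : ∀ i : ℕ, IsLabel i := fun i => ⟨i, by omega, by simp⟩
  cases op with
  | insert ρ =>
    obtain ⟨v', t, φ', ht, hv, hb⟩ := setPt_spec hc h (ρ := ρ) (lab := .const (-1)) (a := -1)
      (q := 1) (rest := []) ⟨-1, le_rfl, by simp⟩ (.inl ⟨by simp, rfl⟩) (fun Q hQ => by
        simpa [wp] using hQ)
    exact ⟨v', t, φ', ht, by rwa [Config.points_insert],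
      (hL' hb).trans (add_le_add_right hmono _)⟩
  | delete ρ =>
    obtain ⟨v', t, φ', ht, hv, hb⟩ := delete_spec hc h ρ
    refine ⟨v', t, φ', ht, hv, ?_⟩
    have h1 : ((t + φ' : ℕ) : ℝ) ≤ ((φ + (2 + c.l) * (opConst * maxDepth c.m ^ 3) : ℕ) : ℝ) := by
      exact_mod_cast hb
    refine h1.trans ?_
    have h2 : ((3 * opConst * maxDepth c.m ^ 3 : ℕ) : ℝ) ≤ totalConst * logCubed c.m :=
      mul_maxDepth_le (by omega) _
    -- At most 1 + l points are removed and one further round ends the deletion; the factor 3 is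
    -- absorbed by `totalConst`.
    have h3 : (2 + (c.l : ℝ)) ≤ 3 * max 1 (c.l : ℝ) := by
      linarith [le_max_left 1 (c.l : ℝ), le_max_right 1 (c.l : ℝ)]
    rw [Nat.cast_add, Nat.cast_mul, Config.opBound]
    refine add_le_add_right ?_ _
    calc ((2 + c.l : ℕ) : ℝ) * ((opConst * maxDepth c.m ^ 3 : ℕ) : ℝ)
        ≤ (3 * max 1 (c.l : ℝ)) * ((opConst * maxDepth c.m ^ 3 : ℕ) : ℝ) := by
          push_cast; gcongr
      _ = max 1 (c.l : ℝ) * ((3 * opConst * maxDepth c.m ^ 3 : ℕ) : ℝ) := by push_cast; ring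
      _ ≤ max 1 (c.l : ℝ) * (totalConst * logCubed c.m) := by gcongr
      _ = _ := by ring
  | insertConflict ρ i =>
    obtain ⟨v', t, φ', ht, hv, hb⟩ := setPt_spec hc h (ρ := ρ) (lab := .var 8) (a := i)
      (q := 1) (rest := [.num (i : ℝ)]) (hnat i) (.inl ⟨by simp, rfl⟩) (fun Q hQ => by
        simpa [wp] using hQ)
    exact ⟨v', t, φ', ht, by rwa [Config.points_insertConflict], hL' hb⟩
  | deleteConflict ρ i =>
    obtain ⟨v', t, φ', ht, hv, hb⟩ := setPt_spec hc h (ρ := ρ) (lab := .var 8) (a := i)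
      (q := -1) (rest := [.num (i : ℝ)]) (hnat i) (.inr ⟨by simp, rfl⟩) (fun Q hQ => by
        simpa [wp] using hQ)
    exact ⟨v', t, φ', ht, by rwa [Config.points_deleteConflict], hL' hb⟩
  | query σ i C =>
    obtain ⟨ans, t, ht, hans, hb⟩ := query_spec hc h hA
    exact ⟨v, t, φ, ⟨ans, ht, hans⟩, h, hL' (by omega)⟩

/-! ### Sequences of operations, initial structures and the total size. -/

theorem run_spec (ops : List Op) {c : Config} (hc : c.WellFormed) (hops : c.Valid ops) {v : Val}
    {φ : ℕ} (h : Stored v c.points φ) :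
    ∃ v' t φ', implementation.Run c v ops v' t ∧ (c.applyAll ops).WellFormed ∧
      Stored v' (c.applyAll ops).points φ' ∧
      ((t + φ' : ℕ) : ℝ) ≤ φ + totalConst * c.totalBound ops := by
  induction ops generalizing c v φ with
  | nil => exact ⟨v, 0, φ, .nil, hc, h, by simp [Config.totalBound]⟩
  | cons op ops ih =>
    obtain ⟨hA, hc', hops⟩ := hops
    obtain ⟨v₁, t₁, φ₁, h1, hv₁, hb₁⟩ := step_spec hc h op hA
    obtain ⟨v₂, t₂, φ₂, h2, hw, hv₂, hb₂⟩ := ih hc' hops hv₁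
    refine ⟨v₂, t₁ + t₂, φ₂, .cons h1 h2, hw, hv₂, ?_⟩
    rw [Config.totalBound]
    push_cast at hb₁ hb₂ ⊢
    linarith

theorem exists_strictSorted (P : Finset Pt) : ∃ L, StrictSorted L ∧ L.toFinset = P := by
  obtain ⟨L, t, -, -, hp, hL⟩ := sort_spec hasTreeFuns (d := 1) le_rfl (by norm_num) P.toList
  refine ⟨L, ?_, by rw [List.toFinset_eq_of_perm _ _ hp, Finset.toList_toFinset]⟩
  have hn : L.Nodup := hp.nodup_iff.2 P.nodup_toList
  exact (hL.and hn).imp fun h => lt_of_le_of_ne h.1 fun e => h.2 (key_one_injective e)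

/-- The building function of the program itself supplies the tree, with all counters at 0 and hence
without potential. -/
theorem exists_rep (P : Finset Pt) : ∃ v, Rep 3 v P 0 := by
  obtain ⟨L, hL, rfl⟩ := exists_strictSorted P
  obtain ⟨v, t, s, -, hT, -⟩ := buildSpec le_rfl L hL
  exact ⟨v, s, hT.mono (by rw [List.toFinset_card_of_nodup hL.nodup]; omega)⟩

theorem exists_stored (c : Config) :
    ∃ v, (c = Config.empty → v = .nil) ∧ Stored v c.points 0 := by
  by_cases hc : c = Config.empty
  · refine ⟨.nil, fun _ => rfl, .inr ⟨rfl, ?_, rfl⟩⟩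
    rw [hc]; rfl
  · obtain ⟨u, hu⟩ := exists_rep c.points
    obtain ⟨v, hv⟩ := exists_rep (rotate c.points)
    obtain ⟨w, hw⟩ := exists_rep (rotate (rotate c.points))
    exact ⟨_, fun h => absurd h hc, .inl ⟨u, v, w, 0, 0, 0, rfl, hu, hv, hw, rfl⟩⟩

theorem Stored.size_le {c : Config} (hc : c.WellFormed) {v : Val} {φ : ℕ}
    (h : Stored v c.points φ) : (v.size : ℝ) ≤ totalConst * c.sizeBound := by
  have h1 := one_le_maxDepth_cubed c.m
  have hM := hc.card_points_le
  have hD := depthBound_le_maxDepth c.m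
  have hn := Config.card_points_le c
  have key : v.size ≤ (3 * sizeConst 3 + 5) * maxDepth c.m ^ 3 * (c.m + c.z + 1) := by
    rcases h with ⟨a, b, d, φa, φb, φc, rfl, ha, hb, hd, -⟩ | ⟨rfl, -, -⟩
    · have e1 := ha.size_le hD hM
      have e2 := hb.size_le hD (by rwa [card_rotate])
      have e3 := hd.size_le hD (by rwa [card_rotate, card_rotate])
      rw [card_rotate] at e2
      rw [card_rotate, card_rotate] at e3
      simp only [Val.size]
      have e4 : sizeConst 3 * maxDepth c.m ^ 3 * c.points.card ≤
          sizeConst 3 * maxDepth c.m ^ 3 * (c.m + c.z + 1) :=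
        Nat.mul_le_mul_left _ (by omega)
      have e5 : 1 ≤ maxDepth c.m ^ 3 * (c.m + c.z + 1) := Nat.mul_pos h1 (by omega)
      have e6 : (3 * sizeConst 3 + 5) * maxDepth c.m ^ 3 * (c.m + c.z + 1) =
        3 * (sizeConst 3 * maxDepth c.m ^ 3 * (c.m + c.z + 1)) +
          5 * (maxDepth c.m ^ 3 * (c.m + c.z + 1)) := by ring
      omega
    · exact Nat.mul_pos (Nat.mul_pos (by omega) h1) (by omega)
  have h2 : ((3 * sizeConst 3 + 5) * maxDepth c.m ^ 3 * (c.m + c.z + 1) : ℕ) =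
      ((((3 * sizeConst 3 + 5) * maxDepth c.m ^ 3 : ℕ) : ℝ) * (c.m + c.z + 1)) := by push_cast; ring
  calc (v.size : ℝ) ≤ (((3 * sizeConst 3 + 5) * maxDepth c.m ^ 3 * (c.m + c.z + 1) : ℕ) : ℝ) := by
        exact_mod_cast key
    _ ≤ totalConst * logCubed c.m * (c.m + c.z + 1) := by
        rw [h2]
        exact mul_le_mul_of_nonneg_right (mul_maxDepth_le (by omega) _) (by positivity)
    _ = totalConst * c.sizeBound := by rw [Config.sizeBound]; ring

end SquareDS

theorem mainTheorem5 :
    ∃ (D : SquareDS.Implementation) (K : ℝ), ∀ c : SquareDS.Config, c.WellFormed →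
      ∃ v₀ : SquareDS.Val, (c = SquareDS.Config.empty → v₀ = SquareDS.Val.nil) ∧
        ∀ ops : List SquareDS.Op, c.Valid ops →
          ∃ (v : SquareDS.Val) (t : ℕ), D.Run c v₀ ops v t ∧
            (v.size : ℝ) ≤ K * (c.applyAll ops).sizeBound ∧
            (t : ℝ) ≤ K * c.totalBound ops := by
  refine ⟨SquareDS.implementation, SquareDS.totalConst, fun c hc => ?_⟩
  obtain ⟨v₀, hv₀, hst⟩ := SquareDS.exists_stored c
  refine ⟨v₀, hv₀, fun ops hops => ?_⟩
  obtain ⟨v, t, φ, hrun, hw, hv, hb⟩ := SquareDS.run_spec ops hc hops hst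
  refine ⟨v, t, hrun, hv.size_le hw, ?_⟩
  push_cast at hb
  -- The initial potential is 0 and the final one is nonnegative, so the amortized bound holds for
  -- the actual number of steps.
  linarith [Nat.cast_nonneg (α := ℝ) φ]
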